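/- Let $\Lambda,m>0$, $a\in\mathbb R$, and suppose that $\mu(r)=-\tfrac{\Lambda r^4}{3}+\bigl(1-\tfrac{\Lambda a^2}{3}\bigr)r^2-2mr+a^2$ has four distinct real roots $r_-<r_C<r_e<r_c$. Put $b=1+\tfrac{\Lambda a^2}{3}$, $c(\theta)=1+\tfrac{\Lambda a^2}{3}\cos^2\theta$, $\rho^2=r^2+a^2\cos^2\theta$. Let $\delta>0$ with $r_e-\delta>r_C$, let $f$ be real analytic on $(r_e-\delta,r_c+\delta)$ with $f(r_e)=-1$, $f(r_c)=1$, and let $M_*=\mathbb R_{t_*}\times(r_e-\delta,r_c+\delta)_r\times S^2_{\phi_*,\theta}$ carry the extended Kerr--de Sitter metric $$g_*=\rho^2\tfrac{1-f^2}{\mu}\,dr^2-\tfrac2b f\,(dt_*-a\sin^2\theta\, d\phi_*)\,dr-\tfrac{\mu}{b^2\rho^2}(dt_*-a\sin^2\theta\, d\phi_*)^2+\tfrac{c\sin^2\theta}{b^2\rho^2}\bigl(a\,dt_*-(r^2+a^2)d\phi_*\bigr)^2+\tfrac{\rho^2}{c}d\theta^2,$$ where $f$ is such that the level sets of $t_*$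 are spacelike. Let $G_*$ be the dual metric and let $M=\{r_e<r<r_c\}$ be the domain of outer communication. Let $A\in C^\infty(M_*;\mathbb C)$ with $\partial_{t_*}A=\partial_{\phi_*}A=0$, let $P=\Box+A$, where the sign of $\Box$ is such that its principal symbol is $G_*(\xi,\xi)$, let $r_0\in[r_e,r_c]$, $\mathrm T=\partial_{t_*}+\tfrac{a}{r_0^2+a^2}\partial_{\phi_*}$, $\sigma\in\mathbb C$, and let $P_\sigma v=e^{i\sigma t_*}P(e^{-i\sigma t_*}v)$ for $\mathrm Tv=0$, regarded as an operator on $L_*=\{t_*=0\}=(r_e-\delta,r_c+\delta)\times S^2$ with principal symbol $p$. Let $\mathrm{Char}(P_\sigma)=\{p=0\}\subset T^*L_*\setminus0$. Its bicharacteristics are the integral curves in $\mathrm{Char}(P_\sigma)$ of the Hamilton vector field $H_p=\sum_j(\partial_{\xi_j}p)\partial_{x_j}-(\partial_{x_j}p)\partial_{\xi_j}$, and are taken to be maximal. Let $\Sigma_\pm=\{\xi\in\mathrm{Char}(P_\sigma):\pm G_*(dt_*,\xi)>0\}$, where $\xi$ is extended to $T M_*$ by $\xi(\mathrm T)=0$,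 and $\xi_r=\xi(\partial_r)$. Conormal bundles are taken in $T^*L_*\setminus 0$. A curve starts (ends) at the fiber infinity of a conic set $S$ if, towards the start (end) of its parameter interval, $|\xi|\to\infty$ and $(x,\xi/|\xi|)$ tends to the set of unit covectors in $S$. A conic set $S\subset\mathrm{Char}(P_\sigma)$ is called \emph{radial in the generalized sense} if it is invariant under the flow and, for some smooth positive function $\tilde\rho$, defined on a conic neighborhood of $S$ and homogeneous of degree $-1$, $H_p\tilde\rho\neq0$ on $S$. It is (at fiber infinity) a \emph{generalized normal source} (\emph{sink}) if, in addition, for some such $\tilde\rho$ there are a nonnegative, nondegenerate quadratic defining function $\rho_0$ of $S$, homogeneous of degree $0$, and $\beta_1>0$ with $\pm H_p\tilde\rho>0$ on $S$ and $\pm\tilde\rho H_p\rho_0\ge\beta_1\rho_0$ near $S$, with the upper sign for a source and the lower sign for a sink. It is \emph{exactly radial} if on $S$ the field $H_p$ is a nonzero multiple of the generator of dilations in the fibers. It is a \emph{stable radial source} (\emph{sink}) if it is exactly radial, a generalized normal source (sink), and for every conic neighborhood $U$ of $S$ there is a conic neighborhood $W$ of $S$ such that each bicharacteristic which is in $W$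 at some parameter value stays in $U$ at all earlier (later) ones and starts (ends) at the fiber infinity of $S$. Then the following hold. 1. $N^*\{r=r_e\}$ and $N^*\{r=r_c\}$ are contained in $\mathrm{Char}(P_\sigma)$ and are radial in the generalized sense. 2. Every other bicharacteristic in $\Sigma_+$ either starts at the fiber infinity of $N^*\{r=r_e\}\cap\{\xi_r>0\}$ and ends (in finite parameter time) at $r=r_e-\delta$, or starts at the fiber infinity of $N^*\{r=r_c\}\cap\{\xi_r<0\}$ and ends at $r=r_c+\delta$. Every other bicharacteristic in $\Sigma_-$ either starts at $r=r_e-\delta$ and ends at the fiber infinity of $N^*\{r=r_e\}\cap\{\xi_r<0\}$, or starts at $r=r_c+\delta$ and ends at the fiber infinity of $N^*\{r=r_c\}\cap\{\xi_r>0\}$. 3. $N^*\{r=r_e\}\cap\{\xi_r>0\}$ and $N^*\{r=r_c\}\cap\{\xi_r<0\}$ are generalized normal sources, and $N^*\{r=r_e\}\cap\{\xi_r<0\}$ and $N^*\{r=r_c\}\cap\{\xi_r>0\}$ are generalized normal sinks. 4. If $r_0=r_e$, then no bicharacteristic between the fiber infinity of $N^*\{r=r_e\}$ and $\{r=r_e-\delta\}$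 (in either direction) meets $M$, the flow is exactly radial at $N^*\{r=r_e\}$, and $N^*\{r=r_e\}\cap\{\xi_r>0\}$ is a stable radial source and $N^*\{r=r_e\}\cap\{\xi_r<0\}$ a stable radial sink. 5. If $r_0=r_c$, then no bicharacteristic between the fiber infinity of $N^*\{r=r_c\}$ and $\{r=r_c+\delta\}$ (in either direction) meets $M$, the flow is exactly radial at $N^*\{r=r_c\}$, and $N^*\{r=r_c\}\cap\{\xi_r<0\}$ is a stable radial source and $N^*\{r=r_c\}\cap\{\xi_r>0\}$ a stable radial sink. -/

import Mathlib

noncomputable section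

namespace KdS

/-- Euclidean three-space; the sphere `S²` is its unit sphere. -/
abbrev V : Type := EuclideanSpace ℝ (Fin 3)

/-- Points `(t_*, r, ω)` of the extended spacetime (with `ω` a unit vector), and also its tangent
vectors `(τ, ϱ, v)` (with `v ⊥ ω`) and covectors `(ξ_t, ξ_r, η)`, where `η` acts on `v` by the
Euclidean inner product, so that only its component orthogonal to `ω` matters. -/
abbrev Pt : Type := ℝ × ℝ × V

/-- Points `(r, ω)` of the hypersurface `{t_* = 0}`, and its (co)tangent vectors. -/
abbrev LPt : Type := ℝ × V

/-- Pairs (point, covector) `((r, ω), (ξ_r, η))`. The cotangent bundle of the hypersurface consists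
of those with `‖ω‖ = 1` and `η ⊥ ω`. -/
abbrev Phase : Type := LPt × LPt

/-! ### The spacetime -/

/-- The data of a Kerr--de Sitter spacetime extended over the future horizons: the parameters, the
four roots `r_- < r_C < r_e < r_c` of `μ`, the width `δ` of the extension and the function `f` in
the coordinate change. The conditions on them are in `Data.Subextremal`. -/
structure Data where
  Λ : ℝ
  a : ℝ
  m : ℝ
  rNeg : ℝ
  rC : ℝ
  re : ℝ
  rc : ℝ
  δ : ℝ
  f : ℝ → ℝ

variable (K : Data)

/-- `μ(r) = -Λ r⁴/3 + (1 - Λ a²/3) r² - 2 m r + a²`. -/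
def Data.mu (r : ℝ) : ℝ :=
  -(K.Λ * r ^ 4 / 3) + (1 - K.Λ * K.a ^ 2 / 3) * r ^ 2 - 2 * K.m * r + K.a ^ 2

/-- `b = 1 + Λ a²/3`. -/
def Data.b : ℝ := 1 + K.Λ * K.a ^ 2 / 3

/-- `c(θ) = 1 + (Λ a²/3) cos² θ`, where `cos θ` is the third coordinate of `ω`. -/
def Data.c (ω : V) : ℝ := 1 + K.Λ * K.a ^ 2 / 3 * ω 2 ^ 2

/-- `r² + a² cos² θ`. -/
def Data.rho2 (r : ℝ) (ω : V) : ℝ := r ^ 2 + K.a ^ 2 * ω 2 ^ 2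

/-- The analytic extension of `(1 - f²)/μ` over the zeros of `μ` (where `f² = 1`); the value there
is given by l'Hôpital's rule. -/
def Data.h (r : ℝ) : ℝ :=
  if K.mu r = 0 then -(2 * K.f r * deriv K.f r) / deriv K.mu r else (1 - K.f r ^ 2) / K.mu r

/-- The rotation vector field `∂_{φ_*}` on `S²`. -/
def dPhi (ω : V) : V := !₂[-ω 1, ω 0, 0]

/-- `η(∂_{φ_*})`, i.e. `ξ_{φ_*}` for a covector `η`, and `sin² θ dφ_*(v)` for a tangent
vector `v`. -/
def phiComp (ω η : V) : ℝ := ω 0 * η 1 - ω 1 * η 0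

/-- The metric `g_*` at the point `y`, polarized, in a form that is regular at the poles:
with `κ = sin² θ dφ_*`, the identities `dθ² + sin² θ dφ_*² = |dω|²` and
`c (r² + a²) - b (r² + a² cos² θ) = a² sin² θ (1 - Λ r²/3)` give
`(c sin² θ / (b² ρ²)) (a dt_* - (r² + a²) dφ_*)² + ρ² dθ² / c`
`= (c / (b² ρ²)) (a² sin² θ dt_*² - 2 a (r² + a²) dt_* κ) + (ρ² / c) |dω|²`
`+ (a² (1 - Λ r²/3) (c (r² + a²) + b ρ²) / (b² c ρ²)) κ²`, where `ρ² = r² + a² cos² θ`. -/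
def Data.gStar (y w w' : Pt) : ℝ :=
  let r := y.2.1
  let ω := y.2.2
  let κ := phiComp ω w.2.2
  let κ' := phiComp ω w'.2.2
  K.rho2 r ω * K.h r * w.2.1 * w'.2.1
    - K.f r / K.b * ((w.1 - K.a * κ) * w'.2.1 + (w'.1 - K.a * κ') * w.2.1)
    - K.mu r / (K.b ^ 2 * K.rho2 r ω) * ((w.1 - K.a * κ) * (w'.1 - K.a * κ'))
    + K.c ω / (K.b ^ 2 * K.rho2 r ω) *
        (K.a ^ 2 * (1 - ω 2 ^ 2) * w.1 * w'.1
          - K.a * (r ^ 2 + K.a ^ 2) * (w.1 * κ' + κ * w'.1))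
    + K.rho2 r ω / K.c ω * inner ℝ w.2.2 w'.2.2
    + K.a ^ 2 * (1 - K.Λ * r ^ 2 / 3) * (K.c ω * (r ^ 2 + K.a ^ 2) + K.b * K.rho2 r ω) /
        (K.b ^ 2 * K.c ω * K.rho2 r ω) * (κ * κ')

/-- The pairing of a covector with a tangent vector of spacetime. -/
def pairM (ξ w : Pt) : ℝ := ξ.1 * w.1 + ξ.2.1 * w.2.1 + inner ℝ ξ.2.2 w.2.2

/-- The index-raising map of `g_*` at `y`: the tangent vector `ξ♯` with `g_*(ξ♯, w) = ξ(w)` for all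
tangent `w`; see `sharp_tangent` and `gStar_sharp`. -/
def Data.sharp (y ξ : Pt) : Pt :=
  let r := y.2.1
  let ω := y.2.2
  let ξφ := phiComp ω ξ.2.2
  let X := (r ^ 2 + K.a ^ 2) * ξ.1 + K.a * ξφ
  (K.rho2 r ω)⁻¹ •
    ( -(K.b * K.f r * (r ^ 2 + K.a ^ 2) * ξ.2.1) - K.b ^ 2 * K.h r * (r ^ 2 + K.a ^ 2) * X
        + K.b ^ 2 / K.c ω * (K.a * ξφ + K.a ^ 2 * (1 - ω 2 ^ 2) * ξ.1),
      K.mu r * ξ.2.1 - K.b * K.f r * X,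
      K.c ω • (ξ.2.2 - (inner ℝ ω ξ.2.2 : ℝ) • ω)
        + (-(K.a * K.b * K.f r * ξ.2.1) - K.a * K.b ^ 2 * K.h r * X
            + K.Λ * K.a ^ 2 / 3 * (K.b + K.c ω) / K.c ω * ξφ
            + K.a * K.b ^ 2 / K.c ω * ξ.1) • dPhi ω )

/-- The dual metric `G_*(ξ, ξ')` at `y`. -/
def Data.GStar (y ξ ξ' : Pt) : ℝ := pairM ξ (K.sharp y ξ')

theorem sharp_tangent (y ξ : Pt) (hω : ‖y.2.2‖ = 1) :
    inner ℝ y.2.2 (K.sharp y ξ).2.2 = 0 := by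
  have h1 : inner ℝ y.2.2 (dPhi y.2.2) = 0 := by
    simp [dPhi, PiLp.inner_apply, Fin.sum_univ_three]; ring
  simp [Data.sharp, inner_add_right, inner_sub_right, inner_smul_right, h1, hω]

theorem gStar_sharp (y ξ w : Pt) (hω : ‖y.2.2‖ = 1) (hw : inner ℝ y.2.2 w.2.2 = 0)
    (hΛ : 0 < K.Λ) (hr : 0 < y.2.1) (hf : K.mu y.2.1 = 0 → K.f y.2.1 ^ 2 = 1) :
    K.gStar y (K.sharp y ξ) w = pairM ξ w := by
  obtain ⟨t, r, ω⟩ := y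
  obtain ⟨ξt, ξr, η⟩ := ξ
  obtain ⟨τ, ϱ, v⟩ := w
  simp only at hω hw hr hf
  have hs : ω 0 ^ 2 + ω 1 ^ 2 = 1 - ω 2 ^ 2 := by
    have := EuclideanSpace.norm_sq_eq ω
    simp [hω, Fin.sum_univ_three] at this
    linarith
  have hmuh : K.mu r * K.h r = 1 - K.f r ^ 2 := by
    unfold Data.h
    split_ifs with h
    · rw [h, hf h]; ring
    · field_simp
  have hdv : inner ℝ (dPhi ω) v = phiComp ω v := by
    simp [dPhi, phiComp, PiLp.inner_apply, Fin.sum_univ_three]; ring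
  have hκ : ∀ (A B x : ℝ), phiComp ω (x • (A • (η - (inner ℝ ω η : ℝ) • ω) + B • dPhi ω))
      = x * (A * phiComp ω η + B * (1 - ω 2 ^ 2)) := by
    intro A B x
    rw [← hs]
    simp [dPhi, phiComp]; ring
  have hρ : 0 < K.rho2 r ω := by unfold Data.rho2; positivity
  have hb : 0 < K.b := by unfold Data.b; positivity
  have hc : 0 < K.c ω := by unfold Data.c; positivity
  simp only [Data.gStar, Data.sharp, pairM, Prod.smul_mk, smul_eq_mul, hκ]
  simp only [inner_smul_left, inner_add_left, inner_sub_left, hw, hdv, RCLike.conj_to_real]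
  have e1 : K.c ω = 1 + K.Λ * K.a ^ 2 / 3 * ω 2 ^ 2 := rfl
  have e2 : K.b = 1 + K.Λ * K.a ^ 2 / 3 := rfl
  have e3 : K.rho2 r ω = r ^ 2 + K.a ^ 2 * ω 2 ^ 2 := rfl
  generalize K.c ω = c at *
  generalize K.b = b at *
  generalize K.rho2 r ω = R at *
  generalize K.mu r = mu at *
  generalize K.h r = h at *
  generalize K.f r = f at *
  generalize phiComp ω v = κ at *
  generalize phiComp ω η = ξφ at *
  generalize (inner ℝ η v : ℝ) = ηv at *
  generalize ω 2 = z at *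
  field_simp
  have key : mu * h + f ^ 2 - 1 = 0 := by linarith
  subst e1 e2 e3
  linear_combination (9 * (r ^ 2 + K.a ^ 2 * z ^ 2) ^ 2 * (1 + K.Λ * K.a ^ 2 / 3) ^ 2
    * (1 + K.Λ * K.a ^ 2 / 3 * z ^ 2) ^ 2 * ξr * ϱ
    + 9 * (r ^ 2 + K.a ^ 2 * z ^ 2) * (1 + K.Λ * K.a ^ 2 / 3) ^ 2
    * (1 + K.Λ * K.a ^ 2 / 3 * z ^ 2) ^ 2 * ((r ^ 2 + K.a ^ 2) * ξt + K.a * ξφ)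
    * (τ - K.a * κ)) * key

/-- The standing assumptions: `μ` has four distinct real roots; `f` is real analytic on
`(r_e - δ, r_c + δ)` with `f(r_e) = -1`, `f(r_c) = 1`; `δ` is so small that `dr` is timelike, i.e.
`μ < 0`, on `[r_e - δ, r_e)` (and hence on `(r_c, r_c + δ]`), so that the boundary hypersurfaces are
spacelike; and the level sets of `t_*` are spacelike, i.e. `dt_*` is timelike. -/
structure Data.Subextremal : Prop where
  Λ_pos : 0 < K.Λ
  m_pos : 0 < K.m
  rNeg_lt : K.rNeg < K.rC
  rC_lt : K.rC < K.re
  re_lt : K.re < K.rc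
  mu_rNeg : K.mu K.rNeg = 0
  mu_rC : K.mu K.rC = 0
  mu_re : K.mu K.re = 0
  mu_rc : K.mu K.rc = 0
  δ_pos : 0 < K.δ
  δ_small : K.rC < K.re - K.δ
  f_analytic : AnalyticOnNhd ℝ K.f (Set.Ioo (K.re - K.δ) (K.rc + K.δ))
  f_re : K.f K.re = -1
  f_rc : K.f K.rc = 1
  spacelike : ∀ y : Pt, y.2.1 ∈ Set.Ioo (K.re - K.δ) (K.rc + K.δ) → ‖y.2.2‖ = 1 →
    K.GStar y (1, 0, 0) (1, 0, 0) < 0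

/-! ### The wave operator and the operators `P_σ` -/

/-- Extension of a function on the spacetime to non-unit `ω`, constant along rays. -/
def ext {F : Type*} (u : Pt → F) : Pt → F := fun y => u (y.1, y.2.1, ‖y.2.2‖⁻¹ • y.2.2)

/-- The differential of a real function on the spacetime, as a covector. -/
def dM (u : Pt → ℝ) (y : Pt) : Pt :=
  (fderiv ℝ (ext u) y (1, 0, 0), fderiv ℝ (ext u) y (0, 1, 0),
    WithLp.toLp 2 fun i => fderiv ℝ (ext u) y (0, 0, EuclideanSpace.single i 1))

/-- The divergence of a tangent vector field with respect to the product volume `dt_* dr dω`, with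
`dω` the round area of `S²`: the Euclidean divergence of the extension constant along rays. -/
def divM (W : Pt → Pt) (y : Pt) : ℝ :=
  fderiv ℝ (fun y' => (ext W y').1) y (1, 0, 0)
    + fderiv ℝ (fun y' => (ext W y').2.1) y (0, 1, 0)
    + ∑ i : Fin 3, fderiv ℝ (fun y' => (ext W y').2.2 i) y (0, 0, EuclideanSpace.single i 1)

/-- The d'Alembert operator `□ = -div grad` on real functions, with the sign for which its principal
symbol is `G_*`. The volume form of `g_*` is `b⁻² (r² + a² cos² θ) dt_* dr dω`. -/
def Data.boxReal (u : Pt → ℝ) (y : Pt) : ℝ :=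
  -((K.rho2 y.2.1 y.2.2)⁻¹ *
    divM (fun y' => K.rho2 y'.2.1 y'.2.2 • K.sharp y' (dM u y')) y)

/-- The d'Alembert operator on complex functions. -/
def Data.box (u : Pt → ℂ) (y : Pt) : ℂ :=
  (K.boxReal (fun y' => (u y').re) y : ℂ) + Complex.I * (K.boxReal (fun y' => (u y').im) y : ℂ)

/-- The wave operator `P = □ + A`. -/
def Data.waveOp (A : Pt → ℂ) (u : Pt → ℂ) (y : Pt) : ℂ := K.box u y + A y * u y

/-- `A` is a smooth function on the spacetime with `∂_{t_*} A = ∂_{φ_*} A = 0`. -/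
structure Data.IsPotential (A : Pt → ℂ) : Prop where
  smooth : ContDiffOn ℝ ((⊤ : ℕ∞) : WithTop ℕ∞) (ext A)
    {y : Pt | y.2.1 ∈ Set.Ioo (K.re - K.δ) (K.rc + K.δ) ∧ y.2.2 ≠ 0}
  dt_zero : ∀ y : Pt, y.2.1 ∈ Set.Ioo (K.re - K.δ) (K.rc + K.δ) → ‖y.2.2‖ = 1 →
    fderiv ℝ (ext A) y (1, 0, 0) = 0
  dphi_zero : ∀ y : Pt, y.2.1 ∈ Set.Ioo (K.re - K.δ) (K.rc + K.δ) → ‖y.2.2‖ = 1 →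
    fderiv ℝ (ext A) y (0, 0, dPhi y.2.2) = 0

/-- The angular velocity `a/(r₀² + a²)`, so that `T = ∂_{t_*} + angVel ∂_{φ_*}`. -/
def Data.angVel (r₀ : ℝ) : ℝ := K.a / (r₀ ^ 2 + K.a ^ 2)

/-- Rotation about the third axis by the angle `α`: the flow of `∂_{φ_*}`. -/
def rot (α : ℝ) (ω : V) : V :=
  !₂[Real.cos α * ω 0 - Real.sin α * ω 1, Real.sin α * ω 0 + Real.cos α * ω 1, ω 2]

/-- The function on spacetime with `T v = 0` that restricts to the given function on
`{t_* = 0}`. -/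
def Data.lift (r₀ : ℝ) (v : LPt → ℂ) : Pt → ℂ :=
  fun y => v (y.2.1, rot (-(K.angVel r₀ * y.1)) y.2.2)

/-- `P_σ v = e^{iσt_*} P (e^{-iσt_*} v)`, for `T v = 0`, as an operator on functions on
`{t_* = 0}`. -/
def Data.Psigma (r₀ : ℝ) (A : Pt → ℂ) (σ : ℂ) (v : LPt → ℂ) (x : LPt) : ℂ :=
  let y : Pt := (0, x.1, x.2)
  Complex.exp (Complex.I * σ * (y.1 : ℂ)) *
    K.waveOp A (fun y' => Complex.exp (-(Complex.I * σ * (y'.1 : ℂ))) * K.lift r₀ v y') y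

/-! ### Principal symbol, Hamilton flow, bicharacteristics -/

/-- The pairing of a covector with a vector of the hypersurface. -/
def pairL (ξ v : LPt) : ℝ := ξ.1 * v.1 + inner ℝ ξ.2 v.2

/-- The principal symbol of a differential operator `Q` of order two on the hypersurface,
`σ₂(Q)(x, dψ(x)) = (i²/2!) Q((ψ - ψ(x))²)(x)`, here with `ψ` the linear function of differential
`ξ`. (With this convention the symbol of `-i∂_j` is `ξ_j`.) -/
def principalSymbol (Q : (LPt → ℂ) → LPt → ℂ) (q : Phase) : ℂ :=
  Complex.I ^ 2 / 2 * Q (fun x => ((pairL q.2 (x - q.1) : ℝ) : ℂ) ^ 2) q.1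

/-- The cotangent bundle, without the zero section, of the hypersurface
`L_* = {t_* = 0} = (r_e - δ, r_c + δ) × S²`. -/
def Data.cotangent : Set Phase :=
  {q | q.1.1 ∈ Set.Ioo (K.re - K.δ) (K.rc + K.δ) ∧ ‖q.1.2‖ = 1 ∧ inner ℝ q.1.2 q.2.2 = 0 ∧ q.2 ≠ 0}

/-- The principal symbol of `P_σ`. -/
def Data.symb (r₀ : ℝ) (A : Pt → ℂ) (σ : ℂ) : Phase → ℂ :=
  principalSymbol (K.Psigma r₀ A σ)

/-- The characteristic set inside `D` of an operator with principal symbol `p`. -/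
def charSet (D : Set Phase) (p : Phase → ℂ) : Set Phase := {q | q ∈ D ∧ p q = 0}

/-- The pullback of a function on `T^*(ℝ × S²)` to `T^*(ℝ × (ℝ³ \ 0))` under the splitting
`T^*(ℝ³ \ 0) = T^*S² × T^*(0, ∞)` given by polar coordinates. -/
def pullback (p : Phase → ℂ) (q : Phase) : ℝ :=
  (p ((q.1.1, ‖q.1.2‖⁻¹ • q.1.2),
    (q.2.1, ‖q.1.2‖ • q.2.2 - ((inner ℝ q.1.2 q.2.2 : ℝ) / ‖q.1.2‖) • q.1.2))).re

/-- The Hamilton vector field `(∂_ξ p, -∂_x p)` of a (real) function `p` on `T^*(ℝ × S²)`. It is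
computed from the pullback above; since the polar coordinate splitting is symplectic, the Hamilton
vector field of the pullback is tangent to `T^*(ℝ × S²) = {‖ω‖ = 1, η ⊥ ω}`, and its restriction is
the Hamilton vector field of `p` there. -/
def ham (p : Phase → ℂ) (q : Phase) : Phase :=
  ((deriv (fun s => pullback p (q.1, (s, q.2.2))) q.2.1,
      gradient (fun η => pullback p (q.1, (q.2.1, η))) q.2.2),
    (-deriv (fun s => pullback p ((s, q.1.2), q.2)) q.1.1,
      -gradient (fun ω => pullback p ((q.1.1, ω), q.2)) q.1.2))

/-- `γ` restricted to the open interval `I` is a (null) bicharacteristic. -/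
structure IsBichar (D : Set Phase) (p : Phase → ℂ) (γ : ℝ → Phase) (I : Set ℝ) : Prop where
  isOpen : IsOpen I
  connected : IsConnected I
  mem_char : ∀ s ∈ I, γ s ∈ charSet D p
  hasDerivAt : ∀ s ∈ I, HasDerivAt γ (ham p (γ s)) s

/-- A bicharacteristic that is not a proper restriction of another one. -/
def IsMaximalBichar (D : Set Phase) (p : Phase → ℂ) (γ : ℝ → Phase) (I : Set ℝ) : Prop :=
  IsBichar D p γ I ∧
    ∀ γ' J, IsBichar D p γ' J → I ⊆ J → Set.EqOn γ γ' I → J = I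

/-- Along the filter `l`, the curve `c` tends to the fiber infinity of the conic set `S`: the
covector becomes infinite and its direction tends to the directions in `S`. -/
def TendsToFiberInfinity {ι : Type*} (S : Set Phase) (c : ι → Phase) (l : Filter ι) : Prop :=
  Filter.Tendsto (fun i => ‖(c i).2‖) l Filter.atTop ∧
  Filter.Tendsto
    (fun i => Metric.infDist ((c i).1, ‖(c i).2‖⁻¹ • (c i).2) (S ∩ {q | ‖q.2‖ = 1})) l (nhds 0)

/-- The curve `γ` on `I` starts at the fiber infinity of `S`. -/
def StartsAtInfinity (S : Set Phase) (γ : ℝ → Phase) (I : Set ℝ) : Prop :=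
  TendsToFiberInfinity S (fun s : I => γ s) Filter.atBot

/-- The curve `γ` on `I` ends at the fiber infinity of `S`. -/
def EndsAtInfinity (S : Set Phase) (γ : ℝ → Phase) (I : Set ℝ) : Prop :=
  TendsToFiberInfinity S (fun s : I => γ s) Filter.atTop

/-- The curve `γ` on `I` starts at the hypersurface `r = R`. -/
def StartsAtRadius (R : ℝ) (γ : ℝ → Phase) (I : Set ℝ) : Prop :=
  BddBelow I ∧ Filter.Tendsto (fun s : I => (γ s).1.1) Filter.atBot (nhds R)

/-- The curve `γ` on `I` ends at the hypersurface `r = R`. -/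
def EndsAtRadius (R : ℝ) (γ : ℝ → Phase) (I : Set ℝ) : Prop :=
  BddAbove I ∧ Filter.Tendsto (fun s : I => (γ s).1.1) Filter.atTop (nhds R)

/-! ### Radial sets -/

/-- A set that is invariant under dilations in the fibers. -/
def IsConic (U : Set Phase) : Prop := ∀ q ∈ U, ∀ t : ℝ, 0 < t → (q.1, t • q.2) ∈ U

/-- `ρ` is, on the conic set `U`, smooth, positive and homogeneous of degree `-1`: a defining function
of fiber infinity. -/
structure IsInfinityDefining (U : Set Phase) (ρ : Phase → ℝ) : Prop where
  smooth : ContDiffOn ℝ ((⊤ : ℕ∞) : WithTop ℕ∞) ρ U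
  pos : ∀ q ∈ U, 0 < ρ q
  homogeneous : ∀ q ∈ U, ∀ t : ℝ, 0 < t → ρ (q.1, t • q.2) = t⁻¹ * ρ q

/-- `ρ₀` is, on the conic set `U`, a smooth nonnegative quadratic defining function of `S`,
homogeneous of degree `0`: it vanishes exactly on `S`, and nondegenerately. -/
structure IsQuadraticDefining (D U S : Set Phase) (ρ₀ : Phase → ℝ) : Prop where
  smooth : ContDiffOn ℝ ((⊤ : ℕ∞) : WithTop ℕ∞) ρ₀ U
  homogeneous : ∀ q ∈ U, ∀ t : ℝ, 0 < t → ρ₀ (q.1, t • q.2) = ρ₀ q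
  nonneg : ∀ q ∈ U ∩ D, 0 ≤ ρ₀ q
  eq_zero_iff : ∀ q ∈ U ∩ D, (ρ₀ q = 0 ↔ q ∈ S)
  nondegenerate : ∃ C > 0, ∀ q ∈ U ∩ D, ‖q.2‖ = 1 → C * Metric.infDist q S ^ 2 ≤ ρ₀ q

/-- The flow is radial in the generalized sense at the conic set `S` for a second order symbol `p`:
`S` is characteristic and invariant, and on `S` the derivative `H_p ρ` of a suitable
defining function `ρ` of fiber infinity does not vanish. -/
def IsGeneralizedRadial (D : Set Phase) (p : Phase → ℂ) (S : Set Phase) : Prop :=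
  S ⊆ charSet D p ∧ IsConic S ∧
  (∀ γ I, IsBichar D p γ I → (∃ s ∈ I, γ s ∈ S) → ∀ s ∈ I, γ s ∈ S) ∧
  ∃ U ρ, IsOpen U ∧ IsConic U ∧ S ⊆ U ∧ IsInfinityDefining U ρ ∧
    ∀ q ∈ S, fderiv ℝ ρ q (ham p q) ≠ 0

/-- The fiber infinity of the conic set `S` is a generalized normal source (`ε = 1`) or sink
(`ε = -1`) for a second order symbol `p`: there are a defining function `ρ` of fiber infinity and a
quadratic defining function `ρ₀` of `S` with `ε H_p ρ > 0` on `S`, and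
`ε ρ H_p ρ₀ ≥ β₁ ρ₀` near `S` for some `β₁ > 0`. -/
def IsNormalSourceSink (ε : ℝ) (D : Set Phase) (p : Phase → ℂ) (S : Set Phase) : Prop :=
  IsGeneralizedRadial D p S ∧
  ∃ U ρ ρ₀, IsOpen U ∧ IsConic U ∧ S ⊆ U ∧ IsInfinityDefining U ρ ∧ IsQuadraticDefining D U S ρ₀ ∧
    (∀ q ∈ S, 0 < ε * fderiv ℝ ρ q (ham p q)) ∧
    ∃ β₁ > 0, ∀ q ∈ U ∩ D, β₁ * ρ₀ q ≤ ε * (ρ q * fderiv ℝ ρ₀ q (ham p q))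

/-- A generalized normal source. -/
def IsNormalSource : Set Phase → (Phase → ℂ) → Set Phase → Prop := IsNormalSourceSink 1

/-- A generalized normal sink. -/
def IsNormalSink : Set Phase → (Phase → ℂ) → Set Phase → Prop := IsNormalSourceSink (-1)

/-- The flow is exactly radial at `S`: there the Hamilton vector field is a nonzero multiple of the
generator of dilations in the fibers. -/
def IsExactlyRadial (p : Phase → ℂ) (S : Set Phase) : Prop :=
  ∀ q ∈ S, ∃ κ : ℝ, κ ≠ 0 ∧ ham p q = (0, κ • q.2)

/-- A stable radial source: the flow is exactly radial at `S`, the fiber infinity of `S` is a normal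
source, and, backwards along the flow, bicharacteristics close to it stay close to it and tend
to it. -/
def IsStableRadialSource (D : Set Phase) (p : Phase → ℂ) (S : Set Phase) : Prop :=
  IsExactlyRadial p S ∧ IsNormalSource D p S ∧
  ∀ U, IsOpen U → IsConic U → S ⊆ U → ∃ W, IsOpen W ∧ IsConic W ∧ S ⊆ W ∧
    ∀ γ I, IsMaximalBichar D p γ I → ∀ s₀ ∈ I, γ s₀ ∈ W →
      (∀ s ∈ I, s ≤ s₀ → γ s ∈ U) ∧ StartsAtInfinity S γ I

/-- A stable radial sink: as for sources, with the direction of the flow reversed. -/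
def IsStableRadialSink (D : Set Phase) (p : Phase → ℂ) (S : Set Phase) : Prop :=
  IsExactlyRadial p S ∧ IsNormalSink D p S ∧
  ∀ U, IsOpen U → IsConic U → S ⊆ U → ∃ W, IsOpen W ∧ IsConic W ∧ S ⊆ W ∧
    ∀ γ I, IsMaximalBichar D p γ I → ∀ s₀ ∈ I, γ s₀ ∈ W →
      (∀ s ∈ I, s₀ ≤ s → γ s ∈ U) ∧ EndsAtInfinity S γ I

/-! ### The sets in the statement -/

/-- The conormal bundle of `{r = R}` in the hypersurface, without the zero section. -/
def Data.conormal (R : ℝ) : Set Phase :=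
  {q | q ∈ K.cotangent ∧ q.1.1 = R ∧ q.2.2 = 0}

/-- The part `ξ_r > 0` of a set of covectors. -/
def posPart (S : Set Phase) : Set Phase := {q | q ∈ S ∧ 0 < q.2.1}

/-- The part `ξ_r < 0` of a set of covectors. -/
def negPart (S : Set Phase) : Set Phase := {q | q ∈ S ∧ q.2.1 < 0}

/-- The covector of the spacetime that annihilates `T` and restricts to the given covector on
`{t_* = 0}`. -/
def Data.toSpacetime (r₀ : ℝ) (q : Phase) : Pt :=
  (-(K.angVel r₀ * phiComp q.1.2 q.2.2), q.2.1, q.2.2)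

/-- `G_*(dt_*, ξ)`. -/
def Data.timeComp (r₀ : ℝ) (q : Phase) : ℝ :=
  K.GStar (0, q.1.1, q.1.2) (1, 0, 0) (K.toSpacetime r₀ q)

/-- `Σ_+`. -/
def Data.sigmaPos (r₀ : ℝ) (p : Phase → ℂ) : Set Phase :=
  {q | q ∈ charSet K.cotangent p ∧ 0 < K.timeComp r₀ q}

/-- `Σ_-`. -/
def Data.sigmaNeg (r₀ : ℝ) (p : Phase → ℂ) : Set Phase :=
  {q | q ∈ charSet K.cotangent p ∧ K.timeComp r₀ q < 0}

end KdS

end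

noncomputable section

namespace KdS

variable {K : Data}

/-! ### The radial functions -/

/-! Why it is true. The symbol separates. On covectors annihilating T, write L = ξ_φ, X = αL with α
= a(r₀² - r²)/(r₀² + a²), and h = (1 - f²)/μ. Then ρ²p = (μξ_r² - 2bf X ξ_r - b²h X²) + Q, where
Carter's constant Q involves only the sphere variables (`GStar_toSpacetime`, `symb_eq`). On the
characteristic set the Hamilton field of p is that of ρ²p divided by ρ², so L and Q are conserved,
and the radial motion is one-dimensional: Y = ½ ∂(ρ²p)/∂ξ_r satisfies r' = 2Y/ρ², Y' = V'(r)/ρ² and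
Y² = V(r) = b²α²L² - μQ. Since Q is a positive definite quadratic form in η (`carter_lower`), the
characteristic set has Q = 0 exactly on the conormal bundles of the two horizons. Everywhere else Q
> 0, and conservation of Q keeps η bounded.

For Q > 0 three facts determine the global behaviour. (1) The radius never equals r₀: there α = 0
and μ ≥ 0, so ρ²p ≥ Q > 0 (`radius_ne`). Hence a curve stays on one side of r₀, and that side
contains at most one horizon R in its closure that matters, encoded with a sign τ in `Data.IsSide`.
(2) There is no trapping. From the factorization of μ, 4rμ - (r² - r₀²)μ' > 0 between the horizons
(`no_trapping`), so the zeros of V are simple and V' has there the sign of r - r₀ when r ≠ r₀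
(`dpot_of_pot_eq_zero`). Thus Y changes sign at most once, r and Y converge, the parameter interval
is bounded at that end, and r tends either to the boundary R - τδ or to R (`forward_limit`). (3) The
function E = bfξ_r + b²hX satisfies E² = b²(ξ_r² + hQ). Spacelike level sets of t_* give h > 0, so E
has no zeros, and its sign is opposite to that of G_*(dt_*, ξ) (`timeComp_energy`). For E < 0 the
curve moves outwards at and beyond the horizon, and a line that stays inside would have to move
inwards near it. So the forward limit is the boundary. For E > 0 motion beyond the horizon is
inwards, so the forward limit is the horizon. There E → ∞, and bξ_r = fE + bhY with f(R) = -τ gives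
the sign of the infinite ξ_r. Backward ends follow by reversing time and the covector.

Radial sets. On the conormal bundle ξ_r' = -μ'(R)ξ_r²/ρ² with μ'(R) ≠ 0, so |ξ_r|⁻¹ is the required
defining function of fiber infinity. The quadratic defining function is Q/ξ_r² + N(p/ξ_r²)². Its
second term is needed because the estimate is required in a full neighbourhood, where p is not zero
and, together with Q, controls r - R. The cross term coming from Q not being conserved off {p = 0}
is absorbed by taking N large.

If r₀ = R, then α vanishes at the horizon. This removes the rotation of the flow on the conormal
bundle, which becomes exactly radial. The barrier r ≠ r₀ is then the horizon itself, so curves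
cannot cross it. Near R a characteristic covector with Q > 0 lies outside and is almost conormal,
which gives stability (`exists_near_horizon`, `exists_stable_neighborhood`). -/

/-- The interval of radii of the extended spacetime. -/
def Data.dom (K : Data) : Set ℝ := Set.Ioo (K.re - K.δ) (K.rc + K.δ)

/-- The derivative of `μ`. -/
def Data.dmu (K : Data) (r : ℝ) : ℝ :=
  -(4 * K.Λ * r ^ 3 / 3) + 2 * (1 - K.Λ * K.a ^ 2 / 3) * r - 2 * K.m

theorem hasDerivAt_mu (r : ℝ) : HasDerivAt K.mu (K.dmu r) r := by
  have h := ((((((hasDerivAt_id r).pow 4).const_mul K.Λ).div_const 3).neg).add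
    (((hasDerivAt_id r).pow 2).const_mul (1 - K.Λ * K.a ^ 2 / 3))).sub
    ((hasDerivAt_id r).const_mul (2 * K.m)) |>.add_const (K.a ^ 2)
  refine HasDerivAt.congr_deriv h ?_
  simp [Data.dmu]
  ring

theorem deriv_mu (r : ℝ) : deriv K.mu r = K.dmu r := (hasDerivAt_mu r).deriv

theorem contDiff_mu {n : WithTop ℕ∞} : ContDiff ℝ n K.mu := by
  unfold Data.mu; fun_prop

theorem contDiff_dmu {n : WithTop ℕ∞} : ContDiff ℝ n K.dmu := by
  unfold Data.dmu; fun_prop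

namespace Data.Subextremal

variable (hK : K.Subextremal)
include hK

/-- A quartic with four distinct roots and no cubic term: the coefficients in terms of the roots. -/
theorem vieta : K.rNeg = -(K.rC + K.re + K.rc) ∧
    (∀ r, K.mu r = -(K.Λ / 3) * ((r - K.rNeg) * (r - K.rC) * (r - K.re) * (r - K.rc))) := by
  have h1 := hK.mu_rNeg
  have h2 := hK.mu_rC
  have h3 := hK.mu_re
  have h4 := hK.mu_rc
  have l1 := hK.rNeg_lt
  have l2 := hK.rC_lt
  have l3 := hK.re_lt
  have hΛ := hK.Λ_pos
  unfold Data.mu at *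
  generalize K.rNeg = x1 at *
  generalize K.rC = x2 at *
  generalize K.re = x3 at *
  generalize K.rc = x4 at *
  generalize K.Λ = Λ at *
  generalize hB : 1 - Λ * K.a ^ 2 / 3 = B at *
  generalize hD : K.a ^ 2 = D at *
  generalize K.m = m at *
  have d12 : x2 - x1 ≠ 0 := by linarith
  have d13 : x3 - x1 ≠ 0 := by linarith
  have d14 : x4 - x1 ≠ 0 := by linarith
  have d23 : x3 - x2 ≠ 0 := by linarith
  have d24 : x4 - x2 ≠ 0 := by linarith
  have d34 : x4 - x3 ≠ 0 := by linarith
  -- Successive divided differences of μ at the roots; the third one is the vanishing of the sum of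
  -- the roots, since there is no cubic term.
  have e12 : -(Λ / 3) * (x1 ^ 3 + x1 ^ 2 * x2 + x1 * x2 ^ 2 + x2 ^ 3) + B * (x1 + x2) - 2 * m = 0 := by
    apply mul_left_cancel₀ d12; linear_combination h2 - h1
  have e13 : -(Λ / 3) * (x1 ^ 3 + x1 ^ 2 * x3 + x1 * x3 ^ 2 + x3 ^ 3) + B * (x1 + x3) - 2 * m = 0 := by
    apply mul_left_cancel₀ d13; linear_combination h3 - h1
  have e14 : -(Λ / 3) * (x1 ^ 3 + x1 ^ 2 * x4 + x1 * x4 ^ 2 + x4 ^ 3) + B * (x1 + x4) - 2 * m = 0 := by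
    apply mul_left_cancel₀ d14; linear_combination h4 - h1
  have e123 : -(Λ / 3) * (x1 ^ 2 + x2 ^ 2 + x3 ^ 2 + x1 * x2 + x1 * x3 + x2 * x3) + B = 0 := by
    apply mul_left_cancel₀ d23; linear_combination e13 - e12
  have e124 : -(Λ / 3) * (x1 ^ 2 + x2 ^ 2 + x4 ^ 2 + x1 * x2 + x1 * x4 + x2 * x4) + B = 0 := by
    apply mul_left_cancel₀ d24; linear_combination e14 - e12
  have e : -(Λ / 3) * (x1 + x2 + x3 + x4) = 0 := by
    apply mul_left_cancel₀ d34; linear_combination e124 - e123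
  have es : x1 + x2 + x3 + x4 = 0 := by
    rcases mul_eq_zero.1 e with h | h
    · linarith
    · exact h
  have ex : x1 = -(x2 + x3 + x4) := by linarith
  refine ⟨ex, fun r => ?_⟩
  have eB : B = (Λ / 3) * (x1 ^ 2 + x2 ^ 2 + x3 ^ 2 + x1 * x2 + x1 * x3 + x2 * x3) := by linarith
  have em : 2 * m = -(Λ / 3) * (x1 ^ 3 + x1 ^ 2 * x2 + x1 * x2 ^ 2 + x2 ^ 3) + B * (x1 + x2) := by
    linarith
  have eD : D = (Λ * x1 ^ 4 / 3) - B * x1 ^ 2 + 2 * m * x1 := by linarith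
  rw [eD, em, eB, ex]
  ring

theorem rNeg_eq : K.rNeg = -(K.rC + K.re + K.rc) := hK.vieta.1

theorem mu_eq (r : ℝ) :
    K.mu r = K.Λ / 3 * ((r + (K.rC + K.re + K.rc)) * (r - K.rC) * (r - K.re) * (K.rc - r)) := by
  rw [hK.vieta.2 r, hK.rNeg_eq]; ring

/-- Suppose the second root were negative. As μ(0) = a² ≥ 0, the next root would be nonpositive too,
and then the linear coefficient -2m, expressed through the roots, would be positive. This is where m
> 0 enters. -/
theorem rC_nonneg : 0 ≤ K.rC := by
  by_contra hneg
  push Not at hneg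
  have hΛ := hK.Λ_pos
  have l1 := hK.rNeg_lt
  have l2 := hK.rC_lt
  have l3 := hK.re_lt
  have h0 := hK.mu_eq 0
  have h1 := hK.mu_eq 1
  have hm1 := hK.mu_eq (-1)
  rw [hK.rNeg_eq] at l1
  have hm := hK.m_pos
  have hrc : 0 < K.rc := by linarith
  have ha : K.mu 0 = K.a ^ 2 := by simp [Data.mu]
  -- the linear coefficient
  have e3 : -(2 * K.m) = K.Λ / 3 * (K.rC * K.re * K.rc
      - (K.rC + K.re + K.rc) * (K.rC * K.re + K.rC * K.rc + K.re * K.rc)) := by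
    have : K.mu 1 - K.mu (-1) = -(4 * K.m) := by simp [Data.mu]; ring
    rw [h1, hm1] at this
    linear_combination (-1 / 2) * this
  have hs : 0 < K.rC + K.re + K.rc := by linarith
  rw [ha] at h0
  have h0' : 0 ≤ -K.re := by
    by_contra hre
    push Not at hre
    have hre' : 0 < K.re := by linarith
    have : 0 < K.Λ / 3 * ((K.rC + K.re + K.rc) * (-K.rC) * (K.re) * (K.rc)) := by
      have : 0 < -K.rC := by linarith
      positivity
    nlinarith [sq_nonneg K.a]
  have hx : 0 < -K.rC := by linarith
  -- In terms of y = -r_-, -r_C and -r_e, with r_c equal to their sum, the expression is a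
  -- polynomial with positive coefficients.
  have key : 0 < K.rC * K.re * K.rc
      - (K.rC + K.re + K.rc) * (K.rC * K.re + K.rC * K.rc + K.re * K.rc) := by
    obtain ⟨y, hy⟩ : ∃ y, y = K.rC + K.re + K.rc := ⟨_, rfl⟩
    have hrc' : K.rc = y + (-K.rC) + (-K.re) := by rw [hy]; ring
    rw [← hy]
    rw [hrc']
    have hy0 : 0 < y := hy ▸ hs
    have : 0 < y * (-K.rC) * (y + (-K.rC)) := by
      have := add_pos hy0 hx
      positivity
    have h2 : 0 ≤ (-K.re) * ((-K.rC) ^ 2 + (-K.rC) * (-K.re) + y ^ 2 + y * (-K.re)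
      + 2 * y * (-K.rC) ) := by positivity
    linear_combination this + h2
  have : 0 < K.Λ / 3 * (K.rC * K.re * K.rc
      - (K.rC + K.re + K.rc) * (K.rC * K.re + K.rC * K.rc + K.re * K.rc)) := by positivity
  linarith

theorem re_pos : 0 < K.re := lt_of_le_of_lt hK.rC_nonneg hK.rC_lt

theorem rc_pos : 0 < K.rc := hK.re_pos.trans hK.re_lt

theorem left_pos : 0 < K.re - K.δ := lt_of_le_of_lt hK.rC_nonneg hK.δ_small

theorem pos_of_dom {r : ℝ} (hr : r ∈ K.dom) : 0 < r := hK.left_pos.trans hr.1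

theorem pos_of_mem {r : ℝ} (hr : r ∈ Set.Icc K.re K.rc) : 0 < r := lt_of_lt_of_le hK.re_pos hr.1

theorem mem_dom_of_mem {r : ℝ} (hr : r ∈ Set.Icc K.re K.rc) : r ∈ K.dom :=
  ⟨by linarith [hK.δ_pos, hr.1], by linarith [hK.δ_pos, hr.2]⟩

theorem sum_pos : 0 < K.rC + K.re + K.rc := by
  linarith [hK.rC_nonneg, hK.re_pos, hK.rc_pos]

theorem mu_pos {r : ℝ} (h1 : K.re < r) (h2 : r < K.rc) : 0 < K.mu r := by
  rw [hK.mu_eq]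
  have := hK.Λ_pos
  have := hK.sum_pos
  have := hK.re_pos
  have := hK.rC_lt
  refine mul_pos (by positivity) (mul_pos (mul_pos (mul_pos ?_ ?_) ?_) ?_) <;> linarith

theorem mu_neg_left {r : ℝ} (h1 : K.rC < r) (h2 : r < K.re) : K.mu r < 0 := by
  rw [hK.mu_eq]
  have := hK.Λ_pos
  have := hK.sum_pos
  have := hK.rC_nonneg
  have := hK.re_lt
  refine mul_neg_of_pos_of_neg (by positivity) (mul_neg_of_neg_of_pos (mul_neg_of_pos_of_neg
    (mul_pos ?_ ?_) ?_) ?_) <;> linarith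

theorem mu_neg_right {r : ℝ} (h1 : K.rc < r) : K.mu r < 0 := by
  rw [hK.mu_eq]
  have := hK.Λ_pos
  have := hK.sum_pos
  have := hK.rc_pos
  have := hK.re_lt
  have := hK.rC_lt
  refine mul_neg_of_pos_of_neg (by positivity) (mul_neg_of_pos_of_neg (mul_pos
    (mul_pos ?_ ?_) ?_) ?_) <;> linarith

theorem mu_eq_zero_iff {r : ℝ} (h : K.rC < r) : K.mu r = 0 ↔ r = K.re ∨ r = K.rc := by
  constructor
  · intro h0
    rcases lt_trichotomy r K.re with h1 | h1 | h1
    · exact absurd h0 (hK.mu_neg_left h h1).ne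
    · exact Or.inl h1
    · rcases lt_trichotomy r K.rc with h2 | h2 | h2
      · exact absurd h0 (hK.mu_pos h1 h2).ne'
      · exact Or.inr h2
      · exact absurd h0 (hK.mu_neg_right h2).ne
  · rintro (rfl | rfl)
    exacts [hK.mu_re, hK.mu_rc]

theorem mu_nonneg {r : ℝ} (h : r ∈ Set.Icc K.re K.rc) : 0 ≤ K.mu r := by
  rcases h.1.eq_or_lt with h1 | h1
  · rw [← h1, hK.mu_re]
  rcases h.2.eq_or_lt with h2 | h2
  · rw [h2, hK.mu_rc]
  exact (hK.mu_pos h1 h2).le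

theorem dmu_eq (r : ℝ) : K.dmu r = K.Λ / 3 * (
    (r - K.rC) * (r - K.re) * (K.rc - r) + (r + (K.rC + K.re + K.rc)) * (r - K.re) * (K.rc - r)
    + (r + (K.rC + K.re + K.rc)) * (r - K.rC) * (K.rc - r)
    - (r + (K.rC + K.re + K.rc)) * (r - K.rC) * (r - K.re)) := by
  have h1 : HasDerivAt (fun r => K.Λ / 3 * ((r + (K.rC + K.re + K.rc)) * (r - K.rC) * (r - K.re)
      * (K.rc - r))) (K.dmu r) r := by
    have := hasDerivAt_mu (K := K) r
    rwa [show K.mu = _ from funext hK.mu_eq] at this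
  have h2 := (((((hasDerivAt_id r).add_const (K.rC + K.re + K.rc)).mul
    ((hasDerivAt_id r).sub_const K.rC)).mul ((hasDerivAt_id r).sub_const K.re)).mul
    ((hasDerivAt_id r).const_sub K.rc)).const_mul (K.Λ / 3)
  rw [h1.unique h2]
  simp only [id, Pi.mul_apply]
  ring

theorem dmu_re_pos : 0 < K.dmu K.re := by
  rw [hK.dmu_eq]
  have := hK.Λ_pos
  have := hK.sum_pos
  have := hK.re_pos
  have h1 : 0 < K.re - K.rC := by linarith [hK.rC_lt]
  have h2 : 0 < K.rc - K.re := by linarith [hK.re_lt]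
  have : 0 < (K.re + (K.rC + K.re + K.rc)) * (K.re - K.rC) * (K.rc - K.re) := by positivity
  simp only [sub_self, mul_zero, zero_mul, zero_add, sub_zero]
  positivity

theorem dmu_rc_neg : K.dmu K.rc < 0 := by
  rw [hK.dmu_eq]
  have := hK.Λ_pos
  have := hK.sum_pos
  have := hK.rc_pos
  have h1 : 0 < K.rc - K.rC := by linarith [hK.rC_lt, hK.re_lt]
  have h2 : 0 < K.rc - K.re := by linarith [hK.re_lt]
  have : 0 < K.Λ / 3 * ((K.rc + (K.rC + K.re + K.rc)) * (K.rc - K.rC) * (K.rc - K.re)) := by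
    positivity
  simp only [sub_self, mul_zero, zero_add, zero_sub]
  linarith

/-- The inequality behind the absence of trapping. -/
theorem no_trapping {r r₀ : ℝ} (h1 : K.re < r) (h2 : r < K.rc) (hr₀ : r₀ ∈ Set.Icc K.re K.rc) :
    0 < 4 * r * K.mu r - (r ^ 2 - r₀ ^ 2) * K.dmu r := by
  rw [hK.mu_eq, hK.dmu_eq]
  obtain ⟨h3, h4⟩ := hr₀
  have hΛ := hK.Λ_pos
  have hC := hK.rC_nonneg
  have hCe := hK.rC_lt
  have hre := hK.re_pos
  generalize K.re = e at *
  generalize K.rc = c at *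
  generalize K.rC = d at *
  generalize K.Λ = Λ at *
  obtain ⟨A, hA⟩ : ∃ A, A = r + (d + e + c) := ⟨_, rfl⟩
  obtain ⟨B, hB⟩ : ∃ B, B = r - d := ⟨_, rfl⟩
  obtain ⟨C, hC'⟩ : ∃ C, C = r - e := ⟨_, rfl⟩
  obtain ⟨D, hD⟩ : ∃ D, D = c - r := ⟨_, rfl⟩
  rw [← hA, ← hB, ← hC', ← hD]
  have pA : 0 < A := by linarith
  have pB : 0 < B := by linarith
  have pC : 0 < C := by linarith
  have pD : 0 < D := by linarith
  have goal_eq : 4 * r * (Λ / 3 * (A * B * C * D)) - (r ^ 2 - r₀ ^ 2) * (Λ / 3 *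
      (B * C * D + A * C * D + A * B * D - A * B * C))
      = Λ / 3 * (4 * r * (A * B * C * D) - (r - r₀) * (r + r₀) *
      (B * C * D + A * C * D + A * B * D - A * B * C)) := by ring
  rw [goal_eq]
  refine mul_pos (by positivity) ?_
  have hs : 0 < r + r₀ := by linarith
  rcases le_or_gt r₀ r with hle | hlt
  · -- `r₀ ≤ r`
    have q0 : 0 ≤ r - r₀ := by linarith
    have qA : r + r₀ ≤ A := by linarith
    have qB : r - r₀ ≤ B := by linarith
    have qC : r - r₀ ≤ C := by linarith
    -- Replacing r + r₀ by A, respectively r - r₀ by B or C, bounds the three terms by ((r - r₀) +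
    -- 2(r + r₀))ABCD. The remaining coefficient is 4r minus this, namely r - r₀, so r = r₀ is
    -- treated separately.
    have t1 : (r - r₀) * (r + r₀) * (B * C * D) ≤ (r - r₀) * A * (B * C * D) := by gcongr
    have t2 : (r - r₀) * (r + r₀) * (A * C * D) ≤ B * (r + r₀) * (A * C * D) := by gcongr
    have t3 : (r - r₀) * (r + r₀) * (A * B * D) ≤ C * (r + r₀) * (A * B * D) := by gcongr
    have t4 : 0 ≤ (r - r₀) * (r + r₀) * (A * B * C) := by positivity
    have t5 : 0 < (r + r₀) * (A * B * C * D) := by positivity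
    have t6 : 4 * r * (A * B * C * D) - ((r - r₀) * A * (B * C * D) + B * (r + r₀) * (A * C * D)
      + C * (r + r₀) * (A * B * D)) = (4 * r - (r - r₀) - 2 * (r + r₀)) * (A * B * C * D) := by ring
    have t7 : 0 < (4 * r - (r - r₀) - 2 * (r + r₀)) * (A * B * C * D) ∨ r = r₀ := by
      by_cases h : r = r₀
      · exact Or.inr h
      · left
        have : r₀ < r := lt_of_le_of_ne hle (Ne.symm h)
        have : 0 < 4 * r - (r - r₀) - 2 * (r + r₀) := by linarith
        exact mul_pos this (by positivity)
    rcases t7 with t7 | t7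
    · linarith
    · rw [t7]
      have : 0 < r₀ := by linarith
      have : 0 < 4 * r₀ * (A * B * C * D) := by positivity
      simpa using this
  · -- `r < r₀`
    have q0 : 0 < r₀ - r := by linarith
    have qD : r₀ - r ≤ D := by linarith
    have qB : B ≤ r + r₀ := by linarith
    have qC : C ≤ r + r₀ := by linarith
    -- Only the term ABC is unfavourable now, and r₀ - r ≤ D controls it. Two of the favourable
    -- terms are kept; the total coefficient of ABCD is 4r + 2(r₀ - r) - (r + r₀) = r + r₀.
    have t1 : 0 < (r₀ - r) * (r + r₀) * (B * C * D) := by positivity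
    have t2 : (r₀ - r) * B * (A * C * D) ≤ (r₀ - r) * (r + r₀) * (A * C * D) := by gcongr
    have t3 : (r₀ - r) * C * (A * B * D) ≤ (r₀ - r) * (r + r₀) * (A * B * D) := by gcongr
    have t4 : (r₀ - r) * (r + r₀) * (A * B * C) ≤ D * (r + r₀) * (A * B * C) := by gcongr
    have t5 : 0 < (r₀ - r) * (A * B * C * D) := by positivity
    have hr : 0 < r := by linarith
    have t6 : 4 * r * (A * B * C * D) + ((r₀ - r) * B * (A * C * D) + (r₀ - r) * C * (A * B * D)
      - D * (r + r₀) * (A * B * C)) = (r₀ + r) * (A * B * C * D) := by ring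
    have hr₀ : 0 < r₀ := by linarith
    have t7 : 0 < (r₀ + r) * (A * B * C * D) := by positivity
    linarith

/-! ### Analyticity of `h` -/

theorem f_analyticAt {r : ℝ} (hr : r ∈ K.dom) : AnalyticAt ℝ K.f r := hK.f_analytic r hr

theorem rC_lt_of_dom {r : ℝ} (hr : r ∈ K.dom) : K.rC < r := hK.δ_small.trans hr.1

theorem f_sq_of_mu {r : ℝ} (hr : r ∈ K.dom) (h0 : K.mu r = 0) : K.f r ^ 2 = 1 := by
  rcases (hK.mu_eq_zero_iff (hK.rC_lt_of_dom hr)).1 h0 with rfl | rfl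
  · rw [hK.f_re]; norm_num
  · rw [hK.f_rc]; norm_num

theorem mu_mul_h {r : ℝ} (hr : r ∈ K.dom) : K.mu r * K.h r = 1 - K.f r ^ 2 := by
  unfold Data.h
  split_ifs with h
  · rw [h, hK.f_sq_of_mu hr h]; ring
  · field_simp

theorem dmu_ne_zero {r : ℝ} (hr : r ∈ K.dom) (h0 : K.mu r = 0) : K.dmu r ≠ 0 := by
  rcases (hK.mu_eq_zero_iff (hK.rC_lt_of_dom hr)).1 h0 with rfl | rfl
  · exact hK.dmu_re_pos.ne'
  · exact hK.dmu_rc_neg.ne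

/-- At a horizon both 1 - f² and μ vanish, and `h` is the quotient of their difference quotients
based there. These are analytic, and the denominator is nonzero because the root of μ is simple. -/
theorem h_analyticAt {r : ℝ} (hr : r ∈ K.dom) : AnalyticAt ℝ K.h r := by
  have hN : AnalyticAt ℝ (fun x => 1 - K.f x ^ 2) r :=
    analyticAt_const.sub ((hK.f_analyticAt hr).pow 2)
  have hM : AnalyticAt ℝ K.mu r := by
    unfold Data.mu; fun_prop
  by_cases h0 : K.mu r = 0
  · have hd := hK.dmu_ne_zero hr h0
    have dslope_an : ∀ {g : ℝ → ℝ}, AnalyticAt ℝ g r → AnalyticAt ℝ (dslope g r) r := by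
      rintro g ⟨s, hs⟩
      exact ⟨_, hs.has_fpower_series_dslope_fslope⟩
    have hq : AnalyticAt ℝ (fun x => dslope (fun x => 1 - K.f x ^ 2) r x / dslope K.mu r x) r :=
      (dslope_an hN).div (dslope_an hM) (by rw [dslope_same, deriv_mu]; exact hd)
    refine hq.congr ?_
    have hne := eventually_nhdsWithin_iff.1 ((hasDerivAt_mu (K := K) r).eventually_ne (c := 0) hd)
    filter_upwards [isOpen_Ioo.mem_nhds hr, hne] with x hx hx0
    by_cases hxr : x = r
    · subst hxr
      have hf := (hK.f_analyticAt hr).differentiableAt.hasDerivAt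
      have : deriv (fun y => 1 - K.f y ^ 2) x = -(2 * K.f x * deriv K.f x) := by
        have := ((hf.pow 2).const_sub 1).deriv
        simpa using this
      simp only [dslope_same, this, Data.h, h0, if_true]
    · rw [dslope_of_ne _ hxr, dslope_of_ne _ hxr, slope_def_field, slope_def_field, h0,
        hK.f_sq_of_mu hr h0, ← hK.mu_mul_h hx]
      have hxr' : x - r ≠ 0 := sub_ne_zero.2 hxr
      have hx0' : K.mu x ≠ 0 := hx0 hxr
      field_simp
      ring
  · refine (hN.div hM h0).congr ?_
    have : ∀ᶠ x in nhds r, K.mu x ≠ 0 := hM.continuousAt.eventually_ne h0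
    filter_upwards [this] with x hx
    simp [Data.h, hx]

end Data.Subextremal

/-! ### The d'Alembert operator on functions vanishing to second order -/

/-- At a zero of ψ the error ψ(F - F x) is O(|y - x|) times o(1), so continuity of F suffices. In
the divergence below this removes any need to differentiate the metric coefficients. -/
theorem hasFDerivAt_mul_of_zero {E : Type*} [NormedAddCommGroup E] [NormedSpace ℝ E]
    {ψ F : E → ℝ} {ψ' : E →L[ℝ] ℝ} {x : E} (hψ : HasFDerivAt ψ ψ' x) (h0 : ψ x = 0)
    (hF : ContinuousAt F x) : HasFDerivAt (fun y => ψ y * F y) (F x • ψ') x := by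
  have h1 : HasFDerivAt (fun y => ψ y * F x) (F x • ψ') x := hψ.mul_const (F x)
  have h2 : (fun y => ψ y * (F y - F x)) =o[nhds x] fun y => y - x := by
    have hO : ψ =O[nhds x] fun y => y - x := by simpa [h0] using hψ.isBigO_sub
    have ho : (fun y => F y - F x) =o[nhds x] fun _ => (1 : ℝ) := by
      rw [Asymptotics.isLittleO_one_iff]
      exact tendsto_sub_nhds_zero_iff.2 hF
    have := hO.norm_right.mul_isLittleO ho
    simpa using this
  rw [hasFDerivAt_iff_isLittleO] at h1 ⊢
  refine (h1.add h2).congr_left fun y => ?_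
  simp [h0]
  ring

theorem sharp_smul (y ξ : Pt) (t : ℝ) : K.sharp y (t • ξ) = t • K.sharp y ξ := by
  obtain ⟨ξt, ξr, η⟩ := ξ
  have e : phiComp y.2.2 (t • η) = t * phiComp y.2.2 η := by simp [phiComp]; ring
  unfold Data.sharp
  simp only [Prod.smul_mk, smul_eq_mul, e, inner_smul_right]
  refine Prod.ext ?_ (Prod.ext ?_ ?_)
  · simp only; ring
  · simp only; ring
  · simp only
    ext i
    simp only [PiLp.smul_apply, PiLp.add_apply, PiLp.sub_apply, smul_eq_mul]
    ring

theorem ext_normalize {F : Type*} (u : Pt → F) (y : Pt) :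
    ext u (y.1, y.2.1, ‖y.2.2‖⁻¹ • y.2.2) = ext u y := by
  unfold ext
  by_cases h : y.2.2 = 0
  · simp [h]
  · have : ‖‖y.2.2‖⁻¹ • y.2.2‖ = 1 := by
      rw [norm_smul, norm_inv, norm_norm, inv_mul_cancel₀ (norm_ne_zero_iff.2 h)]
    simp [this]

theorem ext_of_unit {F : Type*} (u : Pt → F) {y : Pt} (h : ‖y.2.2‖ = 1) : ext u y = u y := by
  simp [ext, h]

/-- The factor ψ is kept outside, so that the gradient of gψ² has the form required by
`hasFDerivAt_mul_of_zero`. -/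
theorem dM_mul_sq {g ψ : Pt → ℝ} {y : Pt} (hg : DifferentiableAt ℝ (ext g) y)
    (hψ : DifferentiableAt ℝ (ext ψ) y) :
    dM (fun y => g y * ψ y ^ 2) y
      = ext ψ y • (ext ψ y • dM g y + (2 * ext g y) • dM ψ y) := by
  have h : HasFDerivAt (ext (fun y => g y * ψ y ^ 2))
      (ext g y • ((2 * ext ψ y) • fderiv ℝ (ext ψ) y) + (ext ψ y ^ 2) • fderiv ℝ (ext g) y) y := by
    have := hg.hasFDerivAt.mul (hψ.hasFDerivAt.pow 2)
    refine HasFDerivAt.congr_fderiv this ?_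
    simp
  unfold dM
  rw [h.fderiv]
  refine Prod.ext ?_ (Prod.ext ?_ ?_)
  · simp; ring
  · simp; ring
  · ext i
    simp; ring

theorem continuousAt_dM {u : Pt → ℝ} {y : Pt} (h : ContDiffAt ℝ 1 (ext u) y) :
    ContinuousAt (dM u) y := by
  have hc : ContinuousAt (fderiv ℝ (ext u)) y := h.continuousAt_fderiv (by norm_num)
  unfold dM
  refine ContinuousAt.prodMk (hc.clm_apply continuousAt_const)
    (ContinuousAt.prodMk (hc.clm_apply continuousAt_const) ?_)
  refine (PiLp.continuous_toLp 2 _).continuousAt.comp (continuousAt_pi.2 fun i => ?_)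
  exact hc.clm_apply continuousAt_const

theorem contDiffAt_normalize {n : WithTop ℕ∞} {y : Pt} (h : y.2.2 ≠ 0) :
    ContDiffAt ℝ n (fun y : Pt => ((y.1, y.2.1, ‖y.2.2‖⁻¹ • y.2.2) : Pt)) y := by
  have hn : ContDiffAt ℝ n (fun y : Pt => ‖y.2.2‖) y :=
    ContDiffAt.norm ℝ (contDiffAt_snd.snd') h
  have h0 : ‖y.2.2‖ ≠ 0 := norm_ne_zero_iff.2 h
  have := hn.inv h0
  fun_prop

theorem continuousAt_sharp (hK : K.Subextremal) {y ξ : Pt} (hr : y.2.1 ∈ K.dom) :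
    ContinuousAt (fun w : Pt × Pt => K.sharp w.1 w.2) (y, ξ) := by
  have hf : ContinuousAt (fun w : Pt × Pt => K.f w.1.2.1) (y, ξ) :=
    ContinuousAt.comp (f := fun w : Pt × Pt => w.1.2.1) (hK.f_analyticAt hr).continuousAt (by fun_prop)
  have hh : ContinuousAt (fun w : Pt × Pt => K.h w.1.2.1) (y, ξ) :=
    ContinuousAt.comp (g := K.h) (f := fun w : Pt × Pt => w.1.2.1) (hK.h_analyticAt hr).continuousAt (by fun_prop)
  have hmu : ContinuousAt (fun w : Pt × Pt => K.mu w.1.2.1) (y, ξ) := by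
    unfold Data.mu; fun_prop
  have hρ : K.rho2 y.2.1 y.2.2 ≠ 0 := by
    have := hK.pos_of_dom hr
    unfold Data.rho2; positivity
  have hc0 : K.c y.2.2 ≠ 0 := by
    have := hK.Λ_pos
    unfold Data.c; positivity
  have hρc : ContinuousAt (fun w : Pt × Pt => (K.rho2 w.1.2.1 w.1.2.2)⁻¹) (y, ξ) := by
    refine ContinuousAt.inv₀ ?_ hρ
    unfold Data.rho2; fun_prop
  have hc : ContinuousAt (fun w : Pt × Pt => K.c w.1.2.2) (y, ξ) := by
    unfold Data.c; fun_prop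
  have hci : ContinuousAt (fun w : Pt × Pt => (K.c w.1.2.2)⁻¹) (y, ξ) := hc.inv₀ hc0
  have hd : ContinuousAt (fun w : Pt × Pt => dPhi w.1.2.2) (y, ξ) := by
    unfold dPhi
    refine (PiLp.continuous_toLp 2 _).continuousAt.comp (continuousAt_pi.2 fun i => ?_)
    fin_cases i <;> simp <;> fun_prop
  unfold Data.sharp phiComp
  simp only [div_eq_mul_inv]
  refine hρc.smul (ContinuousAt.prodMk ?_ (ContinuousAt.prodMk ?_ ?_))
  · fun_prop
  · fun_prop
  · fun_prop

/-- `□ (g ψ²) = -2 g G(dψ, dψ)` at zeros of `ψ`. -/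
theorem boxReal_mul_sq (hK : K.Subextremal) {g ψ : Pt → ℝ} {y : Pt} (hr : y.2.1 ∈ K.dom)
    (hy : ‖y.2.2‖ = 1) (hg : ∀ y : Pt, y.2.2 ≠ 0 → ContDiffAt ℝ 1 (ext g) y)
    (hψ : ∀ y : Pt, y.2.2 ≠ 0 → ContDiffAt ℝ 1 (ext ψ) y) (h0 : ψ y = 0) :
    K.boxReal (fun y => g y * ψ y ^ 2) y = -(2 * g y * K.GStar y (dM ψ y) (dM ψ y)) := by
  have hy0 : y.2.2 ≠ 0 := by
    intro h; rw [h] at hy; simp at hy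
  set ν : Pt → Pt := fun y => (y.1, y.2.1, ‖y.2.2‖⁻¹ • y.2.2) with hν
  have hνy : ν y = y := by simp [hν, hy]
  -- The weighted gradient of gψ² is ψF with F continuous, so at a zero of ψ its divergence is the
  -- pairing of dψ with F. The normalization ν accounts for `ext` evaluating everything on the unit
  -- sphere.
  set F : Pt → Pt := fun y => K.rho2 (ν y).2.1 (ν y).2.2 •
    K.sharp (ν y) (ext ψ y • dM g (ν y) + (2 * ext g y) • dM ψ (ν y)) with hF
  have hνc : ContinuousAt ν y := (contDiffAt_normalize (n := 1) hy0).continuousAt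
  have hFc : ContinuousAt F y := by
    have a1 : ContinuousAt (fun y => dM g (ν y)) y :=
      ContinuousAt.comp (g := dM g) (by rw [hνy]; exact continuousAt_dM (hg y hy0)) hνc
    have a2 : ContinuousAt (fun y => dM ψ (ν y)) y :=
      ContinuousAt.comp (g := dM ψ) (by rw [hνy]; exact continuousAt_dM (hψ y hy0)) hνc
    have a3 := (hg y hy0).continuousAt
    have a4 := (hψ y hy0).continuousAt
    have a5 : ContinuousAt (fun y => K.rho2 (ν y).2.1 (ν y).2.2) y := by
      unfold Data.rho2; fun_prop
    refine a5.smul ?_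
    refine ContinuousAt.comp (g := fun w : Pt × Pt => K.sharp w.1 w.2)
      (f := fun y => (ν y, ext ψ y • dM g (ν y) + (2 * ext g y) • dM ψ (ν y))) ?_ ?_
    · exact continuousAt_sharp hK (by simp only [hνy]; exact hr)
    · fun_prop
  have hWF : ∀ y' : Pt, y'.2.2 ≠ 0 →
      ext (fun y' => K.rho2 y'.2.1 y'.2.2 • K.sharp y' (dM (fun y => g y * ψ y ^ 2) y')) y'
        = ext ψ y' • F y' := by
    intro y' hy'
    have hνy' : (ν y').2.2 ≠ 0 := by
      simp [hν, hy']
    change K.rho2 (ν y').2.1 (ν y').2.2 • K.sharp (ν y') (dM (fun y => g y * ψ y ^ 2) (ν y')) = _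
    rw [dM_mul_sq ((hg _ hνy').differentiableAt (by norm_num))
      ((hψ _ hνy').differentiableAt (by norm_num)), sharp_smul]
    have e1 : ext ψ (ν y') = ext ψ y' := ext_normalize ψ y'
    have e2 : ext g (ν y') = ext g y' := ext_normalize g y'
    rw [e1, e2, smul_comm]
  have hev : ∀ᶠ y' : Pt in nhds y, y'.2.2 ≠ 0 :=
    (continuous_snd.snd.continuousAt (x := y)).eventually_ne hy0
  have hψ0 : ext ψ y = 0 := by rw [ext_of_unit ψ hy, h0]
  have hψd := ((hψ y hy0).differentiableAt (by norm_num)).hasFDerivAt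
  have d1 : HasFDerivAt (fun y' => (ext (fun y' => K.rho2 y'.2.1 y'.2.2 •
      K.sharp y' (dM (fun y => g y * ψ y ^ 2) y')) y').1) ((F y).1 • fderiv ℝ (ext ψ) y) y := by
    refine (hasFDerivAt_mul_of_zero hψd hψ0 (F := fun y => (F y).1) (by fun_prop)).congr_of_eventuallyEq ?_
    filter_upwards [hev] with y' hy'
    rw [hWF y' hy']; rfl
  have d2 : HasFDerivAt (fun y' => (ext (fun y' => K.rho2 y'.2.1 y'.2.2 •
      K.sharp y' (dM (fun y => g y * ψ y ^ 2) y')) y').2.1) ((F y).2.1 • fderiv ℝ (ext ψ) y) y := by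
    refine (hasFDerivAt_mul_of_zero hψd hψ0 (F := fun y => (F y).2.1) (by fun_prop)).congr_of_eventuallyEq ?_
    filter_upwards [hev] with y' hy'
    rw [hWF y' hy']; rfl
  have d3 : ∀ i, HasFDerivAt (fun y' => (ext (fun y' => K.rho2 y'.2.1 y'.2.2 •
      K.sharp y' (dM (fun y => g y * ψ y ^ 2) y')) y').2.2 i)
      ((F y).2.2 i • fderiv ℝ (ext ψ) y) y := by
    intro i
    refine (hasFDerivAt_mul_of_zero hψd hψ0 (F := fun y => (F y).2.2 i) (by fun_prop)).congr_of_eventuallyEq ?_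
    filter_upwards [hev] with y' hy'
    rw [hWF y' hy']; rfl
  unfold Data.boxReal divM
  rw [d1.fderiv, d2.fderiv]
  simp only [fun i => (d3 i).fderiv]
  have hρ : K.rho2 y.2.1 y.2.2 ≠ 0 := by
    have := hK.pos_of_dom hr
    unfold Data.rho2; positivity
  have hFy : F y = (2 * g y * K.rho2 y.2.1 y.2.2) • K.sharp y (dM ψ y) := by
    simp only [hF, hνy, hψ0, zero_smul, zero_add, sharp_smul, ext_of_unit g hy, smul_smul]
    congr 1; ring
  rw [hFy, show K.GStar y (dM ψ y) (dM ψ y) = pairM (dM ψ y) (K.sharp y (dM ψ y)) from rfl]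
  generalize K.sharp y (dM ψ y) = S at *
  simp only [pairM, dM, Prod.smul_fst, Prod.smul_snd, smul_apply, smul_eq_mul,
    PiLp.smul_apply, PiLp.inner_apply, Fin.sum_univ_three, RCLike.inner_apply, conj_trivial]
  field_simp

/-! ### The principal symbol -/

/-- The factor `α` with `(r² + a²) ξ_t + a ξ_φ = α ξ_φ` for covectors annihilating `T`. -/
def Data.alpha (K : Data) (r₀ r : ℝ) : ℝ := K.a * (r₀ ^ 2 - r ^ 2) / (r₀ ^ 2 + K.a ^ 2)

/-- The angular momentum `ξ_φ`. -/
def angMom (q : Phase) : ℝ := phiComp q.1.2 q.2.2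

/-- `|ω × η|²`. -/
def angSq (q : Phase) : ℝ :=
  (q.1.2 0 ^ 2 + q.1.2 1 ^ 2 + q.1.2 2 ^ 2) * (q.2.2 0 ^ 2 + q.2.2 1 ^ 2 + q.2.2 2 ^ 2)
    - (q.1.2 0 * q.2.2 0 + q.1.2 1 * q.2.2 1 + q.1.2 2 * q.2.2 2) ^ 2

/-- The coefficient of `ξ_φ²` in Carter's constant, as a function of `t = cos² θ`. -/
def Data.kap (K : Data) (r₀ t : ℝ) : ℝ :=
  (K.b ^ 2 * (-(2 * K.a * K.angVel r₀) + K.a ^ 2 * (1 - t) * K.angVel r₀ ^ 2)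
    + K.Λ * K.a ^ 2 / 3 * (K.b + (1 + K.Λ * K.a ^ 2 / 3 * t))) / (1 + K.Λ * K.a ^ 2 / 3 * t)

/-- Carter's constant. -/
def Data.carter (K : Data) (r₀ : ℝ) (q : Phase) : ℝ :=
  K.c q.1.2 * angSq q + K.kap r₀ (q.1.2 2 ^ 2) * angMom q ^ 2

/-- The radial part of `ρ² p`. -/
def Data.radial (K : Data) (r₀ : ℝ) (q : Phase) : ℝ :=
  K.mu q.1.1 * q.2.1 ^ 2 - 2 * K.b * K.f q.1.1 * K.alpha r₀ q.1.1 * angMom q * q.2.1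
    - K.b ^ 2 * K.h q.1.1 * K.alpha r₀ q.1.1 ^ 2 * angMom q ^ 2

/-- The explicit form of the principal symbol. -/
def Data.psym (K : Data) (r₀ : ℝ) (q : Phase) : ℝ :=
  (K.radial r₀ q + K.carter r₀ q) / K.rho2 q.1.1 q.1.2

theorem norm_sq_V (v : V) : ‖v‖ ^ 2 = v 0 ^ 2 + v 1 ^ 2 + v 2 ^ 2 := by
  rw [EuclideanSpace.norm_sq_eq]; simp [Fin.sum_univ_three]

theorem inner_V (v w : V) : inner ℝ v w = v 0 * w 0 + v 1 * w 1 + v 2 * w 2 := by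
  simp [PiLp.inner_apply, Fin.sum_univ_three]; ring

theorem Data.Subextremal.rho2_pos (hK : K.Subextremal) {r : ℝ} (hr : r ∈ K.dom) (ω : V) :
    0 < K.rho2 r ω := by
  have := hK.pos_of_dom hr
  unfold Data.rho2; positivity

theorem Data.Subextremal.cz_pos (hK : K.Subextremal) (z : ℝ) :
    0 < 1 + K.Λ * K.a ^ 2 / 3 * z ^ 2 := by
  have := hK.Λ_pos
  positivity

theorem Data.Subextremal.b_pos (hK : K.Subextremal) : 0 < K.b := by
  have := hK.Λ_pos
  unfold Data.b; positivity

theorem Data.Subextremal.c_pos (hK : K.Subextremal) (ω : V) : 0 < K.c ω := hK.cz_pos _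

/-- Carter's separation: once ξ(T) = 0, the combination (r² + a²)ξ_t + aξ_φ becomes αξ_φ, and ρ²G_*
splits into a radial part and a part living on the sphere, coupled only through ξ_φ. -/
theorem GStar_toSpacetime (hK : K.Subextremal) {r₀ : ℝ} (hr₀ : 0 < r₀) {q : Phase}
    (hr : q.1.1 ∈ K.dom) (hω : ‖q.1.2‖ = 1) (hη : inner ℝ q.1.2 q.2.2 = 0) (t : ℝ) :
    K.GStar (t, q.1.1, q.1.2) (K.toSpacetime r₀ q) (K.toSpacetime r₀ q) = K.psym r₀ q := by
  obtain ⟨⟨r, ω⟩, ξ, η⟩ := q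
  have hs : ω 0 ^ 2 + ω 1 ^ 2 + ω 2 ^ 2 = 1 := by rw [← norm_sq_V, hω]; norm_num
  have hη' : ω 0 * η 0 + ω 1 * η 1 + ω 2 * η 2 = 0 := by rw [← inner_V]; exact hη
  have hρ := (hK.rho2_pos hr ω).ne'
  have hc := (hK.c_pos ω).ne'
  have hden : r₀ ^ 2 + K.a ^ 2 ≠ 0 := by positivity
  have hα : K.alpha r₀ r * phiComp ω η = (r ^ 2 + K.a ^ 2) * (-(K.angVel r₀ * phiComp ω η))
      + K.a * phiComp ω η := by
    unfold Data.alpha Data.angVel; field_simp; ring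
  have hcz : 1 + K.Λ * K.a ^ 2 / 3 * ω 2 ^ 2 = K.c ω := rfl
  have hdη : inner ℝ η (dPhi ω) = phiComp ω η := by
    rw [inner_V]; simp [dPhi, phiComp]; ring
  have hηη : inner ℝ η η = angSq ((r, ω), (ξ, η)) := by
    rw [inner_V]; simp only [angSq]; rw [hs, hη']; ring
  simp only at hη
  simp only [Data.GStar, pairM, Data.toSpacetime, Data.sharp, Prod.smul_mk, smul_eq_mul, inner_smul_right,
    inner_add_right, hη, zero_smul, sub_zero, hdη, hηη, ← hα]
  simp only [Data.psym, Data.radial, Data.carter, Data.kap, angMom, hcz]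
  generalize angSq ((r, ω), (ξ, η)) = J at *
  generalize phiComp ω η = L at *
  generalize K.alpha r₀ r = α at *
  generalize K.c ω = c at *
  generalize K.rho2 r ω = ρ at *
  field_simp
  linear_combination (3 * K.b * K.f r * ξ * c + 3 * K.b ^ 2 * K.h r * c * (α * L)) * hα

theorem fderiv_apply_of_hasDerivAt {E : Type*} [NormedAddCommGroup E] [NormedSpace ℝ E]
    {u : E → ℝ} {y v : E} {d : ℝ} (hu : DifferentiableAt ℝ u y)
    (h : HasDerivAt (fun s : ℝ => u (y + s • v)) d 0) : fderiv ℝ u y v = d := by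
  have h1 : HasDerivAt (fun s : ℝ => y + s • v) v 0 := by
    simpa using ((hasDerivAt_id (0 : ℝ)).smul_const v).const_add y
  have h2 : HasFDerivAt u (fderiv ℝ u y) (y + (0 : ℝ) • v) := by simpa using hu.hasFDerivAt
  exact (h2.comp_hasDerivAt (0 : ℝ) h1).unique h

theorem contDiff_rot {n : WithTop ℕ∞} : ContDiff ℝ n (fun w : ℝ × V => rot w.1 w.2) := by
  unfold rot
  refine (PiLp.contDiff_toLp (𝕜 := ℝ) (p := 2)).comp (contDiff_pi.2 fun i => ?_)
  fin_cases i <;> simp <;> fun_prop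

theorem rot_zero (ω : V) : rot 0 ω = ω := by
  ext i; fin_cases i <;> simp [rot]

/-- The function of `y` that is lifted from the linear function of differential `ξ`
vanishing at `x`. -/
def Data.phase (K : Data) (r₀ : ℝ) (q : Phase) (y : Pt) : ℝ :=
  pairL q.2 ((y.2.1, rot (-(K.angVel r₀ * y.1)) y.2.2) - q.1)

theorem contDiffAt_ext_phase (r₀ : ℝ) (q : Phase) {n : WithTop ℕ∞} {y : Pt} (hy : y.2.2 ≠ 0) :
    ContDiffAt ℝ n (ext (K.phase r₀ q)) y := by
  have h1 : ContDiff ℝ n (K.phase r₀ q) := by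
    have : ContDiff ℝ n (fun y : Pt => rot (-(K.angVel r₀ * y.1)) y.2.2) :=
      contDiff_rot.comp (g := fun w : ℝ × V => rot w.1 w.2)
        (f := fun y : Pt => (-(K.angVel r₀ * y.1), y.2.2)) (by fun_prop)
    unfold Data.phase pairL
    simp only [Prod.fst_sub, Prod.snd_sub]
    exact (contDiff_const.mul (by fun_prop)).add (contDiff_const.inner ℝ (this.sub contDiff_const))
  exact h1.contDiffAt.comp y (contDiffAt_normalize hy)

/-- The lifted phase is invariant under T, so its differential annihilates T. Extending constantly
along rays does no harm because η is orthogonal to ω. -/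
theorem dM_phase (r₀ : ℝ) {q : Phase} (hω : ‖q.1.2‖ = 1) (hη : inner ℝ q.1.2 q.2.2 = 0) :
    dM (K.phase r₀ q) (0, q.1.1, q.1.2) = K.toSpacetime r₀ q := by
  obtain ⟨⟨r, ω⟩, ξ, η⟩ := q
  have hω0 : ω ≠ 0 := by rintro rfl; simp at hω
  have hd : DifferentiableAt ℝ (ext (K.phase r₀ ((r, ω), (ξ, η)))) (0, r, ω) :=
    (contDiffAt_ext_phase (n := 1) r₀ _ hω0).differentiableAt (by norm_num)
  simp only at hη hω
  have hη' : inner ℝ η ω = 0 := by rw [real_inner_comm]; exact hη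
  simp only [dM, Data.toSpacetime]
  refine Prod.ext ?_ (Prod.ext ?_ ?_)
  · refine fderiv_apply_of_hasDerivAt hd ?_
    have e : (fun s : ℝ => ext (K.phase r₀ ((r, ω), (ξ, η))) ((0, r, ω) + s • (1, 0, 0)))
        = fun s => η 0 * (Real.cos (-(K.angVel r₀ * s)) * ω 0 - Real.sin (-(K.angVel r₀ * s)) * ω 1
            - ω 0) + η 1 * (Real.sin (-(K.angVel r₀ * s)) * ω 0
            + Real.cos (-(K.angVel r₀ * s)) * ω 1 - ω 1) := by
      funext s
      simp [ext, Data.phase, pairL, hω, inner_V, rot]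
    rw [e]
    have hl : HasDerivAt (fun s : ℝ => -(K.angVel r₀ * s)) (-(K.angVel r₀)) 0 := by
      exact HasDerivAt.congr_deriv ((hasDerivAt_id (0 : ℝ)).const_mul (K.angVel r₀)).neg (by simp)
    have hcos := hl.cos
    have hsin := hl.sin
    have := ((((hcos.mul_const (ω 0)).sub (hsin.mul_const (ω 1))).sub_const (ω 0)).const_mul (η 0)).add
      ((((hsin.mul_const (ω 0)).add (hcos.mul_const (ω 1))).sub_const (ω 1)).const_mul (η 1))
    refine HasDerivAt.congr_deriv this ?_
    simp [phiComp]
    ring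
  · refine fderiv_apply_of_hasDerivAt hd ?_
    have e : (fun s : ℝ => ext (K.phase r₀ ((r, ω), (ξ, η))) ((0, r, ω) + s • (0, 1, 0)))
        = fun s => ξ * s := by
      funext s
      simp [ext, Data.phase, pairL, hω, rot_zero]
    rw [e]
    simpa using (hasDerivAt_id (0 : ℝ)).const_mul ξ
  · ext i
    refine fderiv_apply_of_hasDerivAt hd ?_
    have e : (fun s : ℝ => ext (K.phase r₀ ((r, ω), (ξ, η)))
        ((0, r, ω) + s • (0, 0, EuclideanSpace.single i 1)))
        = fun s => s * (‖ω + s • EuclideanSpace.single i (1 : ℝ)‖⁻¹ * η i) := by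
      funext s
      simp [ext, Data.phase, pairL, rot_zero, inner_sub_right, inner_add_right,
        inner_smul_right, hη', EuclideanSpace.inner_single_right]
      ring
    rw [e]
    have hc : ContinuousAt (fun s : ℝ => ‖ω + s • EuclideanSpace.single i (1 : ℝ)‖⁻¹ * η i) 0 := by
      refine ContinuousAt.mul (ContinuousAt.inv₀ (by fun_prop) (by simp [hω])) continuousAt_const
    have := (hasFDerivAt_mul_of_zero (hasFDerivAt_id (𝕜 := ℝ) (0 : ℝ)) rfl hc).hasDerivAt
    simpa [hω] using this

/-- The real and imaginary parts of the conjugated test function have the form g(t_*)φ² with φ = 0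
at the base point. Hence the d'Alembertian sees only g(0), which is 1 and 0 respectively, and the
potential term drops out. In particular σ and A do not affect the symbol. -/
theorem symb_eq (hK : K.Subextremal) {r₀ : ℝ} (hr₀ : 0 < r₀) (A : Pt → ℂ) (σ : ℂ) {q : Phase}
    (hr : q.1.1 ∈ K.dom) (hω : ‖q.1.2‖ = 1) (hη : inner ℝ q.1.2 q.2.2 = 0) :
    K.symb r₀ A σ q = (K.psym r₀ q : ℂ) := by
  have hph0 : K.phase r₀ q (0, q.1.1, q.1.2) = 0 := by
    simp [Data.phase, rot_zero, pairL]
  have hbox : ∀ g : ℝ → ℝ, ContDiff ℝ 1 g →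
      K.boxReal (fun y => g y.1 * K.phase r₀ q y ^ 2) (0, q.1.1, q.1.2)
        = -(2 * g 0 * K.psym r₀ q) := by
    intro g hg
    rw [boxReal_mul_sq hK (g := fun y => g y.1) (y := (0, q.1.1, q.1.2)) hr hω ?_
      (fun y hy => contDiffAt_ext_phase r₀ q hy) hph0, dM_phase r₀ hω hη,
      GStar_toSpacetime hK hr₀ hr hω hη]
    intro y hy
    have : ContDiff ℝ 1 (ext fun y : Pt => g y.1) := hg.comp (contDiff_fst (𝕜 := ℝ))
    exact this.contDiffAt
  have hexp : ContDiff ℝ 1 (fun t : ℝ => Complex.exp (-(Complex.I * σ * (t : ℂ)))) := by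
    have : ContDiff ℝ 1 (fun t : ℝ => (t : ℂ)) := Complex.ofRealCLM.contDiff
    exact ((contDiff_const.mul this).neg).cexp
  have hre : ContDiff ℝ 1 (fun t : ℝ => (Complex.exp (-(Complex.I * σ * (t : ℂ)))).re) :=
    Complex.reCLM.contDiff.comp hexp
  have him : ContDiff ℝ 1 (fun t : ℝ => (Complex.exp (-(Complex.I * σ * (t : ℂ)))).im) :=
    Complex.imCLM.contDiff.comp hexp
  have b1 := hbox _ hre
  have b2 := hbox _ him
  have e1 : (fun y' : Pt => (Complex.exp (-(Complex.I * σ * (y'.1 : ℂ))) *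
      K.lift r₀ (fun x => ((pairL q.2 (x - q.1) : ℝ) : ℂ) ^ 2) y').re)
      = fun y => (Complex.exp (-(Complex.I * σ * (y.1 : ℂ)))).re * K.phase r₀ q y ^ 2 := by
    funext y
    simp only [Data.lift, Data.phase]
    rw [← Complex.ofReal_pow, Complex.re_mul_ofReal]
  have e2 : (fun y' : Pt => (Complex.exp (-(Complex.I * σ * (y'.1 : ℂ))) *
      K.lift r₀ (fun x => ((pairL q.2 (x - q.1) : ℝ) : ℂ) ^ 2) y').im)
      = fun y => (Complex.exp (-(Complex.I * σ * (y.1 : ℂ)))).im * K.phase r₀ q y ^ 2 := by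
    funext y
    simp only [Data.lift, Data.phase]
    rw [← Complex.ofReal_pow, Complex.im_mul_ofReal]
  have e3 : K.lift r₀ (fun x => ((pairL q.2 (x - q.1) : ℝ) : ℂ) ^ 2) (0, q.1.1, q.1.2) = 0 := by
    simp [Data.lift, rot_zero, pairL]
  simp only [Data.symb, principalSymbol, Data.Psigma, Data.waveOp, Data.box]
  rw [e1, e2, b1, b2, e3]
  simp
  ring

/-! ### The Hamilton vector field -/

/-- The derivative of `Data.kap` in its second argument. -/
def Data.dkap (K : Data) (r₀ t : ℝ) : ℝ :=
  ((-(K.b ^ 2 * K.a ^ 2 * K.angVel r₀ ^ 2) + (K.Λ * K.a ^ 2 / 3) ^ 2)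
      * (1 + K.Λ * K.a ^ 2 / 3 * t)
    - (K.b ^ 2 * (-(2 * K.a * K.angVel r₀) + K.a ^ 2 * (1 - t) * K.angVel r₀ ^ 2)
      + K.Λ * K.a ^ 2 / 3 * (K.b + (1 + K.Λ * K.a ^ 2 / 3 * t))) * (K.Λ * K.a ^ 2 / 3))
    / (1 + K.Λ * K.a ^ 2 / 3 * t) ^ 2

/-- The derivative of Carter's constant in `cos² θ`. -/
def Data.dcarter (K : Data) (r₀ : ℝ) (q : Phase) : ℝ :=
  K.Λ * K.a ^ 2 / 3 * angSq q + K.dkap r₀ (q.1.2 2 ^ 2) * angMom q ^ 2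

/-- `f α`. -/
def Data.fa (K : Data) (r₀ r : ℝ) : ℝ := K.f r * K.alpha r₀ r

/-- `h α²`. -/
def Data.ha (K : Data) (r₀ r : ℝ) : ℝ := K.h r * K.alpha r₀ r ^ 2

/-- The derivative of the radial part of the symbol in `r`. -/
def Data.dradial (K : Data) (r₀ : ℝ) (q : Phase) : ℝ :=
  K.dmu q.1.1 * q.2.1 ^ 2 - 2 * K.b * deriv (K.fa r₀) q.1.1 * angMom q * q.2.1
    - K.b ^ 2 * deriv (K.ha r₀) q.1.1 * angMom q ^ 2

/-- Half the derivative of the radial part of the symbol in `ξ_r`. -/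
def Data.radVel (K : Data) (r₀ : ℝ) (q : Phase) : ℝ :=
  K.mu q.1.1 * q.2.1 - K.b * K.fa r₀ q.1.1 * angMom q

/-- The derivative of `ρ² p` in `ξ_φ`. -/
def Data.angVelocity (K : Data) (r₀ : ℝ) (q : Phase) : ℝ :=
  -(2 * K.b * K.fa r₀ q.1.1 * q.2.1) - 2 * K.b ^ 2 * K.ha r₀ q.1.1 * angMom q
    + 2 * K.kap r₀ (q.1.2 2 ^ 2) * angMom q

/-- The third unit vector. -/
def e3 : V := !₂[0, 0, 1]

/-- `Σ vᵢ wᵢ`. -/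
def dot (v w : V) : ℝ := v 0 * w 0 + v 1 * w 1 + v 2 * w 2

/-- A vector field that agrees with the Hamilton vector field on the characteristic set, and
conserves `‖ω‖` and `⟪ω, η⟫` everywhere. -/
def Data.flow (K : Data) (r₀ : ℝ) (q : Phase) : Phase :=
  (K.rho2 q.1.1 q.1.2)⁻¹ •
    ((2 * K.radVel r₀ q,
      K.angVelocity r₀ q • dPhi q.1.2
        + (2 * K.c q.1.2) • (dot q.1.2 q.1.2 • q.2.2 - dot q.1.2 q.2.2 • q.1.2)),
     (-K.dradial r₀ q,
      K.angVelocity r₀ q • dPhi q.2.2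
        - (2 * K.c q.1.2) • (dot q.2.2 q.2.2 • q.1.2 - dot q.1.2 q.2.2 • q.2.2)
        - (2 * q.1.2 2 * K.dcarter r₀ q) • (dot q.1.2 q.1.2 • e3 - q.1.2 2 • q.1.2)))

/-- The correction of `Data.flow` off the characteristic set. -/
def Data.offChar (K : Data) (q : Phase) : Phase :=
  ((0, 0), (2 * q.1.1, (2 * K.a ^ 2 * q.1.2 2) • (e3 - q.1.2 2 • q.1.2)))

theorem gradient_eq_of_hasDerivAt {u : V → ℝ} {x G : V} (hu : DifferentiableAt ℝ u x)
    (h : ∀ v, HasDerivAt (fun s : ℝ => u (x + s • v)) (inner ℝ G v) 0) : gradient u x = G := by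
  refine HasGradientAt.gradient ?_
  rw [hasGradientAt_iff_hasFDerivAt]
  have : (InnerProductSpace.toDual ℝ V) G = fderiv ℝ u x := by
    ext v
    rw [fderiv_apply_of_hasDerivAt hu (h v)]
    simp
  rw [this]
  exact hu.hasFDerivAt

/-- The pullback of the symbol in coordinates. -/
def Data.phat (K : Data) (r₀ : ℝ) (q : Phase) : ℝ :=
  (K.radial r₀ q + ((1 + K.Λ * K.a ^ 2 / 3 * (q.1.2 2 ^ 2 / dot q.1.2 q.1.2)) * angSq q
    + K.kap r₀ (q.1.2 2 ^ 2 / dot q.1.2 q.1.2) * angMom q ^ 2))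
    / (q.1.1 ^ 2 + K.a ^ 2 * (q.1.2 2 ^ 2 / dot q.1.2 q.1.2))

theorem dot_self (v : V) : dot v v = ‖v‖ ^ 2 := by rw [norm_sq_V]; unfold dot; ring

theorem dot_eq_inner (v w : V) : dot v w = inner ℝ v w := by rw [inner_V]; rfl

/-- Both ξ_φ and |ω × η|² are unchanged by the polar-coordinate pullback. Only cos² θ has to be
normalized, which explains the form of `Data.phat`. -/
theorem pullback_symb (hK : K.Subextremal) {r₀ : ℝ} (hr₀ : 0 < r₀) (A : Pt → ℂ) (σ : ℂ)
    {q : Phase} (hr : q.1.1 ∈ K.dom) (hω : q.1.2 ≠ 0) :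
    pullback (K.symb r₀ A σ) q = K.phat r₀ q := by
  obtain ⟨⟨r, ω⟩, ξ, η⟩ := q
  simp only at hr hω
  have hn : ‖ω‖ ≠ 0 := norm_ne_zero_iff.2 hω
  unfold pullback
  simp only
  rw [symb_eq hK hr₀ A σ (q := ((r, ‖ω‖⁻¹ • ω),
    (ξ, ‖ω‖ • η - ((inner ℝ ω η : ℝ) / ‖ω‖) • ω))) hr, Complex.ofReal_re]
  · have hd : dot ω ω = ‖ω‖ ^ 2 := dot_self ω
    have hL : angMom ((r, ‖ω‖⁻¹ • ω), (ξ, ‖ω‖ • η - ((inner ℝ ω η : ℝ) / ‖ω‖) • ω))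
        = angMom ((r, ω), (ξ, η)) := by
      simp [angMom, phiComp]
      field_simp
      ring
    have hJ : angSq ((r, ‖ω‖⁻¹ • ω), (ξ, ‖ω‖ • η - ((inner ℝ ω η : ℝ) / ‖ω‖) • ω))
        = angSq ((r, ω), (ξ, η)) := by
      simp only [angSq, PiLp.smul_apply, PiLp.sub_apply, smul_eq_mul]
      field_simp
      ring
    have hz : (‖ω‖⁻¹ • ω) 2 ^ 2 = ω 2 ^ 2 / dot ω ω := by
      rw [hd]; simp; field_simp
    simp only [Data.psym, Data.phat, Data.radial, Data.carter, Data.c, Data.rho2, hL, hJ, hz]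
  · simp only [norm_smul, norm_inv, norm_norm]
    exact inv_mul_cancel₀ hn
  · simp only [inner_smul_left, inner_sub_right, inner_smul_right, real_inner_self_eq_norm_sq]
    field_simp
    simp

theorem hasDerivAt_alpha (r₀ r : ℝ) :
    HasDerivAt (K.alpha r₀) (-(2 * K.a * r) / (r₀ ^ 2 + K.a ^ 2)) r := by
  have := ((((hasDerivAt_id r).pow 2).const_sub (r₀ ^ 2)).const_mul K.a).div_const (r₀ ^ 2 + K.a ^ 2)
  refine HasDerivAt.congr_deriv this ?_
  simp; ring

theorem contDiff_alpha (r₀ : ℝ) {n : WithTop ℕ∞} : ContDiff ℝ n (K.alpha r₀) := by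
  unfold Data.alpha; fun_prop

theorem analyticAt_alpha (r₀ r : ℝ) : AnalyticAt ℝ (K.alpha r₀) r := by
  unfold Data.alpha; simp only [div_eq_mul_inv]; fun_prop

theorem Data.Subextremal.fa_analyticAt (hK : K.Subextremal) (r₀ : ℝ) {r : ℝ} (hr : r ∈ K.dom) :
    AnalyticAt ℝ (K.fa r₀) r := (hK.f_analyticAt hr).mul (analyticAt_alpha r₀ r)

theorem Data.Subextremal.ha_analyticAt (hK : K.Subextremal) (r₀ : ℝ) {r : ℝ} (hr : r ∈ K.dom) :
    AnalyticAt ℝ (K.ha r₀) r := (hK.h_analyticAt hr).mul ((analyticAt_alpha r₀ r).pow 2)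

theorem hasDerivAt_fa (hK : K.Subextremal) (r₀ : ℝ) {r : ℝ} (hr : r ∈ K.dom) :
    HasDerivAt (K.fa r₀) (deriv (K.fa r₀) r) r :=
  (hK.fa_analyticAt r₀ hr).differentiableAt.hasDerivAt

theorem hasDerivAt_ha (hK : K.Subextremal) (r₀ : ℝ) {r : ℝ} (hr : r ∈ K.dom) :
    HasDerivAt (K.ha r₀) (deriv (K.ha r₀) r) r :=
  (hK.ha_analyticAt r₀ hr).differentiableAt.hasDerivAt

theorem hasDerivAt_kap (hK : K.Subextremal) (r₀ : ℝ) {t : ℝ} (ht : 0 ≤ t) :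
    HasDerivAt (K.kap r₀) (K.dkap r₀ t) t := by
  have hΛ := hK.Λ_pos
  have h0 : 1 + K.Λ * K.a ^ 2 / 3 * t ≠ 0 := by positivity
  have hc : HasDerivAt (fun t => 1 + K.Λ * K.a ^ 2 / 3 * t) (K.Λ * K.a ^ 2 / 3) t :=
    HasDerivAt.congr_deriv (((hasDerivAt_id t).const_mul (K.Λ * K.a ^ 2 / 3)).const_add 1) (by simp)
  have h1 : HasDerivAt (fun t => K.a ^ 2 * (1 - t) * K.angVel r₀ ^ 2)
      (-(K.a ^ 2 * K.angVel r₀ ^ 2)) t :=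
    HasDerivAt.congr_deriv ((((hasDerivAt_id t).const_sub 1).const_mul (K.a ^ 2)).mul_const
      (K.angVel r₀ ^ 2)) (by simp)
  have := (((h1.const_add (-(2 * K.a * K.angVel r₀))).const_mul (K.b ^ 2)).add
    ((hc.const_add K.b).const_mul (K.Λ * K.a ^ 2 / 3))).div hc h0
  refine HasDerivAt.congr_deriv this ?_
  simp only [Data.dkap, Pi.add_apply]
  congr 1
  ring

/-- The radial part in terms of `fa` and `ha`. -/
theorem radial_eq (r₀ : ℝ) (q : Phase) : K.radial r₀ q = K.mu q.1.1 * q.2.1 ^ 2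
    - 2 * K.b * K.fa r₀ q.1.1 * angMom q * q.2.1 - K.b ^ 2 * K.ha r₀ q.1.1 * angMom q ^ 2 := by
  unfold Data.radial Data.fa Data.ha; ring

theorem hasDerivAt_coord {c : ℝ → V} {v : V} {s : ℝ} (h : HasDerivAt c v s) (i : Fin 3) :
    HasDerivAt (fun s => c s i) (v i) s := by
  have := ((EuclideanSpace.proj (𝕜 := ℝ) i).hasFDerivAt (x := c s)).comp_hasDerivAt s h
  exact this

theorem hasDerivAt_angMom {c : ℝ → Phase} {v : Phase} {s : ℝ} (h : HasDerivAt c v s) :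
    HasDerivAt (fun s => angMom (c s)) (phiComp v.1.2 (c s).2.2 + phiComp (c s).1.2 v.2.2) s := by
  have hω := hasDerivAt_coord h.fst.snd
  have hη := hasDerivAt_coord h.snd.snd
  have := ((hω 0).mul (hη 1)).sub ((hω 1).mul (hη 0))
  refine HasDerivAt.congr_deriv this ?_
  simp [phiComp]; ring

theorem hasDerivAt_angSq {c : ℝ → Phase} {v : Phase} {s : ℝ} (h : HasDerivAt c v s) :
    HasDerivAt (fun s => angSq (c s))
      (2 * dot v.1.2 (c s).1.2 * dot (c s).2.2 (c s).2.2
        + 2 * dot (c s).1.2 (c s).1.2 * dot v.2.2 (c s).2.2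
        - 2 * dot (c s).1.2 (c s).2.2 * (dot v.1.2 (c s).2.2 + dot (c s).1.2 v.2.2)) s := by
  have hω := hasDerivAt_coord h.fst.snd
  have hη := hasDerivAt_coord h.snd.snd
  have := (((((hω 0).pow 2).add ((hω 1).pow 2)).add ((hω 2).pow 2)).mul
    ((((hη 0).pow 2).add ((hη 1).pow 2)).add ((hη 2).pow 2))).sub
    (((((hω 0).mul (hη 0)).add ((hω 1).mul (hη 1))).add ((hω 2).mul (hη 2))).pow 2)
  refine HasDerivAt.congr_deriv this ?_
  simp [dot]; ring

theorem hasDerivAt_radial (hK : K.Subextremal) (r₀ : ℝ) {c : ℝ → Phase} {v : Phase} {s : ℝ}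
    (h : HasDerivAt c v s) (hr : (c s).1.1 ∈ K.dom) :
    HasDerivAt (fun s => K.radial r₀ (c s))
      (K.dradial r₀ (c s) * v.1.1 + 2 * K.radVel r₀ (c s) * v.2.1
        + (K.angVelocity r₀ (c s) - 2 * K.kap r₀ ((c s).1.2 2 ^ 2) * angMom (c s))
          * (phiComp v.1.2 (c s).2.2 + phiComp (c s).1.2 v.2.2)) s := by
  have hr' : HasDerivAt (fun s => (c s).1.1) v.1.1 s := h.fst.fst
  have hξ : HasDerivAt (fun s => (c s).2.1) v.2.1 s := h.snd.fst
  have hL := hasDerivAt_angMom h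
  have hmu := (hasDerivAt_mu (K := K) (c s).1.1).comp s hr'
  have hf := (hasDerivAt_fa hK r₀ hr).comp s hr'
  have hh := (hasDerivAt_ha hK r₀ hr).comp s hr'
  have := ((hmu.mul (hξ.pow 2)).sub (((hf.const_mul (2 * K.b)).mul hL).mul hξ)).sub
    ((hh.const_mul (K.b ^ 2)).mul (hL.pow 2))
  have e : (fun s => K.radial r₀ (c s)) = _ := funext fun s => radial_eq r₀ (c s)
  rw [e]
  refine HasDerivAt.congr_deriv this ?_
  simp [Data.dradial, Data.radVel, Data.angVelocity]; ring

theorem differentiableAt_phat (hK : K.Subextremal) (r₀ : ℝ) {q : Phase} (hr : q.1.1 ∈ K.dom)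
    (hω : q.1.2 ≠ 0) : DifferentiableAt ℝ (K.phat r₀) q := by
  have hd : dot q.1.2 q.1.2 ≠ 0 := by
    rw [dot_self]; exact pow_ne_zero _ (norm_ne_zero_iff.2 hω)
  have hd0 : 0 < dot q.1.2 q.1.2 := by
    rw [dot_self]; positivity
  have hL : DifferentiableAt ℝ angMom q := by unfold angMom phiComp; fun_prop
  have hJ : DifferentiableAt ℝ angSq q := by unfold angSq; fun_prop
  have ht : DifferentiableAt ℝ (fun q : Phase => q.1.2 2 ^ 2 / dot q.1.2 q.1.2) q := by
    have hdd : DifferentiableAt ℝ (fun q : Phase => dot q.1.2 q.1.2) q := by unfold dot; fun_prop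
    have hzz : DifferentiableAt ℝ (fun q : Phase => q.1.2 2 ^ 2) q := by fun_prop
    simpa only [div_eq_mul_inv] using hzz.fun_mul (hdd.fun_inv hd)
  have ht0 : 0 ≤ q.1.2 2 ^ 2 / dot q.1.2 q.1.2 := by positivity
  have hk : DifferentiableAt ℝ (fun q : Phase => K.kap r₀ (q.1.2 2 ^ 2 / dot q.1.2 q.1.2)) q :=
    DifferentiableAt.comp q (g := K.kap r₀) (hasDerivAt_kap hK r₀ ht0).differentiableAt ht
  have hf : DifferentiableAt ℝ (fun q : Phase => K.fa r₀ q.1.1) q :=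
    DifferentiableAt.comp q (g := K.fa r₀) (hK.fa_analyticAt r₀ hr).differentiableAt (by fun_prop)
  have hh : DifferentiableAt ℝ (fun q : Phase => K.ha r₀ q.1.1) q :=
    DifferentiableAt.comp q (g := K.ha r₀) (hK.ha_analyticAt r₀ hr).differentiableAt (by fun_prop)
  have hm : DifferentiableAt ℝ (fun q : Phase => K.mu q.1.1) q := by unfold Data.mu; fun_prop
  have hden : q.1.1 ^ 2 + K.a ^ 2 * (q.1.2 2 ^ 2 / dot q.1.2 q.1.2) ≠ 0 := by
    have := hK.pos_of_dom hr
    positivity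
  have hR : DifferentiableAt ℝ (K.radial r₀) q := by
    rw [show K.radial r₀ = _ from funext (radial_eq r₀)]
    fun_prop
  unfold Data.phat
  have h1 : DifferentiableAt ℝ (fun q : Phase => q.1.1 ^ 2 + K.a ^ 2 * (q.1.2 2 ^ 2 / dot q.1.2 q.1.2)) q :=
    DifferentiableAt.fun_add (by fun_prop) (ht.const_mul _)
  have h2 := (hR.fun_add ((((ht.const_mul (K.Λ * K.a ^ 2 / 3)).const_add 1).fun_mul hJ).fun_add
    (hk.fun_mul (hL.fun_pow 2)))).fun_mul (h1.fun_inv hden)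
  refine h2.congr_of_eventuallyEq (Filter.Eventually.of_forall fun x => ?_)
  simp only [div_eq_mul_inv]

/-- The derivative of the pulled back symbol at a point `q` of the cotangent bundle in the
direction `v`. -/
def Data.dphat (K : Data) (r₀ : ℝ) (q v : Phase) : ℝ :=
  (K.rho2 q.1.1 q.1.2)⁻¹ *
    (K.dradial r₀ q * v.1.1 + 2 * K.radVel r₀ q * v.2.1
      + K.angVelocity r₀ q * (phiComp v.1.2 q.2.2 + phiComp q.1.2 v.2.2)
      + 2 * K.c q.1.2 * (dot v.1.2 q.1.2 * dot q.2.2 q.2.2 + dot v.2.2 q.2.2)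
      + 2 * q.1.2 2 * K.dcarter r₀ q * (v.1.2 2 - q.1.2 2 * dot v.1.2 q.1.2)
      - K.psym r₀ q * (2 * q.1.1 * v.1.1
        + 2 * K.a ^ 2 * q.1.2 2 * (v.1.2 2 - q.1.2 2 * dot v.1.2 q.1.2)))

/-- Differentiating along an arbitrary curve gives all partial derivatives at once; they are read
off along lines in `ham_symb`. -/
theorem hasDerivAt_phat (hK : K.Subextremal) (r₀ : ℝ) {c : ℝ → Phase} {v : Phase} {s : ℝ}
    (h : HasDerivAt c v s) (hr : (c s).1.1 ∈ K.dom) (hω : dot (c s).1.2 (c s).1.2 = 1)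
    (hη : dot (c s).1.2 (c s).2.2 = 0) :
    HasDerivAt (fun s => K.phat r₀ (c s)) (K.dphat r₀ (c s) v) s := by
  have hω' := hasDerivAt_coord h.fst.snd
  have hr' : HasDerivAt (fun s => (c s).1.1) v.1.1 s := h.fst.fst
  have hL := hasDerivAt_angMom h
  have hJ := hasDerivAt_angSq h
  have hR := hasDerivAt_radial hK r₀ h hr
  have hd : HasDerivAt (fun s => dot (c s).1.2 (c s).1.2) (2 * dot v.1.2 (c s).1.2) s := by
    refine HasDerivAt.congr_deriv ((((hω' 0).mul (hω' 0)).add ((hω' 1).mul (hω' 1))).add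
      ((hω' 2).mul (hω' 2))) ?_
    simp only [dot]; ring
  have ht : HasDerivAt (fun s => (c s).1.2 2 ^ 2 / dot (c s).1.2 (c s).1.2)
      (2 * (c s).1.2 2 * (v.1.2 2 - (c s).1.2 2 * dot v.1.2 (c s).1.2)) s := by
    refine HasDerivAt.congr_deriv (((hω' 2).pow 2).div hd (by rw [hω]; norm_num)) ?_
    simp [hω]; ring
  have hts : (c s).1.2 2 ^ 2 / dot (c s).1.2 (c s).1.2 = (c s).1.2 2 ^ 2 := by rw [hω]; simp
  have hk : HasDerivAt (fun s => K.kap r₀ ((c s).1.2 2 ^ 2 / dot (c s).1.2 (c s).1.2)) _ s :=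
    HasDerivAt.comp s (h₂ := K.kap r₀) (hasDerivAt_kap hK r₀ (by rw [hω]; positivity)) ht
  have hρ : (c s).1.1 ^ 2 + K.a ^ 2 * ((c s).1.2 2 ^ 2 / dot (c s).1.2 (c s).1.2) ≠ 0 := by
    rw [hts]; exact (hK.rho2_pos hr _).ne'
  have := (hR.add (((((ht.const_mul (K.Λ * K.a ^ 2 / 3)).const_add 1).mul hJ)).add
    (hk.mul (hL.pow 2)))).div ((hr'.pow 2).add (ht.const_mul (K.a ^ 2))) hρ
  refine HasDerivAt.congr_deriv this ?_
  have hcz : 1 + K.Λ * K.a ^ 2 / 3 * (c s).1.2 2 ^ 2 = K.c (c s).1.2 := rfl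
  have hρz : (c s).1.1 ^ 2 + K.a ^ 2 * (c s).1.2 2 ^ 2 = K.rho2 (c s).1.1 (c s).1.2 := rfl
  simp only [Pi.add_apply, Pi.mul_apply, Pi.pow_apply, hω, div_one, hcz, hρz, hη, Data.dphat,
    Data.psym, Data.carter, Data.dcarter]
  have hρ' := (hK.rho2_pos hr (c s).1.2).ne'
  field_simp
  push_cast
  ring

theorem hasDerivAt_line (q v : Phase) : HasDerivAt (fun s : ℝ => q + s • v) v 0 := by
  simpa using ((hasDerivAt_id (0 : ℝ)).smul_const v).const_add q

/-- The Hamilton vector field of the symbol on the cotangent bundle. -/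
theorem ham_symb (hK : K.Subextremal) {r₀ : ℝ} (hr₀ : 0 < r₀) (A : Pt → ℂ) (σ : ℂ)
    {q : Phase} (hr : q.1.1 ∈ K.dom) (hω : dot q.1.2 q.1.2 = 1) (hη : dot q.1.2 q.2.2 = 0) :
    ham (K.symb r₀ A σ) q
      = K.flow r₀ q + (K.psym r₀ q / K.rho2 q.1.1 q.1.2) • K.offChar q := by
  have hω0 : q.1.2 ≠ 0 := by
    intro h; rw [h] at hω; simp [dot] at hω
  have hev : ∀ᶠ q' : Phase in nhds q, pullback (K.symb r₀ A σ) q' = K.phat r₀ q' := by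
    have h1 : ∀ᶠ q' : Phase in nhds q, q'.1.1 ∈ K.dom :=
      (continuous_fst.fst.continuousAt (x := q)).eventually (isOpen_Ioo.mem_nhds hr)
    have h2 : ∀ᶠ q' : Phase in nhds q, q'.1.2 ≠ 0 :=
      (continuous_fst.snd.continuousAt (x := q)).eventually_ne hω0
    filter_upwards [h1, h2] with q' h1 h2
    exact pullback_symb hK hr₀ A σ h1 h2
  have hdiff : DifferentiableAt ℝ (pullback (K.symb r₀ A σ)) q :=
    (differentiableAt_phat hK r₀ hr hω0).congr_of_eventuallyEq hev
  have hline : ∀ v : Phase, HasDerivAt (fun s : ℝ => pullback (K.symb r₀ A σ) (q + s • v))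
      (K.dphat r₀ q v) 0 := by
    intro v
    have hl := hasDerivAt_line q v
    have h := hasDerivAt_phat hK r₀ hl (by simpa using hr) (by simpa using hω) (by simpa using hη)
    simp only [zero_smul, add_zero] at h
    refine h.congr_of_eventuallyEq ?_
    have : Filter.Tendsto (fun s : ℝ => q + s • v) (nhds 0) (nhds q) := by
      simpa using hl.continuousAt.tendsto
    exact this.eventually hev
  obtain ⟨⟨r, ω⟩, ξ, η⟩ := q
  simp only at hr hω hη hω0
  set P := pullback (K.symb r₀ A σ) with hP
  have hρ := (hK.rho2_pos hr ω).ne'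
  have hη' : η 0 * ω 0 + η 1 * ω 1 + η 2 * ω 2 = 0 := by rw [← hη]; unfold dot; ring
  have c1 : deriv (fun s => P ((r, ω), (s, η))) ξ = 2 * K.radVel r₀ ((r, ω), (ξ, η)) / K.rho2 r ω := by
    have h := hline ((0, 0), (1, 0))
    have e : (fun s : ℝ => P (((r, ω), (ξ, η)) + s • ((0, 0), (1, 0)))) =
        fun s => P ((r, ω), (ξ + s, η)) := by funext s; simp
    rw [e] at h
    have h3 : HasDerivAt (fun s => P ((r, ω), (s, η)))
        (K.dphat r₀ ((r, ω), (ξ, η)) ((0, 0), (1, 0))) ξ := by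
      have := HasDerivAt.comp_sub_const (f := fun s => P ((r, ω), (ξ + s, η))) ξ ξ (by simpa using h)
      simpa using this
    rw [h3.deriv]
    simp [Data.dphat, phiComp, dot]
    field_simp
  have c2 : deriv (fun s => P ((s, ω), (ξ, η))) r = K.dradial r₀ ((r, ω), (ξ, η)) / K.rho2 r ω
      - 2 * r * K.psym r₀ ((r, ω), (ξ, η)) / K.rho2 r ω := by
    have h := hline ((1, 0), (0, 0))
    have e : (fun s : ℝ => P (((r, ω), (ξ, η)) + s • ((1, 0), (0, 0)))) =
        fun s => P ((r + s, ω), (ξ, η)) := by funext s; simp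
    rw [e] at h
    have h3 : HasDerivAt (fun s => P ((s, ω), (ξ, η)))
        (K.dphat r₀ ((r, ω), (ξ, η)) ((1, 0), (0, 0))) r := by
      have := HasDerivAt.comp_sub_const (f := fun s => P ((r + s, ω), (ξ, η))) r r (by simpa using h)
      simpa using this
    rw [h3.deriv]
    simp [Data.dphat, phiComp, dot]
    field_simp
  have c3 : gradient (fun η => P ((r, ω), (ξ, η))) η = (K.rho2 r ω)⁻¹ •
      (K.angVelocity r₀ ((r, ω), (ξ, η)) • dPhi ω + (2 * K.c ω) • η) := by
    refine gradient_eq_of_hasDerivAt ?_ fun v => ?_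
    · exact DifferentiableAt.comp (g := P) (f := fun η => ((r, ω), (ξ, η))) η hdiff (by fun_prop)
    · have h := hline ((0, 0), (0, v))
      have e : (fun s : ℝ => P (((r, ω), (ξ, η)) + s • ((0, 0), (0, v)))) =
          fun s => P ((r, ω), (ξ, η + s • v)) := by funext s; simp
      rw [e] at h
      refine h.congr_deriv ?_
      rw [← dot_eq_inner]
      simp [Data.dphat, phiComp, dot, dPhi]
      ring
  have c4 : gradient (fun ω => P ((r, ω), (ξ, η))) ω = (K.rho2 r ω)⁻¹ •
      (-(K.angVelocity r₀ ((r, ω), (ξ, η)) • dPhi η) + (2 * K.c ω * dot η η) • ω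
        + (2 * ω 2 * K.dcarter r₀ ((r, ω), (ξ, η)) - 2 * K.a ^ 2 * ω 2 * K.psym r₀ ((r, ω), (ξ, η)))
          • (e3 - ω 2 • ω)) := by
    refine gradient_eq_of_hasDerivAt ?_ fun v => ?_
    · exact DifferentiableAt.comp (g := P) (f := fun ω => ((r, ω), (ξ, η))) ω hdiff (by fun_prop)
    · have h := hline ((0, v), (0, 0))
      have e : (fun s : ℝ => P (((r, ω), (ξ, η)) + s • ((0, v), (0, 0)))) =
          fun s => P ((r, ω + s • v), (ξ, η)) := by funext s; simp
      rw [e] at h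
      refine h.congr_deriv ?_
      rw [← dot_eq_inner]
      simp [Data.dphat, phiComp, dot, dPhi, e3]
      ring
  unfold ham
  simp only
  rw [c1, c2, c3, c4]
  unfold Data.flow Data.offChar
  simp only [hω, hη]
  refine Prod.ext (Prod.ext ?_ ?_) (Prod.ext ?_ ?_)
  · simp; ring
  · simp
  · simp; field_simp; ring
  · ext i
    simp
    ring

/-! ### Conserved quantities -/

/-- The characteristic set in explicit form. -/
def Data.Char (K : Data) (r₀ : ℝ) : Set Phase :=
  {q | q ∈ K.cotangent ∧ K.radial r₀ q + K.carter r₀ q = 0}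

theorem dot_of_cotangent {q : Phase} (hq : q ∈ K.cotangent) :
    dot q.1.2 q.1.2 = 1 ∧ dot q.1.2 q.2.2 = 0 := by
  obtain ⟨-, h1, h2, -⟩ := hq
  exact ⟨by rw [dot_self, h1]; norm_num, by rw [dot_eq_inner, h2]⟩

theorem psym_eq_zero_iff (hK : K.Subextremal) (r₀ : ℝ) {q : Phase} (hq : q ∈ K.cotangent) :
    K.psym r₀ q = 0 ↔ K.radial r₀ q + K.carter r₀ q = 0 := by
  unfold Data.psym
  rw [div_eq_zero_iff]
  simp [(hK.rho2_pos hq.1 q.1.2).ne']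

theorem charSet_symb (hK : K.Subextremal) {r₀ : ℝ} (hr₀ : 0 < r₀) (A : Pt → ℂ) (σ : ℂ) :
    charSet K.cotangent (K.symb r₀ A σ) = K.Char r₀ := by
  ext q
  simp only [charSet, Data.Char, Set.mem_ofPred_eq]
  refine and_congr_right fun hq => ?_
  rw [symb_eq hK hr₀ A σ hq.1 hq.2.1 hq.2.2.1, ← psym_eq_zero_iff hK r₀ hq, Complex.ofReal_eq_zero]

/-- The correction term carries a factor p: dividing the Hamiltonian ρ²p by ρ² changes its Hamilton
field on {p = 0} only by the factor ρ⁻². -/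
theorem ham_of_char (hK : K.Subextremal) {r₀ : ℝ} (hr₀ : 0 < r₀) (A : Pt → ℂ) (σ : ℂ) {q : Phase}
    (hq : q ∈ K.Char r₀) : ham (K.symb r₀ A σ) q = K.flow r₀ q := by
  obtain ⟨h1, h2⟩ := dot_of_cotangent hq.1
  rw [ham_symb hK hr₀ A σ hq.1.1 h1 h2, (psym_eq_zero_iff hK r₀ hq.1).2 hq.2]
  simp

/-- The derivative of Carter's constant. -/
def Data.fcarter (K : Data) (r₀ : ℝ) (q v : Phase) : ℝ :=
  K.c q.1.2 * (2 * dot v.1.2 q.1.2 * dot q.2.2 q.2.2 + 2 * dot q.1.2 q.1.2 * dot v.2.2 q.2.2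
    - 2 * dot q.1.2 q.2.2 * (dot v.1.2 q.2.2 + dot q.1.2 v.2.2))
  + 2 * q.1.2 2 * v.1.2 2 * K.dcarter r₀ q
  + 2 * K.kap r₀ (q.1.2 2 ^ 2) * angMom q * (phiComp v.1.2 q.2.2 + phiComp q.1.2 v.2.2)

theorem hasDerivAt_carter (hK : K.Subextremal) (r₀ : ℝ) {c : ℝ → Phase} {v : Phase} {s : ℝ}
    (h : HasDerivAt c v s) :
    HasDerivAt (fun s => K.carter r₀ (c s)) (K.fcarter r₀ (c s) v) s := by
  have hω := hasDerivAt_coord h.fst.snd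
  have hz := (hω 2).pow 2
  have hk := HasDerivAt.comp s (h₂ := K.kap r₀) (hasDerivAt_kap hK r₀ (sq_nonneg ((c s).1.2 2))) hz
  have := (((hz.const_mul (K.Λ * K.a ^ 2 / 3)).const_add 1).mul (hasDerivAt_angSq h)).add
    (hk.mul ((hasDerivAt_angMom h).pow 2))
  refine HasDerivAt.congr_deriv this ?_
  simp [Data.fcarter, Data.dcarter, Data.c]
  ring

/-- Rotation about the axis, acting on ω and η together, is a symmetry of the symbol. -/
theorem angMom_flow (r₀ : ℝ) (q : Phase) :
    phiComp (K.flow r₀ q).1.2 q.2.2 + phiComp q.1.2 (K.flow r₀ q).2.2 = 0 := by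
  simp [Data.flow, phiComp, dPhi, e3, dot]
  ring

/-- The radial part of ρ²p depends on the sphere variables only through ξ_φ, which Poisson-commutes
with Carter's constant. -/
theorem fcarter_flow (r₀ : ℝ) {q : Phase} (hω : dot q.1.2 q.1.2 = 1) :
    K.fcarter r₀ q (K.flow r₀ q) = 0 := by
  unfold Data.fcarter
  rw [angMom_flow]
  generalize hD : K.dcarter r₀ q = D
  generalize hG : K.angVelocity r₀ q = G
  simp only [Data.flow, hD, hG]
  generalize K.c q.1.2 = c
  generalize (K.rho2 q.1.1 q.1.2)⁻¹ = ρ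
  unfold dot at *
  simp [dPhi, e3]
  linear_combination (-(4 * ρ * c * D * q.1.2 2) *
    ((q.1.2 0 ^ 2 + q.1.2 1 ^ 2 + q.1.2 2 ^ 2) * q.2.2 2
      - (q.1.2 0 * q.2.2 0 + q.1.2 1 * q.2.2 1 + q.1.2 2 * q.2.2 2) * q.1.2 2)) * hω

/-- Solutions of the flow conserve the equations of the cotangent bundle. -/
theorem dot_flow (r₀ : ℝ) (q : Phase) : dot (K.flow r₀ q).1.2 q.1.2 = 0 ∧
    dot (K.flow r₀ q).1.2 q.2.2 + dot q.1.2 (K.flow r₀ q).2.2 = 0 := by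
  constructor
  · simp [Data.flow, dPhi, e3, dot]; ring
  · simp [Data.flow, dPhi, e3, dot]; ring

theorem hasDerivAt_dot {c d : ℝ → V} {v w : V} {s : ℝ} (hc : HasDerivAt c v s)
    (hd : HasDerivAt d w s) :
    HasDerivAt (fun s => dot (c s) (d s)) (dot v (d s) + dot (c s) w) s := by
  have h1 := hasDerivAt_coord hc
  have h2 := hasDerivAt_coord hd
  have := (((h1 0).mul (h2 0)).add ((h1 1).mul (h2 1))).add ((h1 2).mul (h2 2))
  refine HasDerivAt.congr_deriv this ?_
  simp [dot]; ring

/-- The effective potential. -/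
def Data.pot (K : Data) (r₀ L Q r : ℝ) : ℝ := K.b ^ 2 * K.alpha r₀ r ^ 2 * L ^ 2 - K.mu r * Q

/-- The derivative of the effective potential. -/
def Data.dpot (K : Data) (r₀ L Q r : ℝ) : ℝ :=
  2 * K.b ^ 2 * K.alpha r₀ r * (-(2 * K.a * r) / (r₀ ^ 2 + K.a ^ 2)) * L ^ 2 - K.dmu r * Q

theorem hasDerivAt_pot (r₀ L Q r : ℝ) : HasDerivAt (K.pot r₀ L Q) (K.dpot r₀ L Q r) r := by
  have := ((((hasDerivAt_alpha (K := K) r₀ r).pow 2).const_mul (K.b ^ 2)).mul_const (L ^ 2)).sub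
    ((hasDerivAt_mu (K := K) r).mul_const Q)
  refine HasDerivAt.congr_deriv this ?_
  simp only [Data.dpot]
  push_cast
  ring

theorem continuous_dpot (r₀ L Q : ℝ) : Continuous (K.dpot r₀ L Q) := by
  unfold Data.dpot
  have h1 := (contDiff_alpha (K := K) r₀ (n := 0)).continuous
  have h2 := (contDiff_dmu (K := K) (n := 0)).continuous
  fun_prop

/-- The energy-type function `E` whose sign distinguishes the two components of the
characteristic set. -/
def Data.energy (K : Data) (r₀ : ℝ) (q : Phase) : ℝ :=
  K.b * K.f q.1.1 * q.2.1 + K.b ^ 2 * K.h q.1.1 * (K.alpha r₀ q.1.1 * angMom q)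

/-! ### Quadratic relations on the characteristic set -/

section algebra

variable (hK : K.Subextremal) {r₀ : ℝ} {q : Phase} (hq : q ∈ K.Char r₀)
include hK hq

/-- The radial part is a quadratic form in (ξ_r, X), X = αL, with determinant -b²(μh + f²) = -b².
Its half partial derivatives are Y and -E. Completing the square in X gives this relation,
completing it in ξ_r gives `radVel_sq`, and the next two identities invert the linear map (ξ_r, X) ↦
(Y, E). -/
theorem energy_sq : K.energy r₀ q ^ 2 = K.b ^ 2 * (q.2.1 ^ 2 + K.h q.1.1 * K.carter r₀ q) := by
  have h1 := hK.mu_mul_h hq.1.1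
  have h2 := hq.2
  unfold Data.radial at h2
  unfold Data.energy
  generalize K.carter r₀ q = Q at *
  linear_combination K.b ^ 2 * q.2.1 ^ 2 * h1 - K.b ^ 2 * K.h q.1.1 * h2

theorem radVel_sq : K.radVel r₀ q ^ 2 = K.pot r₀ (angMom q) (K.carter r₀ q) q.1.1 := by
  have h1 := hK.mu_mul_h hq.1.1
  have h2 := hq.2
  unfold Data.radial at h2
  unfold Data.radVel Data.pot Data.fa
  generalize K.carter r₀ q = Q at *
  linear_combination K.mu q.1.1 * h2 + K.b ^ 2 * K.alpha r₀ q.1.1 ^ 2 * angMom q ^ 2 * h1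

theorem mu_mul_energy : K.mu q.1.1 * K.energy r₀ q
    = K.b * (K.f q.1.1 * K.radVel r₀ q + K.b * (K.alpha r₀ q.1.1 * angMom q)) := by
  have h1 := hK.mu_mul_h hq.1.1
  unfold Data.energy Data.radVel Data.fa
  linear_combination K.b ^ 2 * (K.alpha r₀ q.1.1 * angMom q) * h1

theorem b_mul_xi : K.b * q.2.1 = K.f q.1.1 * K.energy r₀ q
    + K.b * K.h q.1.1 * K.radVel r₀ q := by
  have h1 := hK.mu_mul_h hq.1.1
  unfold Data.energy Data.radVel Data.fa
  linear_combination (-(K.b * q.2.1)) * h1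

/-- For Q > 0 the right side is positive at a horizon, where f² = 1. So E can become infinite there
only if b X - fY tends to 0; this is the form in which finiteness of E is decided. -/
theorem energy_mul : K.energy r₀ q * (K.b * (K.alpha r₀ q.1.1 * angMom q)
      - K.f q.1.1 * K.radVel r₀ q)
    = K.b * (K.h q.1.1 * K.b ^ 2 * (K.alpha r₀ q.1.1 * angMom q) ^ 2
      + K.f q.1.1 ^ 2 * K.carter r₀ q) := by
  have h1 := hK.mu_mul_h hq.1.1
  have h2 := hq.2
  unfold Data.radial at h2
  unfold Data.energy Data.radVel Data.fa
  generalize K.carter r₀ q = Q at *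
  linear_combination (-(K.b * K.f q.1.1 ^ 2)) * h2
    - K.b ^ 2 * K.f q.1.1 * q.2.1 * (K.alpha r₀ q.1.1 * angMom q) * h1

end algebra

/-! ### Positivity -/

section positivity

variable (hK : K.Subextremal) {r₀ : ℝ}
include hK

theorem Data.Subextremal.one_le_b : 1 ≤ K.b := by
  have := hK.Λ_pos
  have : 0 ≤ K.Λ * K.a ^ 2 / 3 := by positivity
  unfold Data.b; linarith

theorem Data.Subextremal.one_le_c (ω : V) : 1 ≤ K.c ω := by
  have := hK.Λ_pos
  have : 0 ≤ K.Λ * K.a ^ 2 / 3 * ω 2 ^ 2 := by positivity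
  unfold Data.c; linarith

omit hK in
theorem z_sq_le {q : Phase} (hq : q ∈ K.cotangent) : q.1.2 2 ^ 2 ≤ 1 := by
  have := (dot_of_cotangent hq).1
  unfold dot at this
  nlinarith [sq_nonneg (q.1.2 0), sq_nonneg (q.1.2 1)]

theorem Data.Subextremal.c_le_b {q : Phase} (hq : q ∈ K.cotangent) : K.c q.1.2 ≤ K.b := by
  have := hK.Λ_pos
  have h0 : 0 ≤ K.Λ * K.a ^ 2 / 3 := by positivity
  have := z_sq_le hq
  unfold Data.b Data.c
  nlinarith

/-- The radius-independent lower bound for `1 - a Ω sin² θ`. -/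
def Data.lowFac (K : Data) (r₀ : ℝ) : ℝ := r₀ ^ 2 / (r₀ ^ 2 + K.a ^ 2)

omit hK in
theorem lowFac_pos (hr₀ : 0 < r₀) : 0 < K.lowFac r₀ := by unfold Data.lowFac; positivity

omit hK in
theorem lowFac_le_one (hr₀ : 0 < r₀) : K.lowFac r₀ ≤ 1 := by
  unfold Data.lowFac
  rw [div_le_one (by positivity)]
  nlinarith [sq_nonneg K.a]

omit hK in
theorem angSq_nonneg (q : Phase) : 0 ≤ angSq q := by
  unfold angSq
  nlinarith [sq_nonneg (q.1.2 0 * q.2.2 1 - q.1.2 1 * q.2.2 0),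
    sq_nonneg (q.1.2 0 * q.2.2 2 - q.1.2 2 * q.2.2 0),
    sq_nonneg (q.1.2 1 * q.2.2 2 - q.1.2 2 * q.2.2 1)]

omit hK in
theorem angSq_eq {q : Phase} (hq : q ∈ K.cotangent) : angSq q = ‖q.2.2‖ ^ 2 := by
  obtain ⟨h1, h2⟩ := dot_of_cotangent hq
  rw [norm_sq_V]
  unfold dot at h1 h2
  unfold angSq
  rw [h2]
  linear_combination (q.2.2 0 ^ 2 + q.2.2 1 ^ 2 + q.2.2 2 ^ 2) * h1

omit hK in
theorem angMom_sq_le {q : Phase} (hq : q ∈ K.cotangent) :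
    angMom q ^ 2 ≤ (1 - q.1.2 2 ^ 2) * angSq q := by
  have h1 := (dot_of_cotangent hq).1
  rw [angSq_eq hq, norm_sq_V]
  have hy : 1 - q.1.2 2 ^ 2 = q.1.2 0 ^ 2 + q.1.2 1 ^ 2 := by
    unfold dot at h1; linarith
  rw [hy]
  unfold angMom phiComp
  nlinarith [sq_nonneg (q.1.2 0 * q.2.2 0 + q.1.2 1 * q.2.2 1), sq_nonneg (q.1.2 0 * q.2.2 2),
    sq_nonneg (q.1.2 1 * q.2.2 2)]

omit hK in
theorem angMom_sq_le_norm {q : Phase} (hq : q ∈ K.cotangent) : angMom q ^ 2 ≤ ‖q.2.2‖ ^ 2 := by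
  have h1 := angMom_sq_le hq
  rw [angSq_eq hq] at h1
  nlinarith [sq_nonneg (q.1.2 2), sq_nonneg ‖q.2.2‖, mul_nonneg (sq_nonneg (q.1.2 2)) (sq_nonneg ‖q.2.2‖)]

/-- After multiplication by c sin² θ, Carter's constant is a sum of two nonnegative terms, because
L² ≤ sin² θ |η|². Away from the poles this yields its positivity. -/
theorem carter_identity {q : Phase} :
    (1 - q.1.2 2 ^ 2) * (K.c q.1.2 * K.carter r₀ q)
      = K.c q.1.2 ^ 2 * ((1 - q.1.2 2 ^ 2) * angSq q - angMom q ^ 2)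
        + K.b ^ 2 * (angMom q * (1 - K.a * K.angVel r₀ * (1 - q.1.2 2 ^ 2))) ^ 2 := by
  have hc := (hK.c_pos q.1.2).ne'
  unfold Data.carter Data.kap
  have hcz : 1 + K.Λ * K.a ^ 2 / 3 * q.1.2 2 ^ 2 = K.c q.1.2 := rfl
  rw [hcz]
  have e : K.c q.1.2 = 1 + (K.b - 1) * q.1.2 2 ^ 2 := by unfold Data.c Data.b; ring
  have e' : K.Λ * K.a ^ 2 / 3 = K.b - 1 := by unfold Data.b; ring
  rw [e']
  generalize K.c q.1.2 = c at *
  generalize q.1.2 2 ^ 2 = t at *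
  field_simp
  rw [e]
  ring

omit hK in
theorem one_sub_pos (hr₀ : 0 < r₀) {y : ℝ} (h1 : y ≤ 1) :
    K.lowFac r₀ ≤ 1 - K.a * K.angVel r₀ * y := by
  have hden : 0 < r₀ ^ 2 + K.a ^ 2 := by positivity
  have : K.a * K.angVel r₀ * y ≤ K.a ^ 2 / (r₀ ^ 2 + K.a ^ 2) := by
    unfold Data.angVel
    rw [show K.a * (K.a / (r₀ ^ 2 + K.a ^ 2)) * y = K.a ^ 2 * y / (r₀ ^ 2 + K.a ^ 2) by ring]
    gcongr
    nlinarith [sq_nonneg K.a]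
  have h2 : K.lowFac r₀ = 1 - K.a ^ 2 / (r₀ ^ 2 + K.a ^ 2) := by
    unfold Data.lowFac; field_simp; ring
  linarith

/-- Carter's constant is a positive definite quadratic form in `η`. -/
theorem carter_lower (hr₀ : 0 < r₀) {q : Phase} (hq : q ∈ K.cotangent) :
    K.lowFac r₀ ^ 2 / K.b * ‖q.2.2‖ ^ 2 ≤ K.carter r₀ q := by
  have hb := hK.b_pos
  have hc1 := hK.one_le_c q.1.2
  have hb1 := hK.one_le_b
  have hcb := hK.c_le_b hq
  have hd0 := lowFac_pos (K := K) hr₀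
  have hd1 := lowFac_le_one (K := K) hr₀
  have hL := angMom_sq_le hq
  have hz := z_sq_le hq
  rw [← angSq_eq hq]
  have hJ := angSq_nonneg q
  rw [div_mul_eq_mul_div, div_le_iff₀ hb]
  -- At a pole the identity degenerates to 0 = 0 and has to be replaced: there L = 0 and Carter's
  -- constant is c|η|².
  rcases hz.eq_or_lt with h1 | h1
  · have hL0 : angMom q ^ 2 = 0 := le_antisymm (by rw [h1] at hL; simpa using hL) (sq_nonneg _)
    have : K.carter r₀ q = K.c q.1.2 * angSq q := by unfold Data.carter; rw [hL0]; ring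
    rw [this]
    have h3 : K.lowFac r₀ ^ 2 ≤ 1 := by nlinarith
    calc K.lowFac r₀ ^ 2 * angSq q ≤ 1 * angSq q := by gcongr
      _ = 1 * angSq q * 1 := by ring
      _ ≤ K.c q.1.2 * angSq q * K.b := by gcongr
  · have hy : 0 < 1 - q.1.2 2 ^ 2 := by linarith
    have hid := carter_identity hK (r₀ := r₀) (q := q)
    have hl := one_sub_pos (K := K) hr₀ (y := 1 - q.1.2 2 ^ 2) (by nlinarith [sq_nonneg (q.1.2 2)])
    have hZ : K.lowFac r₀ ^ 2 * angMom q ^ 2 ≤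
        K.b ^ 2 * (angMom q * (1 - K.a * K.angVel r₀ * (1 - q.1.2 2 ^ 2))) ^ 2 := by
      rw [mul_pow, ← mul_assoc, mul_comm (K.b ^ 2), mul_assoc]
      have : K.lowFac r₀ ^ 2 ≤ (1 - K.a * K.angVel r₀ * (1 - q.1.2 2 ^ 2)) ^ 2 := by gcongr
      have hbb : 1 ≤ K.b ^ 2 := one_le_pow₀ hb1
      calc K.lowFac r₀ ^ 2 * angMom q ^ 2 = angMom q ^ 2 * (1 * K.lowFac r₀ ^ 2) := by ring
        _ ≤ angMom q ^ 2 * (K.b ^ 2 * (1 - K.a * K.angVel r₀ * (1 - q.1.2 2 ^ 2)) ^ 2) := by gcongr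
    have hJL : 0 ≤ (1 - q.1.2 2 ^ 2) * angSq q - angMom q ^ 2 := by linarith
    have hcc : K.lowFac r₀ ^ 2 ≤ K.c q.1.2 ^ 2 := by gcongr; linarith
    have h4 : K.lowFac r₀ ^ 2 * ((1 - q.1.2 2 ^ 2) * angSq q)
        ≤ (1 - q.1.2 2 ^ 2) * (K.c q.1.2 * K.carter r₀ q) := by
      rw [hid]
      have := mul_le_mul_of_nonneg_right hcc hJL
      nlinarith
    have h5 : K.lowFac r₀ ^ 2 * angSq q ≤ K.c q.1.2 * K.carter r₀ q := by
      refine le_of_mul_le_mul_left ?_ hy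
      linarith
    have h6 : 0 ≤ K.carter r₀ q := by
      have h7 : 0 ≤ K.c q.1.2 * K.carter r₀ q := le_trans (by positivity) h5
      exact nonneg_of_mul_nonneg_right h7 (by linarith)
    calc _ ≤ _ := h5
      _ ≤ K.b * K.carter r₀ q := by gcongr
      _ = _ := mul_comm _ _

theorem carter_nonneg (hr₀ : 0 < r₀) {q : Phase} (hq : q ∈ K.cotangent) : 0 ≤ K.carter r₀ q :=
  le_trans (by have := hK.b_pos; positivity) (carter_lower hK hr₀ hq)

theorem carter_eq_zero_iff (hr₀ : 0 < r₀) {q : Phase} (hq : q ∈ K.cotangent) :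
    K.carter r₀ q = 0 ↔ q.2.2 = 0 := by
  constructor
  · intro h
    have h1 := carter_lower hK hr₀ hq
    rw [h] at h1
    have hb := hK.b_pos
    have hd0 := lowFac_pos (K := K) hr₀
    have h2 : 0 < K.lowFac r₀ ^ 2 / K.b := by positivity
    have h3 : ‖q.2.2‖ ^ 2 ≤ 0 := by
      by_contra h4
      push Not at h4
      linarith [mul_pos h2 h4]
    have : ‖q.2.2‖ = 0 := by nlinarith [norm_nonneg q.2.2]
    exact norm_eq_zero.1 this
  · intro h
    simp [Data.carter, angSq, angMom, phiComp, h]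

/-- `angMom² ≤ C carter`. -/
theorem angMom_sq_le_carter (hr₀ : 0 < r₀) {q : Phase} (hq : q ∈ K.cotangent) :
    angMom q ^ 2 ≤ K.b / K.lowFac r₀ ^ 2 * K.carter r₀ q := by
  have h1 := carter_lower hK hr₀ hq
  have hb := hK.b_pos
  have hd0 := lowFac_pos (K := K) hr₀
  refine (angMom_sq_le_norm hq).trans ?_
  rw [div_mul_eq_mul_div, le_div_iff₀ (by positivity)]
  rw [div_mul_eq_mul_div, div_le_iff₀ hb] at h1
  linarith

omit hK in
theorem timeComp_eq (r₀ : ℝ) (hr₀ : 0 < r₀) (q : Phase) :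
    K.timeComp r₀ q = (K.rho2 q.1.1 q.1.2)⁻¹ * (-((q.1.1 ^ 2 + K.a ^ 2) * K.energy r₀ q)
      + K.b ^ 2 / K.c q.1.2 * K.a * (angMom q * (1 - K.a * K.angVel r₀ * (1 - q.1.2 2 ^ 2)))) := by
  have hden : r₀ ^ 2 + K.a ^ 2 ≠ 0 := by positivity
  have hα : K.alpha r₀ q.1.1 * angMom q
      = (q.1.1 ^ 2 + K.a ^ 2) * (-(K.angVel r₀ * angMom q)) + K.a * angMom q := by
    unfold Data.alpha Data.angVel; field_simp; ring
  unfold Data.timeComp Data.GStar Data.toSpacetime Data.sharp pairM Data.energy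
  rw [hα]
  simp [angMom]
  left
  ring

/-- This is G_*(dt_*, dt_*) < 0 written out. -/
theorem spacelike_h {r : ℝ} (hr : r ∈ K.dom) (ω : V) (hω : ‖ω‖ = 1) :
    K.a ^ 2 * (1 - ω 2 ^ 2) / K.c ω < K.h r * (r ^ 2 + K.a ^ 2) ^ 2 := by
  have h := hK.spacelike (0, r, ω) hr hω
  have hρ := hK.rho2_pos hr ω
  have hb := hK.b_pos
  have e : K.GStar (0, r, ω) (1, 0, 0) (1, 0, 0) = (K.rho2 r ω)⁻¹ * K.b ^ 2 *
      (K.a ^ 2 * (1 - ω 2 ^ 2) / K.c ω - K.h r * (r ^ 2 + K.a ^ 2) ^ 2) := by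
    simp [Data.GStar, Data.sharp, pairM, phiComp]
    ring
  rw [e] at h
  by_contra hcon
  push Not at hcon
  have : 0 ≤ (K.rho2 r ω)⁻¹ * K.b ^ 2 *
      (K.a ^ 2 * (1 - ω 2 ^ 2) / K.c ω - K.h r * (r ^ 2 + K.a ^ 2) ^ 2) :=
    mul_nonneg (by positivity) (by linarith)
  linarith

/-- The spacelike condition at a pole, where the term with sin² θ disappears. -/
theorem h_pos {r : ℝ} (hr : r ∈ K.dom) : 0 < K.h r := by
  have h := spacelike_h hK hr e3 (by
    have : ‖e3‖ ^ 2 = 1 := by rw [norm_sq_V]; simp [e3]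
    nlinarith [norm_nonneg e3])
  have e : (e3 : V) 2 = 1 := by simp [e3]
  rw [e] at h
  have hr0 := hK.pos_of_dom hr
  simp at h
  exact pos_of_mul_pos_left h (by positivity)

/-- E² is b² times ξ_r² + hQ, which is positive definite in the covector. -/
theorem energy_ne_zero (hr₀ : 0 < r₀) {q : Phase} (hq : q ∈ K.Char r₀) : K.energy r₀ q ≠ 0 := by
  intro h0
  have h := energy_sq hK hq
  rw [h0, zero_pow two_ne_zero] at h
  have hh := h_pos hK hq.1.1
  have hQ := carter_nonneg hK hr₀ hq.1
  have hb := hK.b_pos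
  have h1 : q.2.1 ^ 2 + K.h q.1.1 * K.carter r₀ q = 0 := by
    rcases mul_eq_zero.1 h.symm with h2 | h2
    · exact absurd h2 (by positivity)
    · simpa using h2
  have h2 : q.2.1 ^ 2 = 0 := by nlinarith [sq_nonneg q.2.1, mul_nonneg hh.le hQ]
  have h3 : K.carter r₀ q = 0 := by
    have : K.h q.1.1 * K.carter r₀ q = 0 := by linarith
    exact (mul_eq_zero.1 this).resolve_left hh.ne'
  refine hq.1.2.2.2 (Prod.ext ?_ ?_)
  · simpa using h2
  · exact (carter_eq_zero_iff hK hr₀ hq.1).1 h3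

/-- On the characteristic set the energy dominates in the time component. -/
theorem timeComp_energy (hr₀ : 0 < r₀) {q : Phase} (hq : q ∈ K.Char r₀) :
    (0 < K.timeComp r₀ q → K.energy r₀ q < 0) ∧ (K.timeComp r₀ q < 0 → 0 < K.energy r₀ q) := by
  have hE := energy_ne_zero hK hr₀ hq
  have hρ := hK.rho2_pos hq.1.1 q.1.2
  have hc := hK.c_pos q.1.2
  have hb := hK.b_pos
  have hQ := carter_nonneg hK hr₀ hq.1
  set Z := angMom q * (1 - K.a * K.angVel r₀ * (1 - q.1.2 2 ^ 2)) with hZ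
  have hid := carter_identity hK (r₀ := r₀) (q := q)
  rw [← hZ] at hid
  have hL := angMom_sq_le hq.1
  have h1 : K.b ^ 2 * Z ^ 2 ≤ (1 - q.1.2 2 ^ 2) * (K.c q.1.2 * K.carter r₀ q) := by
    rw [hid]
    have : 0 ≤ K.c q.1.2 ^ 2 * ((1 - q.1.2 2 ^ 2) * angSq q - angMom q ^ 2) :=
      mul_nonneg (by positivity) (by linarith)
    linarith
  have hs := spacelike_h hK hq.1.1 q.1.2 hq.1.2.1
  have hr0 := hK.pos_of_dom hq.1.1
  -- A Cauchy-Schwarz estimate for dt_*: the angular term is bounded by Carter's constant through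
  -- `carter_identity`, then by hQ through the spacelike condition, then by E² through `energy_sq`.
  -- Hence the E term decides the sign of the time component.
  have hbound : (K.b ^ 2 / K.c q.1.2 * K.a * Z) ^ 2 ≤ ((q.1.1 ^ 2 + K.a ^ 2) * K.energy r₀ q) ^ 2 := by
    calc (K.b ^ 2 / K.c q.1.2 * K.a * Z) ^ 2
        = K.b ^ 2 * K.a ^ 2 / K.c q.1.2 ^ 2 * (K.b ^ 2 * Z ^ 2) := by field_simp
      _ ≤ K.b ^ 2 * K.a ^ 2 / K.c q.1.2 ^ 2 * ((1 - q.1.2 2 ^ 2) * (K.c q.1.2 * K.carter r₀ q)) := by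
          gcongr
      _ = K.b ^ 2 * K.carter r₀ q * (K.a ^ 2 * (1 - q.1.2 2 ^ 2) / K.c q.1.2) := by field_simp
      _ ≤ K.b ^ 2 * K.carter r₀ q * (K.h q.1.1 * (q.1.1 ^ 2 + K.a ^ 2) ^ 2) := by gcongr
      _ ≤ (q.1.1 ^ 2 + K.a ^ 2) ^ 2 * (K.b ^ 2 * (q.2.1 ^ 2 + K.h q.1.1 * K.carter r₀ q)) := by
          nlinarith [mul_nonneg (sq_nonneg (q.1.1 ^ 2 + K.a ^ 2)) (sq_nonneg (K.b * q.2.1))]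
      _ = _ := by rw [mul_pow, energy_sq hK hq]
  have hab := sq_le_sq.1 hbound
  rw [timeComp_eq r₀ hr₀, ← hZ]
  have hpos : 0 < q.1.1 ^ 2 + K.a ^ 2 := by positivity
  constructor
  · intro h
    have h2 := (mul_pos_iff_of_pos_left (inv_pos.2 hρ)).1 h
    by_contra hcon
    push Not at hcon
    rw [abs_of_nonneg (a := (q.1.1 ^ 2 + K.a ^ 2) * K.energy r₀ q) (by positivity)] at hab
    linarith [le_abs_self (K.b ^ 2 / K.c q.1.2 * K.a * Z)]
  · intro h
    by_contra hcon
    push Not at hcon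
    have : 0 ≤ -((q.1.1 ^ 2 + K.a ^ 2) * K.energy r₀ q) + K.b ^ 2 / K.c q.1.2 * K.a * Z := by
      rw [abs_of_nonpos (a := (q.1.1 ^ 2 + K.a ^ 2) * K.energy r₀ q)
        (mul_nonpos_of_nonneg_of_nonpos hpos.le hcon)] at hab
      linarith [neg_abs_le (K.b ^ 2 / K.c q.1.2 * K.a * Z)]
    linarith [mul_nonneg (inv_pos.2 hρ).le this]

end positivity

/-! ### Extension of integral curves -/

section ODE

open Set Filter Topology

variable {E : Type*} [NormedAddCommGroup E] [NormedSpace ℝ E] [CompleteSpace E]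

/-- A bounded derivative makes the curve Lipschitz, so its values form a Cauchy filter at the right
endpoint. -/
theorem exists_tendsto_of_bounded_deriv {γ γ' : ℝ → E} {a S C : ℝ}
    (hγ : ∀ t ∈ Ioo a S, HasDerivAt γ (γ' t) t) (hC : ∀ t ∈ Ioo a S, ‖γ' t‖ ≤ C) (haS : a < S) :
    ∃ q, Tendsto γ (𝓝[<] S) (𝓝 q) := by
  have hC0 : 0 ≤ C := by
    have : (a + S) / 2 ∈ Ioo a S := ⟨by linarith, by linarith⟩
    exact (norm_nonneg _).trans (hC _ this)
  have hlip : ∀ x ∈ Ioo a S, ∀ y ∈ Ioo a S, ‖γ y - γ x‖ ≤ C * ‖y - x‖ := fun x hx y hy =>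
    (convex_Ioo a S).norm_image_sub_le_of_norm_hasDerivWithin_le
      (fun t ht => (hγ t ht).hasDerivWithinAt) hC hx hy
  have hcau : Cauchy (map γ (𝓝[<] S)) := by
    rw [Metric.cauchy_iff]
    refine ⟨inferInstance, fun ε hε => ?_⟩
    have hC1 : 0 < C + 1 := by linarith
    have hd : 0 < ε / (C + 1) := by positivity
    refine ⟨γ '' Ioo (max a (S - ε / (C + 1))) S, image_mem_map (Ioo_mem_nhdsLT (by simp [haS, hd])), ?_⟩
    rintro _ ⟨x, hx, rfl⟩ _ ⟨y, hy, rfl⟩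
    have hx1 := (max_lt_iff.1 hx.1)
    have hy1 := (max_lt_iff.1 hy.1)
    rw [dist_comm, dist_eq_norm]
    refine (hlip x ⟨hx1.1, hx.2⟩ y ⟨hy1.1, hy.2⟩).trans_lt ?_
    have h1 : ‖y - x‖ < ε / (C + 1) := by
      rw [Real.norm_eq_abs, abs_lt]
      constructor <;> linarith [hx1.2, hy1.2, hx.2, hy.2]
    calc C * ‖y - x‖ ≤ (C + 1) * ‖y - x‖ := by gcongr; linarith
      _ < (C + 1) * (ε / (C + 1)) := by gcongr
      _ = ε := by field_simp
  exact CompleteSpace.complete hcau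

/-- A local solution through the limit point is glued on. At the gluing time the left derivative
exists because the derivatives converge, by continuity of the field. -/
theorem exists_extension {v : E → E} {γ : ℝ → E} {a S : ℝ} {q : E} (haS : a < S)
    (hγ : ∀ t ∈ Ioo a S, HasDerivAt γ (v (γ t)) t) (hlim : Tendsto γ (𝓝[<] S) (𝓝 q))
    (hv : ContDiffAt ℝ 1 v q) :
    ∃ ε > 0, ∃ g : ℝ → E, (∀ t < S, g t = γ t) ∧ g S = q ∧
      ∀ t ∈ Ioo a (S + ε), HasDerivAt g (v (g t)) t := by
  obtain ⟨f, hf0, ε, hε, hf⟩ :=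
    hv.exists_forall_mem_closedBall_exists_eq_forall_mem_Ioo_hasDerivAt₀ S
  classical
  refine ⟨ε, hε, fun t => if t < S then γ t else f t, fun t ht => by simp [ht], by simp [hf0], ?_⟩
  intro t ht
  rcases lt_trichotomy t S with h | rfl | h
  · simp only [h, if_true]
    refine (hγ t ⟨ht.1, h⟩).congr_of_eventuallyEq ?_
    filter_upwards [isOpen_Iio.mem_nhds h] with u hu
    simp [show u < S from hu]
  · simp only [lt_irrefl, if_false]
    have hS : t ∈ Ioo (t - ε) (t + ε) := ⟨by linarith, by linarith⟩
    have hr : HasDerivWithinAt (fun u => if u < t then γ u else f u) (v (f t)) (Ici t) t := by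
      refine (hf t hS).hasDerivWithinAt.congr (fun u hu => ?_) (by simp)
      simp [not_lt.2 (show t ≤ u from hu)]
    have hd : ∀ u ∈ Ioo a t, HasDerivAt (fun u => if u < t then γ u else f u) (v (γ u)) u := by
      intro u hu
      refine (hγ u hu).congr_of_eventuallyEq ?_
      filter_upwards [isOpen_Iio.mem_nhds hu.2] with w hw
      simp [show w < t from hw]
    have hmem : Ioo a t ∈ 𝓝[<] t := Ioo_mem_nhdsLT haS
    have hl : HasDerivWithinAt (fun u => if u < t then γ u else f u) (v (f t)) (Iic t) t := by
      refine hasDerivWithinAt_Iic_of_tendsto_deriv (s := Ioo a t)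
        (fun u hu => (hd u hu).differentiableAt.differentiableWithinAt) ?_ hmem ?_
      · have h1 : Tendsto (fun u => if u < t then γ u else f u) (𝓝[<] t) (𝓝 q) := by
          refine hlim.congr' ?_
          filter_upwards [self_mem_nhdsWithin] with u hu
          simp [show u < t from hu]
        simp only [ContinuousWithinAt, lt_irrefl, if_false, hf0]
        exact h1.mono_left (nhdsWithin_mono _ fun u hu => hu.2)
      · rw [hf0]
        refine Tendsto.congr' ?_ (hv.continuousAt.tendsto.comp hlim)
        filter_upwards [hmem] with u hu
        exact (hd u hu).deriv.symm
    have := hl.union hr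
    rwa [Iic_union_Ici, hasDerivWithinAt_univ] at this
  · simp only [not_lt.2 h.le, if_false]
    refine (hf t ⟨by linarith, ht.2⟩).congr_of_eventuallyEq ?_
    filter_upwards [isOpen_Ioi.mem_nhds h] with u hu
    simp [not_lt.2 (le_of_lt (show S < u from hu))]

theorem eq_of_hasDerivAt_zero {g : ℝ → ℝ} {I : Set ℝ} (hI : IsOpen I) (hc : IsPreconnected I)
    (h : ∀ s ∈ I, HasDerivAt g 0 s) {s t : ℝ} (hs : s ∈ I) (ht : t ∈ I) : g s = g t :=
  hI.is_const_of_deriv_eq_zero hc (fun s hs => (h s hs).differentiableAt.differentiableWithinAt)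
    (fun s hs => (h s hs).deriv) hs ht

/-- The filter `atTop` on a bounded open interval, as a filter on the real line. -/
theorem map_coe_atTop {I : Set ℝ} (hI : IsOpen I) (hc : IsConnected I) (hb : BddAbove I) :
    map ((↑) : I → ℝ) atTop = 𝓝[<] (sSup I) := by
  have : Nonempty I := hc.nonempty.to_subtype
  have hlt : ∀ s ∈ I, s < sSup I := by
    intro s hs
    obtain ⟨ε, hε, h⟩ := Metric.isOpen_iff.1 hI s hs
    have : s + ε / 2 ∈ I := h (by simp [abs_of_pos hε, hε])
    linarith [le_csSup hb this]
  have hmem : ∀ s ∈ I, Ico s (sSup I) ⊆ I := by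
    intro s hs t ht
    obtain ⟨u, hu, htu⟩ := exists_lt_of_lt_csSup hc.nonempty ht.2
    exact hc.isPreconnected.ordConnected.out hs hu ⟨ht.1, htu.le⟩
  ext U
  rw [mem_map, mem_atTop_sets]
  constructor
  · rintro ⟨⟨s, hs⟩, h⟩
    refine mem_of_superset (Ico_mem_nhdsLT (hlt s hs)) fun t ht => ?_
    exact h ⟨t, hmem s hs ht⟩ ht.1
  · intro h
    obtain ⟨a, ha, h⟩ := (mem_nhdsLT_iff_exists_Ico_subset).1 h
    obtain ⟨u, hu, hau⟩ := exists_lt_of_lt_csSup hc.nonempty ha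
    exact ⟨⟨u, hu⟩, fun t ht => h ⟨hau.le.trans ht, hlt t t.2⟩⟩

end ODE

/-! ### Bicharacteristics -/

/-- An explicit form of `IsBichar` for the symbol of the wave operator. -/
structure Data.IsFlowLine (K : Data) (r₀ : ℝ) (γ : ℝ → Phase) (I : Set ℝ) : Prop where
  isOpen : IsOpen I
  connected : IsConnected I
  mem : ∀ s ∈ I, γ s ∈ K.Char r₀
  deriv : ∀ s ∈ I, HasDerivAt γ (K.flow r₀ (γ s)) s

theorem isBichar_iff (hK : K.Subextremal) {r₀ : ℝ} (hr₀ : 0 < r₀) (A : Pt → ℂ) (σ : ℂ)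
    (γ : ℝ → Phase) (I : Set ℝ) :
    IsBichar K.cotangent (K.symb r₀ A σ) γ I ↔ K.IsFlowLine r₀ γ I := by
  constructor
  · rintro ⟨h1, h2, h3, h4⟩
    rw [charSet_symb hK hr₀] at h3
    refine ⟨h1, h2, h3, fun s hs => ?_⟩
    rw [← ham_of_char hK hr₀ A σ (h3 s hs)]
    exact h4 s hs
  · rintro ⟨h1, h2, h3, h4⟩
    refine ⟨h1, h2, by rwa [charSet_symb hK hr₀], fun s hs => ?_⟩
    rw [ham_of_char hK hr₀ A σ (h3 s hs)]
    exact h4 s hs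

/-- An explicit form of `IsMaximalBichar` for the symbol of the wave operator. -/
def Data.IsMaxFlowLine (K : Data) (r₀ : ℝ) (γ : ℝ → Phase) (I : Set ℝ) : Prop :=
  K.IsFlowLine r₀ γ I ∧ ∀ γ' J, K.IsFlowLine r₀ γ' J → I ⊆ J → Set.EqOn γ γ' I → J = I

theorem isMaximalBichar_iff (hK : K.Subextremal) {r₀ : ℝ} (hr₀ : 0 < r₀) (A : Pt → ℂ) (σ : ℂ)
    (γ : ℝ → Phase) (I : Set ℝ) :
    IsMaximalBichar K.cotangent (K.symb r₀ A σ) γ I ↔ K.IsMaxFlowLine r₀ γ I := by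
  unfold IsMaximalBichar Data.IsMaxFlowLine
  simp only [isBichar_iff hK hr₀]

/-! #### Smoothness of the flow -/

theorem contDiffAt_flow (hK : K.Subextremal) (r₀ : ℝ) {q : Phase} (hr : q.1.1 ∈ K.dom) :
    ContDiffAt ℝ 1 (K.flow r₀) q := by
  have comp : ∀ g : ℝ → ℝ, ContDiffAt ℝ 1 g q.1.1 → ContDiffAt ℝ 1 (fun q : Phase => g q.1.1) q :=
    fun g hg => ContDiffAt.comp q (g := g) hg (by fun_prop)
  have hfa := comp _ (hK.fa_analyticAt r₀ hr).contDiffAt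
  have hha := comp _ (hK.ha_analyticAt r₀ hr).contDiffAt
  have hdfa := comp _ (hK.fa_analyticAt r₀ hr).deriv.contDiffAt
  have hdha := comp _ (hK.ha_analyticAt r₀ hr).deriv.contDiffAt
  have hmu := comp _ (contDiff_mu (K := K)).contDiffAt
  have hdmu := comp _ (contDiff_dmu (K := K)).contDiffAt
  have hL : ContDiffAt ℝ 1 angMom q := by unfold angMom phiComp; fun_prop
  have hJ : ContDiffAt ℝ 1 angSq q := by unfold angSq; fun_prop
  have hc : ContDiffAt ℝ 1 (fun q : Phase => K.c q.1.2) q := by unfold Data.c; fun_prop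
  have hci : ContDiffAt ℝ 1 (fun q : Phase => (1 + K.Λ * K.a ^ 2 / 3 * q.1.2 2 ^ 2)⁻¹) q :=
    ContDiffAt.inv (by fun_prop) (hK.cz_pos _).ne'
  have hρ : ContDiffAt ℝ 1 (fun q : Phase => (K.rho2 q.1.1 q.1.2)⁻¹) q :=
    ContDiffAt.inv (by unfold Data.rho2; fun_prop) (hK.rho2_pos hr _).ne'
  have hk : ContDiffAt ℝ 1 (fun q : Phase => K.kap r₀ (q.1.2 2 ^ 2)) q := by
    unfold Data.kap; simp only [div_eq_mul_inv] at *; fun_prop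
  have hdk : ContDiffAt ℝ 1 (fun q : Phase => K.dkap r₀ (q.1.2 2 ^ 2)) q := by
    unfold Data.dkap; simp only [div_eq_mul_inv, ← inv_pow] at *; fun_prop
  have hd : ∀ {v : Phase → V}, ContDiffAt ℝ 1 v q → ContDiffAt ℝ 1 (fun q => dPhi (v q)) q := by
    intro v hv
    have hv' : ∀ i, ContDiffAt ℝ 1 (fun q => v q i) q := fun i => by fun_prop
    unfold dPhi
    refine (PiLp.contDiff_toLp (𝕜 := ℝ) (p := 2)).contDiffAt.comp q (contDiffAt_pi.2 fun i => ?_)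
    have h0 := hv' 0
    have h1 := hv' 1
    fin_cases i <;> simp <;> fun_prop
  have hd1 := hd (v := fun q => q.1.2) (by fun_prop)
  have hd2 := hd (v := fun q => q.2.2) (by fun_prop)
  have hdot : ∀ {v w : Phase → V}, ContDiffAt ℝ 1 v q → ContDiffAt ℝ 1 w q →
      ContDiffAt ℝ 1 (fun q => dot (v q) (w q)) q := by
    intro v w hv hw
    unfold dot; fun_prop
  have hxx := hdot (v := fun q => q.1.2) (w := fun q => q.1.2) (by fun_prop) (by fun_prop)
  have hxe := hdot (v := fun q => q.1.2) (w := fun q => q.2.2) (by fun_prop) (by fun_prop)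
  have hee := hdot (v := fun q => q.2.2) (w := fun q => q.2.2) (by fun_prop) (by fun_prop)
  have hG : ContDiffAt ℝ 1 (K.angVelocity r₀) q := by unfold Data.angVelocity; fun_prop
  have hY : ContDiffAt ℝ 1 (K.radVel r₀) q := by unfold Data.radVel; fun_prop
  have hdr : ContDiffAt ℝ 1 (K.dradial r₀) q := by unfold Data.dradial; fun_prop
  have hdc : ContDiffAt ℝ 1 (K.dcarter r₀) q := by unfold Data.dcarter; fun_prop
  unfold Data.flow
  refine hρ.smul (ContDiffAt.prodMk (ContDiffAt.prodMk ?_ ?_) (ContDiffAt.prodMk ?_ ?_))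
  · fun_prop
  · fun_prop
  · fun_prop
  · have hz : ContDiffAt ℝ 1 (fun q : Phase => q.1.2 2) q := by fun_prop
    have h1 : ContDiffAt ℝ 1 (fun q : Phase => q.1.2) q := by fun_prop
    have h2 : ContDiffAt ℝ 1 (fun q : Phase => q.2.2) q := by fun_prop
    exact ((hG.smul hd2).sub ((contDiffAt_const.mul hc).smul ((hee.smul h1).sub (hxe.smul h2)))).sub
      (((contDiffAt_const.mul hz).mul hdc).smul ((hxx.smul contDiffAt_const).sub (hz.smul h1)))

/-! #### Derivatives along the flow -/

section Curve

variable (hK : K.Subextremal) {r₀ : ℝ} {γ : ℝ → Phase} {s : ℝ}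
  (h : HasDerivAt γ (K.flow r₀ (γ s)) s)
include h

theorem hasDerivAt_r_flow : HasDerivAt (fun s => (γ s).1.1)
    (2 * K.radVel r₀ (γ s) / K.rho2 (γ s).1.1 (γ s).1.2) s := by
  have h1 : HasDerivAt (fun s => (γ s).1.1) (K.flow r₀ (γ s)).1.1 s := h.fst.fst
  refine h1.congr_deriv ?_
  simp [Data.flow]; ring

theorem hasDerivAt_xi_flow : HasDerivAt (fun s => (γ s).2.1)
    (-K.dradial r₀ (γ s) / K.rho2 (γ s).1.1 (γ s).1.2) s := by
  have h1 : HasDerivAt (fun s => (γ s).2.1) (K.flow r₀ (γ s)).2.1 s := h.snd.fst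
  refine h1.congr_deriv ?_
  simp [Data.flow]; ring

theorem hasDerivAt_angMom_flow : HasDerivAt (fun s => angMom (γ s)) 0 s :=
  (hasDerivAt_angMom h).congr_deriv (angMom_flow r₀ (γ s))

theorem hasDerivAt_dot_flow : HasDerivAt (fun s => dot (γ s).1.2 (γ s).1.2) 0 s ∧
    HasDerivAt (fun s => dot (γ s).1.2 (γ s).2.2) 0 s := by
  obtain ⟨h1, h2⟩ := dot_flow (K := K) r₀ (γ s)
  refine ⟨(hasDerivAt_dot h.fst.snd h.fst.snd).congr_deriv ?_,
    (hasDerivAt_dot h.fst.snd h.snd.snd).congr_deriv ?_⟩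
  · have : dot (γ s).1.2 (K.flow r₀ (γ s)).1.2 = dot (K.flow r₀ (γ s)).1.2 (γ s).1.2 := by
      unfold dot; ring
    change dot (K.flow r₀ (γ s)).1.2 (γ s).1.2 + dot (γ s).1.2 (K.flow r₀ (γ s)).1.2 = 0
    rw [this, h1]; norm_num
  · exact h2

include hK

theorem hasDerivAt_carter_flow (hω : dot (γ s).1.2 (γ s).1.2 = 1) :
    HasDerivAt (fun s => K.carter r₀ (γ s)) 0 s :=
  (hasDerivAt_carter hK r₀ h).congr_deriv (fcarter_flow r₀ hω)

theorem hasDerivAt_radial_flow (hr : (γ s).1.1 ∈ K.dom) :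
    HasDerivAt (fun s => K.radial r₀ (γ s)) 0 s := by
  refine (hasDerivAt_radial hK r₀ h hr).congr_deriv ?_
  rw [angMom_flow]
  simp [Data.flow]; ring

theorem hasDerivAt_radVel_flow (hq : γ s ∈ K.Char r₀) :
    HasDerivAt (fun s => K.radVel r₀ (γ s))
      (K.dpot r₀ (angMom (γ s)) (K.carter r₀ (γ s)) (γ s).1.1
        / K.rho2 (γ s).1.1 (γ s).1.2) s := by
  have hr : (γ s).1.1 ∈ K.dom := hq.1.1
  have hρ := (hK.rho2_pos hr (γ s).1.2).ne'
  have hr' := hasDerivAt_r_flow h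
  have hξ := hasDerivAt_xi_flow h
  have hL := hasDerivAt_angMom_flow h
  have hmu := (hasDerivAt_mu (K := K) (γ s).1.1).comp s hr'
  have hf := (hasDerivAt_fa hK r₀ hr).comp s hr'
  have := (hmu.mul hξ).sub ((hf.const_mul K.b).mul hL)
  refine HasDerivAt.congr_deriv this ?_
  -- differentiate `μ h α² = α² - (f α)²`
  have hid : K.dmu (γ s).1.1 * K.ha r₀ (γ s).1.1 + K.mu (γ s).1.1 * deriv (K.ha r₀) (γ s).1.1
      = 2 * K.alpha r₀ (γ s).1.1 * (-(2 * K.a * (γ s).1.1) / (r₀ ^ 2 + K.a ^ 2))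
        - 2 * K.fa r₀ (γ s).1.1 * deriv (K.fa r₀) (γ s).1.1 := by
    have d1 := (hasDerivAt_mu (K := K) (γ s).1.1).mul (hasDerivAt_ha hK r₀ hr)
    have d2 := ((hasDerivAt_alpha (K := K) r₀ (γ s).1.1).pow 2).sub ((hasDerivAt_fa hK r₀ hr).pow 2)
    have heq : K.mu * K.ha r₀ =ᶠ[nhds (γ s).1.1] K.alpha r₀ ^ 2 - K.fa r₀ ^ 2 := by
      filter_upwards [isOpen_Ioo.mem_nhds hr] with x hx
      have := hK.mu_mul_h hx
      simp only [Pi.mul_apply, Pi.sub_apply, Pi.pow_apply, Data.ha, Data.fa]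
      linear_combination K.alpha r₀ x ^ 2 * this
    have := (d2.congr_of_eventuallyEq heq).unique d1
    rw [← this]
    push_cast
    ring
  have h2 := hq.2
  rw [radial_eq] at h2
  simp only [Function.comp, Data.dpot]
  have hQ : K.carter r₀ (γ s) = -(K.mu (γ s).1.1 * (γ s).2.1 ^ 2
    - 2 * K.b * K.fa r₀ (γ s).1.1 * angMom (γ s) * (γ s).2.1
    - K.b ^ 2 * K.ha r₀ (γ s).1.1 * angMom (γ s) ^ 2) := by linarith
  rw [hQ]
  have hα' : 2 * K.b ^ 2 * K.alpha r₀ (γ s).1.1 * (-(2 * K.a * (γ s).1.1) / (r₀ ^ 2 + K.a ^ 2))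
      = K.b ^ 2 * (K.dmu (γ s).1.1 * K.ha r₀ (γ s).1.1
        + K.mu (γ s).1.1 * deriv (K.ha r₀) (γ s).1.1
        + 2 * K.fa r₀ (γ s).1.1 * deriv (K.fa r₀) (γ s).1.1) := by rw [hid]; ring
  rw [hα']
  simp only [Data.dradial, Data.radVel]
  field_simp
  ring

end Curve

open Set Filter Topology

section Lines

variable {r₀ : ℝ} {γ : ℝ → Phase} {I : Set ℝ}

theorem Data.IsFlowLine.angMom_eq (h : K.IsFlowLine r₀ γ I) {s t : ℝ} (hs : s ∈ I) (ht : t ∈ I) :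
    angMom (γ s) = angMom (γ t) :=
  eq_of_hasDerivAt_zero h.isOpen h.connected.isPreconnected
    (fun u hu => hasDerivAt_angMom_flow (h.deriv u hu)) hs ht

theorem Data.IsFlowLine.carter_eq (hK : K.Subextremal) (h : K.IsFlowLine r₀ γ I) {s t : ℝ}
    (hs : s ∈ I) (ht : t ∈ I) : K.carter r₀ (γ s) = K.carter r₀ (γ t) :=
  eq_of_hasDerivAt_zero h.isOpen h.connected.isPreconnected
    (fun u hu => hasDerivAt_carter_flow hK (h.deriv u hu) (dot_of_cotangent (h.mem u hu).1).1) hs ht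

theorem Data.IsFlowLine.continuousAt (h : K.IsFlowLine r₀ γ I) {s : ℝ} (hs : s ∈ I) :
    ContinuousAt γ s := (h.deriv s hs).continuousAt

/-- A maximal flow line leaves every compact set when its parameter interval is bounded. -/
theorem Data.IsMaxFlowLine.false_of_tendsto (hK : K.Subextremal) (hr₀ : 0 < r₀)
    (hγ : K.IsMaxFlowLine r₀ γ I) (hb : BddAbove I) {r₁ ξ₁ : ℝ} (hr₁ : r₁ ∈ K.dom)
    (h1 : Tendsto (fun s : I => (γ s).1.1) atTop (𝓝 r₁))
    (h2 : Tendsto (fun s : I => (γ s).2.1) atTop (𝓝 ξ₁))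
    (hne : ξ₁ ≠ 0 ∨ ∃ s ∈ I, K.carter r₀ (γ s) ≠ 0) : False := by
  obtain ⟨hline, hmax⟩ := hγ
  have hmap := map_coe_atTop hline.isOpen hline.connected hb
  set S := sSup I with hS
  have hI : IsOpen I := hline.isOpen
  have hIev : ∀ᶠ s in 𝓝[<] S, s ∈ I := by
    rw [← hmap, eventually_map]; exact Eventually.of_forall fun s => s.2
  have h1' : Tendsto (fun s => (γ s).1.1) (𝓝[<] S) (𝓝 r₁) := by
    rw [← hmap]; exact tendsto_map'_iff.2 h1
  have h2' : Tendsto (fun s => (γ s).2.1) (𝓝[<] S) (𝓝 ξ₁) := by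
    rw [← hmap]; exact tendsto_map'_iff.2 h2
  obtain ⟨s₁, hs₁⟩ := hline.connected.nonempty
  obtain ⟨ε, hε, hball⟩ := Metric.nhds_basis_closedBall.mem_iff.1 (isOpen_Ioo.mem_nhds hr₁ : K.dom ∈ 𝓝 r₁)
  -- the curve stays in a compact set
  set M : ℝ := Real.sqrt (K.b / K.lowFac r₀ ^ 2 * K.carter r₀ (γ s₁)) with hM
  set B : Set Phase := (Metric.closedBall r₁ ε ×ˢ Metric.closedBall (0 : V) 1) ×ˢ
    (Metric.closedBall ξ₁ 1 ×ˢ Metric.closedBall (0 : V) M) with hB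
  have hBc : IsCompact B :=
    ((isCompact_closedBall _ _).prod (isCompact_closedBall _ _)).prod
      ((isCompact_closedBall _ _).prod (isCompact_closedBall _ _))
  have hBcont : ContinuousOn (K.flow r₀) B := fun q hq =>
    (contDiffAt_flow hK r₀ (hball hq.1.1)).continuousAt.continuousWithinAt
  obtain ⟨C, hC⟩ := hBc.exists_bound_of_continuousOn hBcont
  have hev : ∀ᶠ s in 𝓝[<] S, s ∈ I ∧ γ s ∈ B := by
    filter_upwards [hIev, h1'.eventually (Metric.closedBall_mem_nhds r₁ hε),
      h2'.eventually (Metric.closedBall_mem_nhds ξ₁ one_pos)] with s hs a1 a2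
    refine ⟨hs, ⟨a1, ?_⟩, a2, ?_⟩
    · simp [(hline.mem s hs).1.2.1]
    · rw [mem_closedBall_zero_iff]
      refine Real.le_sqrt_of_sq_le ?_
      have hlow := carter_lower hK hr₀ (hline.mem s hs).1
      rw [hline.carter_eq hK hs hs₁] at hlow
      have hb := hK.b_pos
      have hd0 := lowFac_pos (K := K) hr₀
      rw [div_mul_eq_mul_div, le_div_iff₀ (by positivity)]
      rw [div_mul_eq_mul_div, div_le_iff₀ hb] at hlow
      linarith
  obtain ⟨a, ha, hIco⟩ := mem_nhdsLT_iff_exists_Ico_subset.1 hev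
  have haS : a < S := ha
  have hd : ∀ t ∈ Ioo a S, HasDerivAt γ (K.flow r₀ (γ t)) t := fun t ht =>
    hline.deriv t (hIco ⟨ht.1.le, ht.2⟩).1
  obtain ⟨q, hq⟩ := exists_tendsto_of_bounded_deriv hd
    (fun t ht => hC _ (hIco ⟨ht.1.le, ht.2⟩).2) haS
  have hqr : q.1.1 = r₁ :=
    tendsto_nhds_unique ((continuous_fst.fst.tendsto q).comp hq) h1'
  have hqξ : q.2.1 = ξ₁ :=
    tendsto_nhds_unique ((continuous_snd.fst.tendsto q).comp hq) h2'
  have hqdom : q.1.1 ∈ K.dom := hqr ▸ hr₁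
  obtain ⟨ε', hε', g, hg1, hg2, hg3⟩ := exists_extension haS hd hq (contDiffAt_flow hK r₀ hqdom)
  have haI : ∀ t ∈ Ico a S, t ∈ I := fun t ht => (hIco ht).1
  -- near `S` the extension stays in the domain
  have hgc : ContinuousAt g S := (hg3 S ⟨haS, by linarith⟩).continuousAt
  have hgd : ∀ᶠ t in 𝓝 S, (g t).1.1 ∈ K.dom := by
    have : Tendsto (fun t => (g t).1.1) (𝓝 S) (𝓝 q.1.1) := by
      have := (continuous_fst.fst.tendsto (g S)).comp hgc.tendsto
      rw [hg2] at this; exact this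
    exact this.eventually (isOpen_Ioo.mem_nhds hqdom)
  -- the limit point is a nonzero covector
  have hcarter_cont : ∀ s, ContinuousAt g s → ContinuousAt (fun s => K.carter r₀ (g s)) s := by
    intro s hs
    have hc : Continuous (K.carter r₀) := by
      have h0 : ∀ q : Phase, 1 + K.Λ * K.a ^ 2 / 3 * q.1.2 2 ^ 2 ≠ 0 := fun q => (hK.cz_pos _).ne'
      unfold Data.carter Data.kap Data.c angSq angMom phiComp
      fun_prop (disch := assumption)
    exact hc.continuousAt.comp hs
  have hbase : ∀ t ∈ Ioo a S, g t = γ t := fun t ht => hg1 t ht.2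
  -- If the limit covector were zero, then ξ₁ = 0 and, by continuity, the conserved Carter constant
  -- would vanish; `hne` excludes one of the two.
  have hq0 : q.2 ≠ 0 := by
    intro h0
    rcases hne with hne | ⟨s, hs, hne⟩
    · apply hne; rw [← hqξ, h0]; rfl
    · have hc1 : Tendsto (fun s => K.carter r₀ (g s)) (𝓝[<] S) (𝓝 (K.carter r₀ q)) := by
        have := (hcarter_cont S hgc).tendsto
        rw [hg2] at this
        exact this.mono_left nhdsWithin_le_nhds
      have hc2 : Tendsto (fun s => K.carter r₀ (g s)) (𝓝[<] S) (𝓝 (K.carter r₀ (γ s))) := by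
        refine tendsto_const_nhds.congr' ?_
        filter_upwards [hIev, self_mem_nhdsWithin] with t ht htS
        rw [hg1 t htS]
        exact hline.carter_eq hK hs ht
      have := tendsto_nhds_unique hc2 hc1
      apply hne
      rw [this]
      simp [Data.carter, angSq, angMom, phiComp, show q.2.2 = 0 by rw [h0]; rfl]
  have hgn : ∀ᶠ t in 𝓝 S, (g t).2 ≠ 0 := by
    have : Tendsto (fun t => (g t).2) (𝓝 S) (𝓝 q.2) := by
      have := (continuous_snd.tendsto (g S)).comp hgc.tendsto
      rw [hg2] at this; exact this
    exact this.eventually_ne hq0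
  obtain ⟨η, hη, hηball⟩ := Metric.eventually_nhds_iff.1 (hgd.and hgn)
  set b' := min (S + ε') (S + η) with hb'
  have hSb : S < b' := by simp [hb', hε', hη]
  have hprop : ∀ t ∈ Ioo a b', (g t).1.1 ∈ K.dom ∧ (g t).2 ≠ 0 := by
    intro t ht
    rcases lt_or_ge t S with htS | htS
    · rw [hg1 t htS]
      have := (hline.mem t (haI t ⟨ht.1.le, htS⟩)).1
      exact ⟨this.1, this.2.2.2⟩
    · refine hηball ?_
      rw [Real.dist_eq, abs_of_nonneg (by linarith)]
      have := ht.2.trans_le (min_le_right _ _)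
      linarith
  have hgd' : ∀ t ∈ Ioo a b', HasDerivAt g (K.flow r₀ (g t)) t := fun t ht =>
    hg3 t ⟨ht.1, ht.2.trans_le (min_le_left _ _)⟩
  have hmid : (a + S) / 2 ∈ Ioo a b' := ⟨by linarith, by linarith⟩
  have hmidI : (a + S) / 2 ∈ I := haI _ ⟨by linarith, by linarith⟩
  have hgmid : g ((a + S) / 2) = γ ((a + S) / 2) := hg1 _ (by linarith)
  have hmidC := hline.mem _ hmidI
  rw [← hgmid] at hmidC
  -- The extension solves the equation only in the ambient vector space. It remains in the cotangent
  -- bundle and in the characteristic set because `Data.flow` conserves |ω|², ω · η and the radial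
  -- and Carter parts of the symbol also off that set.
  have hd1 : ∀ t ∈ Ioo a b', dot (g t).1.2 (g t).1.2 = 1 := fun t ht =>
    (eq_of_hasDerivAt_zero isOpen_Ioo isPreconnected_Ioo
      (fun u hu => (hasDerivAt_dot_flow (hgd' u hu)).1) ht hmid).trans
      (dot_of_cotangent hmidC.1).1
  have hd2 : ∀ t ∈ Ioo a b', dot (g t).1.2 (g t).2.2 = 0 := fun t ht =>
    (eq_of_hasDerivAt_zero isOpen_Ioo isPreconnected_Ioo
      (fun u hu => (hasDerivAt_dot_flow (hgd' u hu)).2) ht hmid).trans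
      (dot_of_cotangent hmidC.1).2
  have hd3 : ∀ t ∈ Ioo a b', K.radial r₀ (g t) + K.carter r₀ (g t) = 0 := fun t ht => by
    rw [eq_of_hasDerivAt_zero (g := fun t => K.radial r₀ (g t)) isOpen_Ioo isPreconnected_Ioo
        (fun u hu => hasDerivAt_radial_flow hK (hgd' u hu) (hprop u hu).1) ht hmid,
      eq_of_hasDerivAt_zero (g := fun t => K.carter r₀ (g t)) isOpen_Ioo isPreconnected_Ioo
        (fun u hu => hasDerivAt_carter_flow hK (hgd' u hu) (hd1 u hu)) ht hmid]
    exact hmidC.2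
  have hchar : ∀ t ∈ Ioo a b', g t ∈ K.Char r₀ := by
    intro t ht
    refine ⟨⟨(hprop t ht).1, ?_, ?_, (hprop t ht).2⟩, hd3 t ht⟩
    · have := hd1 t ht
      rw [dot_self] at this
      nlinarith [norm_nonneg (g t).1.2]
    · rw [← dot_eq_inner]; exact hd2 t ht
  have hItop : ∀ t ∈ I, t < S := by
    intro t ht
    obtain ⟨e, he, hsub⟩ := Metric.isOpen_iff.1 hI t ht
    have : t + e / 2 ∈ I := hsub (by simp [abs_of_pos he, he])
    linarith [le_csSup hb this]
  have hJ : K.IsFlowLine r₀ g (I ∪ Ioo a b') := by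
    refine ⟨hI.union isOpen_Ioo, ?_, ?_, ?_⟩
    · exact IsConnected.union ⟨_, hmidI, hmid⟩ hline.connected ⟨⟨_, hmid⟩, isPreconnected_Ioo⟩
    · rintro t (ht | ht)
      · rw [hg1 t (hItop t ht)]; exact hline.mem t ht
      · exact hchar t ht
    · rintro t (ht | ht)
      · rw [hg1 t (hItop t ht)]
        refine (hline.deriv t ht).congr_of_eventuallyEq ?_
        filter_upwards [isOpen_Iio.mem_nhds (hItop t ht)] with u hu
        exact hg1 u hu
      · exact hgd' t ht
  have hJI := hmax g _ hJ subset_union_left fun t ht => (hg1 t (hItop t ht)).symm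
  -- The extended interval contains its former supremum, which the open set I does not.
  have hSJ : S ∈ I ∪ Ioo a b' := Or.inr ⟨haS, hSb⟩
  rw [hJI] at hSJ
  exact lt_irrefl _ (hItop S hSJ)

/-! ### Time reversal -/

/-- Multiplication of the covector by `-1`. -/
def flip (q : Phase) : Phase := (q.1, -q.2)

/-- The reversed curve. -/
def rev (γ : ℝ → Phase) (s : ℝ) : Phase := flip (γ (-s))

theorem flip_flip (q : Phase) : flip (flip q) = q := by simp [flip]

theorem angMom_flip (q : Phase) : angMom (flip q) = -angMom q := by
  simp [angMom, phiComp, flip]; ring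

theorem angSq_flip (q : Phase) : angSq (flip q) = angSq q := by
  simp [angSq, flip]; ring

theorem carter_flip (r₀ : ℝ) (q : Phase) : K.carter r₀ (flip q) = K.carter r₀ q := by
  unfold Data.carter; rw [angSq_flip, angMom_flip]; simp [flip]

theorem dcarter_flip (r₀ : ℝ) (q : Phase) : K.dcarter r₀ (flip q) = K.dcarter r₀ q := by
  unfold Data.dcarter; rw [angSq_flip, angMom_flip]; simp [flip]

theorem radial_flip (r₀ : ℝ) (q : Phase) : K.radial r₀ (flip q) = K.radial r₀ q := by
  unfold Data.radial; rw [angMom_flip]; simp [flip]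

theorem dradial_flip (r₀ : ℝ) (q : Phase) : K.dradial r₀ (flip q) = K.dradial r₀ q := by
  unfold Data.dradial; rw [angMom_flip]; simp [flip]

theorem radVel_flip (r₀ : ℝ) (q : Phase) : K.radVel r₀ (flip q) = -K.radVel r₀ q := by
  unfold Data.radVel; rw [angMom_flip]; simp [flip]; ring

theorem energy_flip (r₀ : ℝ) (q : Phase) : K.energy r₀ (flip q) = -K.energy r₀ q := by
  unfold Data.energy; rw [angMom_flip]; simp [flip]; ring

/-- The symbol is even in the covector, so changing its sign conjugates the flow to its time
reversal. All results about backward ends are obtained from forward ends in this way; Y and E change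
sign, while Carter's constant does not. -/
theorem flow_flip (r₀ : ℝ) (q : Phase) :
    K.flow r₀ (flip q) = (-(K.flow r₀ q).1, (K.flow r₀ q).2) := by
  have hG : K.angVelocity r₀ (flip q) = -K.angVelocity r₀ q := by
    unfold Data.angVelocity; rw [angMom_flip]; simp [flip]; ring
  unfold Data.flow
  rw [hG, radVel_flip, dradial_flip, dcarter_flip]
  simp only [flip]
  refine Prod.ext (Prod.ext ?_ ?_) (Prod.ext ?_ ?_)
  · simp
  · ext i
    fin_cases i <;> simp [dot, dPhi] <;> ring
  · simp
  · ext i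
    fin_cases i <;> simp [dot, dPhi] <;> left <;> ring

theorem cotangent_flip {q : Phase} : flip q ∈ K.cotangent ↔ q ∈ K.cotangent := by
  simp [Data.cotangent, flip]

theorem char_flip {q : Phase} : flip q ∈ K.Char r₀ ↔ q ∈ K.Char r₀ := by
  unfold Data.Char
  simp only [Set.mem_ofPred_eq, cotangent_flip, radial_flip, carter_flip]

theorem Data.IsFlowLine.rev (h : K.IsFlowLine r₀ γ I) : K.IsFlowLine r₀ (rev γ) (-I) := by
  refine ⟨h.isOpen.neg, ?_, fun s hs => char_flip.2 (h.mem _ hs), fun s hs => ?_⟩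
  · have := h.connected.image Neg.neg continuous_neg.continuousOn
    simpa using this
  · have h1 := (h.deriv (-s) hs)
    have h2 : HasDerivAt (fun s => γ (-s)) (-K.flow r₀ (γ (-s))) s := by
      have := h1.scomp s (hasDerivAt_neg s)
      exact this.congr_deriv (by simp)
    have h4 : HasDerivAt (fun s => (γ (-s)).2) (-K.flow r₀ (γ (-s))).2 s := h2.snd
    have h3 : HasDerivAt (KdS.rev γ) ((-K.flow r₀ (γ (-s))).1, -(-K.flow r₀ (γ (-s))).2) s :=
      HasDerivAt.prodMk (f₁ := fun s => (γ (-s)).1) (f₂ := fun s => -(γ (-s)).2) h2.fst h4.neg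
    refine h3.congr_deriv ?_
    change _ = K.flow r₀ (flip (γ (-s)))
    rw [flow_flip]
    simp

theorem Data.IsMaxFlowLine.rev (h : K.IsMaxFlowLine r₀ γ I) : K.IsMaxFlowLine r₀ (rev γ) (-I) := by
  refine ⟨h.1.rev, fun γ' J hγ' hIJ heq => ?_⟩
  have := h.2 (KdS.rev γ') (-J) hγ'.rev (by rw [← Set.neg_subset_neg] at hIJ; simpa using hIJ) ?_
  · rw [← this]; simp
  · intro s hs
    have := heq (x := -s) (by simpa using hs)
    simp only [KdS.rev, neg_neg] at this ⊢
    rw [← this, flip_flip]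

/-- Negation exchanges the ends of an interval. -/
theorem tendsto_neg_atTop_iff {α : Type*} {g : ℝ → α} {l : Filter α} {I : Set ℝ} :
    Tendsto (fun s : (-I : Set ℝ) => g (-s)) atTop l ↔ Tendsto (fun s : I => g s) atBot l := by
  let e : I ≃o (-I : Set ℝ)ᵒᵈ :=
    { toFun := fun s => OrderDual.toDual ⟨-s, by simp⟩
      invFun := fun s => ⟨-(OrderDual.ofDual s).1, (OrderDual.ofDual s).2⟩
      left_inv := fun s => by simp
      right_inv := fun s => by simp
      map_rel_iff' := by
        intro s t
        change (-(t : ℝ) ≤ -(s : ℝ)) ↔ _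
        simp }
  have h1 : map e atBot = atBot := e.map_atBot
  have h2 : (fun s : I => g s) = (fun s : (-I : Set ℝ) => g (-s)) ∘ (fun s => OrderDual.ofDual (e s)) := by
    funext s; simp [e]
  rw [h2, ← tendsto_map'_iff]
  have h3 : map (fun s => OrderDual.ofDual (e s)) atBot = (atTop : Filter (-I : Set ℝ)) := h1
  rw [h3]

end Lines

/-! ### The effective potential -/

theorem pot_pos_of_mu_neg {r₀ L Q r : ℝ} (hQ : 0 < Q) (hmu : K.mu r < 0) : 0 < K.pot r₀ L Q r := by
  unfold Data.pot
  have h1 : 0 ≤ K.b ^ 2 * K.alpha r₀ r ^ 2 * L ^ 2 := by positivity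
  have h2 : K.mu r * Q < 0 := mul_neg_of_neg_of_pos hmu hQ
  linarith

/-- The zeros of the effective potential are simple: there is no trapping. -/
theorem dpot_of_pot_eq_zero (hK : K.Subextremal) {r₀ L Q r : ℝ} (hr₀ : r₀ ∈ Icc K.re K.rc)
    (hQ : 0 < Q) (hr : K.rC < r) (h0 : K.pot r₀ L Q r = 0) :
    r ∈ Icc K.re K.rc ∧ (r < r₀ → K.dpot r₀ L Q r < 0) ∧ (r₀ < r → 0 < K.dpot r₀ L Q r) ∧
      K.dpot r₀ L Q r ≠ 0 := by
  have hr₀pos := hK.pos_of_mem hr₀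
  have hle : K.re ≤ r := by
    by_contra h
    push Not at h
    exact (pot_pos_of_mu_neg hQ (hK.mu_neg_left hr h)).ne' h0
  have hge : r ≤ K.rc := by
    by_contra h
    push Not at h
    exact (pot_pos_of_mu_neg hQ (hK.mu_neg_right h)).ne' h0
  have hb := hK.b_pos
  refine ⟨⟨hle, hge⟩, ?_⟩
  -- At a horizon V = 0 forces αL = 0, and only the term -μ'Q survives in V'.
  have hzero : K.mu r = 0 → K.dpot r₀ L Q r = -(K.dmu r * Q) := by
    intro hmu
    unfold Data.pot at h0
    rw [hmu] at h0
    have h1 : (K.b * (K.alpha r₀ r * L)) ^ 2 = 0 := by linear_combination h0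
    have h2 : K.alpha r₀ r * L = 0 := by
      rcases mul_eq_zero.1 (pow_eq_zero_iff two_ne_zero |>.1 h1) with h | h
      · exact absurd h hb.ne'
      · exact h
    unfold Data.dpot
    linear_combination (2 * K.b ^ 2 * (-(2 * K.a * r) / (r₀ ^ 2 + K.a ^ 2)) * L) * h2
  rcases hle.eq_or_lt with h1 | h1
  · have hd : K.dpot r₀ L Q r < 0 := by
      rw [hzero (by rw [← h1, hK.mu_re]), ← h1]
      have := mul_pos hK.dmu_re_pos hQ
      linarith
    refine ⟨fun _ => hd, fun h => ?_, hd.ne⟩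
    linarith [hr₀.1]
  rcases hge.eq_or_lt with h2 | h2
  · have hd : 0 < K.dpot r₀ L Q r := by
      rw [hzero (by rw [h2, hK.mu_rc]), h2]
      have := mul_neg_of_neg_of_pos hK.dmu_rc_neg hQ
      linarith
    refine ⟨fun h => ?_, fun _ => hd, hd.ne'⟩
    linarith [hr₀.2]
  have hmu := hK.mu_pos h1 h2
  have hN := hK.no_trapping h1 h2 hr₀
  have hden : 0 < r₀ ^ 2 + K.a ^ 2 := by positivity
  have hpos : 0 < K.b ^ 2 * K.alpha r₀ r ^ 2 * L ^ 2 := by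
    have : K.b ^ 2 * K.alpha r₀ r ^ 2 * L ^ 2 = K.mu r * Q := by
      unfold Data.pot at h0; linarith
    rw [this]; positivity
  have hα : K.alpha r₀ r ≠ 0 := by
    intro h; rw [h] at hpos; simp at hpos
  have hL : L ≠ 0 := by
    intro h; rw [h] at hpos; simp at hpos
  have ha : K.a ≠ 0 := by
    intro h; apply hα; simp [Data.alpha, h]
  have hne : r ≠ r₀ := by
    rintro rfl; apply hα; simp [Data.alpha]
  -- The combination μV' - μ'V no longer contains Q. It is a positive multiple of r - r₀ by
  -- `no_trapping`.
  have hid : K.mu r * K.dpot r₀ L Q r = K.b ^ 2 * L ^ 2 * K.a ^ 2 / (r₀ ^ 2 + K.a ^ 2) ^ 2 *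
      (4 * r * K.mu r - (r ^ 2 - r₀ ^ 2) * K.dmu r) * (r + r₀) * (r - r₀) := by
    have e : K.mu r * K.dpot r₀ L Q r = K.mu r * K.dpot r₀ L Q r - K.dmu r * K.pot r₀ L Q r := by
      rw [h0]; ring
    rw [e]
    unfold Data.dpot Data.pot Data.alpha
    field_simp
    ring
  have hrpos : 0 < r := hK.re_pos.trans h1
  have hc : 0 < K.b ^ 2 * L ^ 2 * K.a ^ 2 / (r₀ ^ 2 + K.a ^ 2) ^ 2 *
      (4 * r * K.mu r - (r ^ 2 - r₀ ^ 2) * K.dmu r) * (r + r₀) := by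
    have : 0 < r + r₀ := by linarith
    positivity
  have hlt : r < r₀ → K.dpot r₀ L Q r < 0 := by
    intro h
    by_contra hcon
    push Not at hcon
    have := mul_nonneg hmu.le hcon
    rw [hid] at this
    linarith [mul_neg_of_pos_of_neg hc (sub_neg.2 h)]
  have hgt : r₀ < r → 0 < K.dpot r₀ L Q r := by
    intro h
    by_contra hcon
    push Not at hcon
    have := mul_nonpos_of_nonneg_of_nonpos hmu.le hcon
    rw [hid] at this
    linarith [mul_pos hc (sub_pos.2 h)]
  refine ⟨hlt, hgt, ?_⟩
  rcases lt_or_gt_of_ne hne with h | h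
  · exact (hlt h).ne
  · exact (hgt h).ne'

/-! ### Curves defined for all large times -/

/-- If k₁ were nonzero, the derivative of g would eventually be bounded away from 0 with a fixed
sign, and g would be unbounded. The weight w stands for ρ⁻², which need not converge. -/
theorem eq_zero_of_tendsto_of_deriv {g k w : ℝ → ℝ} {s₁ wl g₁ k₁ : ℝ}
    (hg : ∀ s ≥ s₁, HasDerivAt g (k s * w s) s) (hw : ∀ s ≥ s₁, wl ≤ w s) (hwl : 0 < wl)
    (hgt : Tendsto g atTop (𝓝 g₁)) (hkt : Tendsto k atTop (𝓝 k₁)) : k₁ = 0 := by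
  have key : ∀ {g k : ℝ → ℝ} {g₁ k₁ : ℝ}, (∀ s ≥ s₁, HasDerivAt g (k s * w s) s) →
      Tendsto g atTop (𝓝 g₁) → Tendsto k atTop (𝓝 k₁) → ¬ 0 < k₁ := by
    intro g k g₁ k₁ hg hgt hkt hk
    have hev : ∀ᶠ s in atTop, k₁ / 2 < k s := hkt.eventually (lt_mem_nhds (by linarith))
    obtain ⟨s₂, hs₂⟩ := eventually_atTop.1 (hev.and (eventually_ge_atTop s₁))
    have hc : 0 < k₁ / 2 * wl := by positivity
    have hlow : ∀ s ≥ s₂, g s₂ + k₁ / 2 * wl * (s - s₂) ≤ g s := by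
      intro s hs
      have := (convex_Ici s₂).mul_sub_le_image_sub_of_le_deriv (f := g) (C := k₁ / 2 * wl)
        (fun t ht => (hg t (hs₂ t ht).2).continuousAt.continuousWithinAt)
        (fun t ht => (hg t (hs₂ t (interior_subset ht)).2).differentiableAt.differentiableWithinAt)
        (fun t ht => by
          have ht' := hs₂ t (interior_subset ht)
          rw [(hg t ht'.2).deriv]
          have := hw t ht'.2
          exact mul_le_mul ht'.1.le this hwl.le (by linarith [ht'.1])) s₂ self_mem_Ici s hs hs
      linarith
    have hinf : Tendsto g atTop atTop := by
      refine tendsto_atTop_mono' atTop (f₁ := fun s => g s₂ + k₁ / 2 * wl * (s - s₂)) ?_ ?_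
      · filter_upwards [eventually_ge_atTop s₂] with s hs using hlow s hs
      · refine tendsto_atTop_add_const_left _ _ (Tendsto.const_mul_atTop hc ?_)
        exact tendsto_atTop_add_const_right _ (-s₂) tendsto_id
    exact not_tendsto_nhds_of_tendsto_atTop hinf g₁ hgt
  by_contra hne
  rcases lt_or_gt_of_ne hne with h | h
  · refine key (g := fun s => -g s) (k := fun s => -k s) (fun s hs => ?_) hgt.neg hkt.neg
      (neg_pos.2 h)
    exact (hg s hs).neg.congr_deriv (by ring)
  · exact key hg hgt hkt h

theorem map_coe_atTop_of_not_bddAbove {I : Set ℝ} (hc : IsConnected I) (hb : ¬ BddAbove I) :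
    map ((↑) : I → ℝ) atTop = atTop ∧ ∀ s ∈ I, Ici s ⊆ I := by
  have : Nonempty I := hc.nonempty.to_subtype
  have hmem : ∀ s ∈ I, Ici s ⊆ I := by
    intro s hs t ht
    obtain ⟨u, hu, htu⟩ := not_bddAbove_iff.1 hb t
    exact hc.isPreconnected.ordConnected.out hs hu ⟨ht, htu.le⟩
  refine ⟨?_, hmem⟩
  ext U
  rw [mem_map, mem_atTop_sets, mem_atTop_sets]
  constructor
  · rintro ⟨⟨s, hs⟩, h⟩
    exact ⟨s, fun t ht => h ⟨t, hmem s hs ht⟩ ht⟩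
  · rintro ⟨a, h⟩
    obtain ⟨u, hu, hau⟩ := not_bddAbove_iff.1 hb a
    exact ⟨⟨u, hu⟩, fun t ht => h t (hau.le.trans ht)⟩

/-! ### The ends of maximal flow lines -/

section Ends

variable {r₀ : ℝ} {γ : ℝ → Phase} {I : Set ℝ}

/-- The forward end of a flow line along which the radius and the radial velocity converge. -/
theorem Data.IsMaxFlowLine.forward_end (hK : K.Subextremal) (hr₀ : r₀ ∈ Icc K.re K.rc)
    (hγ : K.IsMaxFlowLine r₀ γ I) {L Q r₁ y₁ : ℝ} (hQ : 0 < Q)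
    (hL : ∀ s ∈ I, angMom (γ s) = L) (hcQ : ∀ s ∈ I, K.carter r₀ (γ s) = Q)
    (hr₁ : K.rC < r₁) (h1 : Tendsto (fun s : I => (γ s).1.1) atTop (𝓝 r₁))
    (h2 : Tendsto (fun s : I => K.radVel r₀ (γ s)) atTop (𝓝 y₁)) :
    BddAbove I ∧ (r₁ ∈ K.dom → K.mu r₁ = 0 ∧
      K.b * (K.alpha r₀ r₁ * L) - K.f r₁ * y₁ = 0) := by
  have hline := hγ.1
  have hr₀pos := hK.pos_of_mem hr₀
  have : Nonempty I := hline.connected.nonempty.to_subtype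
  have hpot : y₁ ^ 2 = K.pot r₀ L Q r₁ := by
    have a1 := h2.pow 2
    have a2 : Tendsto (fun s : I => K.radVel r₀ (γ s) ^ 2) atTop (𝓝 (K.pot r₀ L Q r₁)) := by
      refine ((hasDerivAt_pot r₀ L Q r₁).continuousAt.tendsto.comp h1).congr fun s => ?_
      rw [radVel_sq hK (hline.mem s s.2), hL s s.2, hcQ s s.2]; rfl
    exact tendsto_nhds_unique a1 a2
  -- On an infinite interval the convergence of r and Y forces Y = 0 and V' = 0 in the limit. Since
  -- Y² = V, this would be a double zero of V, contrary to the absence of trapping.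
  have hbdd : BddAbove I := by
    by_contra hb
    obtain ⟨hmap, hIci⟩ := map_coe_atTop_of_not_bddAbove hline.connected hb
    have h1' : Tendsto (fun s => (γ s).1.1) atTop (𝓝 r₁) := by
      rw [← hmap]; exact tendsto_map'_iff.2 h1
    have h2' : Tendsto (fun s => K.radVel r₀ (γ s)) atTop (𝓝 y₁) := by
      rw [← hmap]; exact tendsto_map'_iff.2 h2
    obtain ⟨s₁, hs₁⟩ := hline.connected.nonempty
    have hI : ∀ s ≥ s₁, s ∈ I := fun s hs => hIci s₁ hs₁ hs
    set wl : ℝ := ((K.rc + K.δ) ^ 2 + K.a ^ 2)⁻¹ with hwl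
    have hrc : 0 < K.rc + K.δ := by linarith [hK.rc_pos, hK.δ_pos]
    have hwlpos : 0 < wl := by positivity
    have hw : ∀ s ≥ s₁, wl ≤ (K.rho2 (γ s).1.1 (γ s).1.2)⁻¹ := by
      intro s hs
      have hm := (hline.mem s (hI s hs)).1
      have hpos := hK.rho2_pos hm.1 (γ s).1.2
      refine inv_anti₀ hpos ?_
      have hz := z_sq_le hm
      have hr0 := hK.pos_of_dom hm.1
      have hrlt : (γ s).1.1 < K.rc + K.δ := hm.1.2
      unfold Data.rho2
      have : K.a ^ 2 * (γ s).1.2 2 ^ 2 ≤ K.a ^ 2 * 1 := by gcongr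
      have : (γ s).1.1 ^ 2 ≤ (K.rc + K.δ) ^ 2 := by gcongr
      linarith
    have e1 : 2 * y₁ = 0 := eq_zero_of_tendsto_of_deriv (k := fun s => 2 * K.radVel r₀ (γ s))
      (fun s hs => (hasDerivAt_r_flow (hline.deriv s (hI s hs)))) hw hwlpos h1' (h2'.const_mul 2)
    have e2 : K.dpot r₀ L Q r₁ = 0 :=
      eq_zero_of_tendsto_of_deriv (k := fun s => K.dpot r₀ L Q (γ s).1.1) (fun s hs => by
        have := hasDerivAt_radVel_flow hK (hline.deriv s (hI s hs)) (hline.mem s (hI s hs))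
        rw [hL s (hI s hs), hcQ s (hI s hs)] at this
        exact this) hw hwlpos h2' (((continuous_dpot r₀ L Q).tendsto r₁).comp h1')
    have hy0 : y₁ = 0 := by linarith
    rw [hy0] at hpot
    exact (dpot_of_pot_eq_zero hK hr₀ hQ hr₁ (by rw [← hpot]; norm_num)).2.2.2 e2
  refine ⟨hbdd, fun hdom => ?_⟩
  have hfc := (hK.f_analyticAt hdom).continuousAt.tendsto.comp h1
  have hhc := (hK.h_analyticAt hdom).continuousAt.tendsto.comp h1
  have hmc := ((contDiff_mu (K := K) (n := 0)).continuous.tendsto r₁).comp h1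
  have hac := ((contDiff_alpha (K := K) r₀ (n := 0)).continuous.tendsto r₁).comp h1
  obtain ⟨s₁, hs₁⟩ := hline.connected.nonempty
  have hcne : ∃ s ∈ I, K.carter r₀ (γ s) ≠ 0 := ⟨s₁, hs₁, by rw [hcQ s₁ hs₁]; exact hQ.ne'⟩
  have hb := hK.b_pos
  constructor
  -- Where μ ≠ 0, the definition of Y can be solved for ξ_r, which would then converge and allow an
  -- extension.
  · by_contra hmu
    refine hγ.false_of_tendsto hK hr₀pos hbdd hdom h1
      (ξ₁ := (y₁ + K.b * (K.f r₁ * K.alpha r₀ r₁) * L) / K.mu r₁) ?_ (Or.inr hcne)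
    refine ((h2.add (((hfc.mul hac).const_mul K.b).mul_const L)).div hmc hmu).congr' ?_
    filter_upwards [hmc.eventually_ne hmu] with s hs
    have hs' : K.mu (γ s).1.1 ≠ 0 := hs
    simp only [Function.comp, Pi.div_apply, Data.radVel, hL s s.2, Data.fa]
    field_simp
    ring
  -- Otherwise E converges as a quotient by `energy_mul`, hence so does ξ_r by `b_mul_xi`, and the
  -- line could again be extended.
  · by_contra hd
    have hdt : Tendsto (fun s : I => K.b * (K.alpha r₀ (γ s).1.1 * L)
        - K.f (γ s).1.1 * K.radVel r₀ (γ s)) atTop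
        (𝓝 (K.b * (K.alpha r₀ r₁ * L) - K.f r₁ * y₁)) :=
      ((hac.mul_const L).const_mul K.b).sub (hfc.mul h2)
    have hnt : Tendsto (fun s : I => K.b * (K.h (γ s).1.1 * K.b ^ 2 * (K.alpha r₀ (γ s).1.1 * L) ^ 2
        + K.f (γ s).1.1 ^ 2 * Q)) atTop
        (𝓝 (K.b * (K.h r₁ * K.b ^ 2 * (K.alpha r₀ r₁ * L) ^ 2 + K.f r₁ ^ 2 * Q))) :=
      (((hhc.mul_const (K.b ^ 2)).mul ((hac.mul_const L).pow 2)).add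
        ((hfc.pow 2).mul_const Q)).const_mul K.b
    refine hγ.false_of_tendsto hK hr₀pos hbdd hdom h1 ?_ (Or.inr hcne)
      (ξ₁ := (K.f r₁ * (K.b * (K.h r₁ * K.b ^ 2 * (K.alpha r₀ r₁ * L) ^ 2 + K.f r₁ ^ 2 * Q)
        / (K.b * (K.alpha r₀ r₁ * L) - K.f r₁ * y₁)) + K.b * K.h r₁ * y₁) / K.b)
    refine (((hfc.mul (hnt.div hdt hd)).add ((hhc.const_mul K.b).mul h2)).div_const K.b).congr' ?_
    filter_upwards [hdt.eventually_ne hd] with s hs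
    have hm := hline.mem s s.2
    have a1 := energy_mul hK hm
    have a2 := b_mul_xi hK hm
    rw [hL s s.2, hcQ s s.2] at a1
    simp only [Function.comp, Pi.div_apply]
    rw [← a1, mul_div_assoc, div_self hs, mul_one, ← a2, mul_div_cancel_left₀ _ hb.ne']

end Ends

/-! ### The two sides of the domain of outer communication -/

/-- `R` is the radius of one of the two horizons, and `τ` is the sign of `r - R` inside the domain
of outer communication. -/
def Data.IsSide (K : Data) (R τ : ℝ) : Prop := (R = K.re ∧ τ = 1) ∨ (R = K.rc ∧ τ = -1)

namespace Data.IsSide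

variable {R τ : ℝ} (hs : K.IsSide R τ)
include hs

theorem sq : τ * τ = 1 := by rcases hs with ⟨-, rfl⟩ | ⟨-, rfl⟩ <;> norm_num

theorem cases : τ = 1 ∨ τ = -1 := by rcases hs with ⟨-, rfl⟩ | ⟨-, rfl⟩ <;> simp

variable (hK : K.Subextremal)
include hK

theorem f_eq : K.f R = -τ := by
  rcases hs with ⟨rfl, rfl⟩ | ⟨rfl, rfl⟩
  · exact hK.f_re
  · simpa using hK.f_rc

theorem mu_zero : K.mu R = 0 := by
  rcases hs with ⟨rfl, rfl⟩ | ⟨rfl, rfl⟩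
  · exact hK.mu_re
  · exact hK.mu_rc

theorem dmu_pos : 0 < τ * K.dmu R := by
  rcases hs with ⟨rfl, rfl⟩ | ⟨rfl, rfl⟩
  · simpa using hK.dmu_re_pos
  · simpa using hK.dmu_rc_neg

theorem mem_Icc : R ∈ Icc K.re K.rc := by
  have := hK.re_lt
  rcases hs with ⟨rfl, rfl⟩ | ⟨rfl, rfl⟩
  · exact ⟨le_rfl, this.le⟩
  · exact ⟨this.le, le_rfl⟩

theorem mem_dom : R ∈ K.dom := hK.mem_dom_of_mem (hs.mem_Icc hK)

theorem mu_neg {r : ℝ} (hr : r ∈ K.dom) (h : τ * (r - R) < 0) : K.mu r < 0 := by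
  rcases hs with ⟨rfl, rfl⟩ | ⟨rfl, rfl⟩
  · exact hK.mu_neg_left (hK.rC_lt_of_dom hr) (by linarith)
  · exact hK.mu_neg_right (by linarith)

theorem mu_nonpos {r : ℝ} (hr : r ∈ K.dom) (h : τ * (r - R) ≤ 0) : K.mu r ≤ 0 := by
  rcases h.eq_or_lt with h | h
  · have : r = R := by
      rcases mul_eq_zero.1 h with h' | h'
      · have := hs.sq; rw [h'] at this; norm_num at this
      · linarith
    rw [this, hs.mu_zero hK]
  · exact (hs.mu_neg hK hr h).le

theorem mu_pos {r r₀ : ℝ} (hr₀ : r₀ ∈ Icc K.re K.rc) (h : 0 < τ * (r - R))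
    (h' : 0 < τ * (r₀ - r)) : 0 < K.mu r := by
  rcases hs with ⟨rfl, rfl⟩ | ⟨rfl, rfl⟩
  · exact hK.mu_pos (by linarith) (by linarith [hr₀.2])
  · exact hK.mu_pos (by linarith [hr₀.1]) (by linarith)

/-- At R the value of τf is -1. A change of sign at or beyond the horizon would produce a zero of f
with μ ≤ 0, whereas μh = 1 - f² = 1 and h > 0. -/
theorem f_neg {r : ℝ} (hr : r ∈ K.dom) (h : τ * (r - R) ≤ 0) : τ * K.f r < 0 := by
  by_contra hcon
  push Not at hcon
  have hR := hs.mem_dom hK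
  have hsub : uIcc r R ⊆ K.dom := ordConnected_Ioo.uIcc_subset hr hR
  have hc : ContinuousOn (fun x => τ * K.f x) (uIcc r R) := fun x hx =>
    ((hK.f_analyticAt (hsub hx)).continuousAt.const_smul τ).continuousWithinAt
  have h0 : (0 : ℝ) ∈ uIcc (τ * K.f r) (τ * K.f R) := by
    rw [hs.f_eq hK]
    refine mem_uIcc.2 (Or.inr ⟨?_, hcon⟩)
    have := hs.sq; linarith
  obtain ⟨x, hx, hx0⟩ := intermediate_value_uIcc hc h0
  have hx' : τ * (x - R) ≤ 0 := by
    rcases hs.cases with rfl | rfl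
    · have : r ≤ R := by linarith
      rw [uIcc_of_le this] at hx; linarith [hx.2]
    · have : R ≤ r := by linarith
      rw [uIcc_of_ge this] at hx; linarith [hx.1]
  have h1 := hs.mu_nonpos hK (hsub hx) hx'
  have h2 := h_pos hK (hsub hx)
  have h3 := hK.mu_mul_h (hsub hx)
  have hf : K.f x = 0 := by
    rcases mul_eq_zero.1 hx0 with h' | h'
    · have := hs.sq; rw [h'] at this; norm_num at this
    · exact h'
  rw [hf] at h3
  linarith [mul_nonpos_of_nonpos_of_nonneg h1 h2.le]

end Data.IsSide

section Signs

variable {R τ r₀ : ℝ} {q : Phase}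

/-- At r₀ the factor α vanishes and μ ≥ 0, so ρ²p = μξ_r² + Q > 0. The sphere r = r₀ is therefore a
barrier for all lines with Q > 0. -/
theorem radius_ne (hK : K.Subextremal) (hr₀ : r₀ ∈ Icc K.re K.rc) (hq : q ∈ K.Char r₀)
    (hQ : 0 < K.carter r₀ q) : q.1.1 ≠ r₀ := by
  intro h
  have h2 := hq.2
  have hmu := hK.mu_nonneg hr₀
  have hα : K.alpha r₀ r₀ = 0 := by simp [Data.alpha]
  unfold Data.radial at h2
  rw [h, hα] at h2
  have : 0 ≤ K.mu r₀ * q.2.1 ^ 2 := by positivity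
  linarith

/-- Outside of the domain of outer communication, future directed bicharacteristics move away
from it. -/
theorem radVel_neg_outside (hK : K.Subextremal) (hs : K.IsSide R τ)
    (hq : q ∈ K.Char r₀) (hQ : 0 < K.carter r₀ q) (hE : K.energy r₀ q < 0)
    (h : τ * (q.1.1 - R) ≤ 0) : τ * K.radVel r₀ q < 0 := by
  have hb := hK.b_pos
  have hh := h_pos hK hq.1.1
  have hτ := hs.sq
  set X := K.alpha r₀ q.1.1 * angMom q with hX
  -- On the horizon, μ = 0 and f = -τ give Y = τbX, and `energy_mul` determines the sign of X.
  -- Beyond it, the sign of μE is compared with the sizes of Y and bX.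
  rcases h.eq_or_lt with h0 | h0
  · have hR : q.1.1 = R := by
      rcases mul_eq_zero.1 h0 with h' | h'
      · rw [h'] at hτ; norm_num at hτ
      · linarith
    have hY : K.radVel r₀ q = τ * (K.b * X) := by
      unfold Data.radVel Data.fa
      rw [hX, hR, hs.mu_zero hK, hs.f_eq hK]; ring
    have h1 := energy_mul hK hq
    rw [← hX, hY, hR, hs.f_eq hK] at h1
    have hh' : 0 < K.h R := hR ▸ hh
    have h2 : K.energy r₀ q * (2 * K.b * X) =
        K.b * (K.h R * K.b ^ 2 * X ^ 2 + K.carter r₀ q) := by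
      linear_combination h1 - K.b * (K.energy r₀ q * X - K.carter r₀ q) * hτ
    have h3 : 0 < K.energy r₀ q * (2 * K.b * X) := by rw [h2]; positivity
    have h4 : 2 * K.b * X < 0 := neg_of_mul_pos_right h3 hE.le
    rw [hY]
    have : τ * (τ * (K.b * X)) = K.b * X := by linear_combination K.b * X * hτ
    linarith
  · have hmu := hs.mu_neg hK hq.1.1 h0
    have hf := hs.f_neg hK hq.1.1 h
    have h1 := mu_mul_energy hK hq
    have h2 := radVel_sq hK hq
    unfold Data.pot at h2
    have h3 := hK.mu_mul_h hq.1.1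
    rw [← hX] at h1
    have hpos : 0 < K.f q.1.1 * K.radVel r₀ q + K.b * X := by
      have := mul_pos_of_neg_of_neg hmu hE
      rw [h1] at this
      exact (mul_pos_iff_of_pos_left hb).1 this
    have hY2 : (K.b * X) ^ 2 < K.radVel r₀ q ^ 2 := by
      rw [h2, hX]
      have := mul_neg_of_neg_of_pos hmu hQ
      linarith
    have hf2 : 1 ≤ K.f q.1.1 ^ 2 := by
      have := mul_neg_of_neg_of_pos hmu hh
      linarith
    -- Beyond the horizon |Y| > |bX| and |f| ≥ 1, so fY determines the sign of fY + bX.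
    have hfY : 0 < K.f q.1.1 * K.radVel r₀ q := by
      by_contra hcon
      push Not at hcon
      have h5 : (K.b * X) ^ 2 < (K.f q.1.1 * K.radVel r₀ q) ^ 2 := by
        rw [mul_pow]
        nlinarith [sq_nonneg (K.radVel r₀ q)]
      have h6 := sq_lt_sq.1 h5
      rw [abs_of_nonpos hcon] at h6
      linarith [le_abs_self (K.b * X)]
    have : 0 < (τ * K.f q.1.1) * (τ * K.radVel r₀ q) := by
      have : (τ * K.f q.1.1) * (τ * K.radVel r₀ q) = K.f q.1.1 * K.radVel r₀ q := by
        linear_combination K.f q.1.1 * K.radVel r₀ q * hτ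
      linarith
    exact neg_of_mul_pos_right this hf.le

theorem radVel_pos_outside (hK : K.Subextremal) (hs : K.IsSide R τ)
    (hq : q ∈ K.Char r₀) (hQ : 0 < K.carter r₀ q) (hE : 0 < K.energy r₀ q)
    (h : τ * (q.1.1 - R) ≤ 0) : 0 < τ * K.radVel r₀ q := by
  have := radVel_neg_outside hK hs (char_flip.2 hq) (by rwa [carter_flip])
    (by rw [energy_flip]; linarith) h
  rw [radVel_flip] at this
  linarith

/-- The inequalities of the exterior case are reversed: now μ > 0 gives |Y| < |bX| and |f| ≤ 1, so
bX determines the sign of fY + bX, which is that of μE. -/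
theorem angMom_neg_inside (hK : K.Subextremal) (hs : K.IsSide R τ) (hr₀ : r₀ ∈ Icc K.re K.rc)
    (hq : q ∈ K.Char r₀) (hQ : 0 < K.carter r₀ q) (hE : K.energy r₀ q < 0)
    (h : 0 < τ * (q.1.1 - R)) (h' : 0 < τ * (r₀ - q.1.1)) :
    K.alpha r₀ q.1.1 * angMom q < 0 := by
  have hb := hK.b_pos
  have hh := h_pos hK hq.1.1
  set X := K.alpha r₀ q.1.1 * angMom q with hX
  have hmu := hs.mu_pos hK hr₀ h h'
  have h1 := mu_mul_energy hK hq
  have h2 := radVel_sq hK hq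
  unfold Data.pot at h2
  have h3 := hK.mu_mul_h hq.1.1
  rw [← hX] at h1
  have hneg : K.f q.1.1 * K.radVel r₀ q + K.b * X < 0 := by
    have := mul_neg_of_pos_of_neg hmu hE
    rw [h1] at this
    exact neg_of_mul_neg_right this hb.le
  have hY2 : K.radVel r₀ q ^ 2 < (K.b * X) ^ 2 := by
    rw [h2, hX]
    have := mul_pos hmu hQ
    linarith
  have hf2 : K.f q.1.1 ^ 2 ≤ 1 := by
    have := mul_pos hmu hh
    linarith
  by_contra hcon
  push Not at hcon
  have h5 : (K.f q.1.1 * K.radVel r₀ q) ^ 2 < (K.b * X) ^ 2 := by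
    rw [mul_pow]
    nlinarith [sq_nonneg (K.radVel r₀ q)]
  have h6 := sq_lt_sq.1 h5
  rw [abs_of_nonneg (a := K.b * X) (by positivity)] at h6
  linarith [neg_abs_le (K.f q.1.1 * K.radVel r₀ q)]

/-- A turning point is a zero of V, and its slope has the sign of r - r₀. So a line can only turn
away from r₀, towards the horizon on its side or the boundary. -/
theorem dpot_neg_of_radVel_eq_zero (hK : K.Subextremal) (hs : K.IsSide R τ)
    (hr₀ : r₀ ∈ Icc K.re K.rc) (hq : q ∈ K.Char r₀) (hQ : 0 < K.carter r₀ q)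
    (h' : 0 < τ * (r₀ - q.1.1)) (h0 : K.radVel r₀ q = 0) :
    τ * K.dpot r₀ (angMom q) (K.carter r₀ q) q.1.1 < 0 := by
  have h2 := radVel_sq hK hq
  rw [h0, zero_pow two_ne_zero] at h2
  obtain ⟨-, a1, a2, -⟩ := dpot_of_pot_eq_zero hK hr₀ hQ (hK.rC_lt_of_dom hq.1.1) h2.symm
  rcases hs.cases with rfl | rfl
  · simpa using a1 (by linarith)
  · simpa using a2 (by linarith)

end Signs

/-! ### One-dimensional dynamics -/

/-- A barrier argument: the value zero can only be crossed downwards. It is applied to τY, whose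
zeros are turning points, and to τ(r - R), whose zeros are horizon crossings. -/
theorem neg_of_deriv_neg_of_eq_zero {w w' : ℝ → ℝ} {I : Set ℝ} (hI : OrdConnected I)
    (hd : ∀ s ∈ I, HasDerivAt w (w' s) s) (hz : ∀ s ∈ I, w s = 0 → w' s < 0) {s₁ s : ℝ}
    (hs₁ : s₁ ∈ I) (h1 : w s₁ ≤ 0) (hs : s ∈ I) (hlt : s₁ < s) : w s < 0 := by
  have hsub : Icc s₁ s ⊆ I := hI.out hs₁ hs
  have hle : ∀ t ∈ Icc s₁ s, w t ≤ 0 := by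
    intro t ht
    exact image_le_of_deriv_right_lt_deriv_boundary' (B := fun _ => 0) (B' := fun _ => 0)
      (fun t ht => (hd t (hsub ht)).continuousAt.continuousWithinAt)
      (fun t ht => (hd t (hsub (Ico_subset_Icc_self ht))).hasDerivWithinAt) h1
      continuousOn_const (fun t _ => hasDerivWithinAt_const _ _ _)
      (fun t ht h => hz t (hsub (Ico_subset_Icc_self ht)) h) ht
  refine (hle s ⟨hlt.le, le_rfl⟩).lt_of_ne fun h0 => ?_
  have h2 := hz s hs h0
  have h3 : Tendsto (slope w s) (𝓝[<] s) (𝓝 (w' s)) :=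
    (hasDerivAt_iff_tendsto_slope.1 (hd s hs)).mono_left (nhdsWithin_mono _ fun x hx => ne_of_lt hx)
  have h4 : 0 ≤ w' s := by
    refine ge_of_tendsto h3 ?_
    filter_upwards [Ioo_mem_nhdsLT hlt] with t ht
    rw [slope_def_field, h0, sub_zero]
    exact div_nonneg_of_nonpos (hle t ⟨ht.1.le, ht.2.le⟩) (by linarith [ht.2])
  linarith

theorem exists_tendsto_of_monotoneOn {I : Set ℝ} {u : ℝ → ℝ} {s₁ B : ℝ} (hs₁ : s₁ ∈ I)
    (hu : MonotoneOn u (I ∩ Ici s₁)) (hB : ∀ s ∈ I, u s ≤ B) :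
    ∃ x, Tendsto (fun s : I => u s) atTop (𝓝 x) ∧ ∀ s ∈ I, s₁ ≤ s → u s ≤ x := by
  have : Nonempty I := ⟨⟨s₁, hs₁⟩⟩
  have hmem : ∀ s : I, max (s : ℝ) s₁ ∈ I := fun s => by
    rcases le_total (s : ℝ) s₁ with h | h
    · rwa [max_eq_right h]
    · rw [max_eq_left h]; exact s.2
  have hmono : Monotone fun s : I => u (max (s : ℝ) s₁) := fun s t hst =>
    hu ⟨hmem s, mem_Ici.2 (le_max_right _ _)⟩ ⟨hmem t, mem_Ici.2 (le_max_right _ _)⟩ (max_le_max_right _ hst)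
  have hb : BddAbove (range fun s : I => u (max (s : ℝ) s₁)) :=
    ⟨B, by rintro _ ⟨s, rfl⟩; exact hB _ (hmem s)⟩
  refine ⟨_, (tendsto_atTop_ciSup hmono hb).congr' ?_, fun s hs h => ?_⟩
  · filter_upwards [eventually_ge_atTop (⟨s₁, hs₁⟩ : I)] with s hs
    rw [max_eq_left (show s₁ ≤ (s : ℝ) from hs)]
  · have := le_ciSup hb ⟨s, hs⟩
    simpa [max_eq_left h] using this

/-! ### Convergence of the radius along flow lines -/

section Lines

variable {r₀ R τ : ℝ} {γ : ℝ → Phase} {I : Set ℝ}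

theorem Data.IsFlowLine.monotoneOn_radius (hK : K.Subextremal) (h : K.IsFlowLine r₀ γ I)
    {κ s₁ : ℝ} (hY : ∀ s ∈ I, s₁ < s → 0 ≤ κ * K.radVel r₀ (γ s)) :
    MonotoneOn (fun s => κ * (γ s).1.1) (I ∩ Ici s₁) := by
  have hconv : Convex ℝ (I ∩ Ici s₁) :=
    (h.connected.isPreconnected.ordConnected.inter ordConnected_Ici).convex
  have hint : ∀ s ∈ interior (I ∩ Ici s₁), s ∈ I ∧ s₁ < s := by
    intro s hs
    rw [interior_inter, interior_Ici, h.isOpen.interior_eq] at hs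
    exact hs
  refine monotoneOn_of_deriv_nonneg hconv
    (fun s hs => ((hasDerivAt_r_flow (h.deriv s hs.1)).const_mul κ).continuousAt.continuousWithinAt)
    (fun s hs => ((hasDerivAt_r_flow
      (h.deriv s (hint s hs).1)).const_mul κ).differentiableAt.differentiableWithinAt)
    fun s hs => ?_
  obtain ⟨h1, h2⟩ := hint s hs
  rw [((hasDerivAt_r_flow (h.deriv s h1)).const_mul κ).deriv]
  have hρ := hK.rho2_pos (h.mem s h1).1.1 (γ s).1.2
  have := hY s h1 h2
  rw [show κ * (2 * K.radVel r₀ (γ s) / K.rho2 (γ s).1.1 (γ s).1.2)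
    = 2 * (κ * K.radVel r₀ (γ s)) / K.rho2 (γ s).1.1 (γ s).1.2 by ring]
  positivity

/-- If the radial velocity has a constant sign, then the radius and the radial velocity
converge. -/
theorem Data.IsFlowLine.exists_limit (hK : K.Subextremal) (h : K.IsFlowLine r₀ γ I)
    {κ s₁ : ℝ} (hκ : κ * κ = 1) (hs₁ : s₁ ∈ I)
    (hY : ∀ s ∈ I, s₁ < s → 0 ≤ κ * K.radVel r₀ (γ s)) :
    ∃ r₁ y₁, Tendsto (fun s : I => (γ s).1.1) atTop (𝓝 r₁) ∧
      Tendsto (fun s : I => K.radVel r₀ (γ s)) atTop (𝓝 y₁) ∧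
      r₁ ∈ Icc (K.re - K.δ) (K.rc + K.δ) ∧ ∀ s ∈ I, s₁ ≤ s → κ * (γ s).1.1 ≤ κ * r₁ := by
  have : Nonempty I := ⟨⟨s₁, hs₁⟩⟩
  have hB : ∀ s ∈ I, κ * (γ s).1.1 ≤ |κ| * (K.rc + K.δ) := by
    intro s hs
    have h1 := hK.pos_of_dom (h.mem s hs).1.1
    have h2 : (γ s).1.1 < K.rc + K.δ := (h.mem s hs).1.1.2
    calc κ * (γ s).1.1 ≤ |κ| * (γ s).1.1 := by gcongr; exact le_abs_self κ
      _ ≤ _ := by gcongr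
  obtain ⟨x, hx1, hx2⟩ := exists_tendsto_of_monotoneOn hs₁ (h.monotoneOn_radius hK hY) hB
  have hr : Tendsto (fun s : I => (γ s).1.1) atTop (𝓝 (κ * x)) := by
    refine (hx1.const_mul κ).congr fun s => ?_
    linear_combination (γ s).1.1 * hκ
  set L := angMom (γ s₁) with hL
  set Q := K.carter r₀ (γ s₁) with hQ
  -- Once the sign of Y is fixed, Y = κ√V(r), so its convergence follows from that of r.
  have hp : Tendsto (fun s : I => κ * Real.sqrt (K.pot r₀ L Q (γ s).1.1)) atTop
      (𝓝 (κ * Real.sqrt (K.pot r₀ L Q (κ * x)))) :=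
    (((hasDerivAt_pot r₀ L Q (κ * x)).continuousAt.sqrt.tendsto).comp hr).const_mul κ
  refine ⟨κ * x, κ * Real.sqrt (K.pot r₀ L Q (κ * x)), hr, hp.congr' ?_,
    isClosed_Icc.mem_of_tendsto hr (Eventually.of_forall fun s => Ioo_subset_Icc_self
      (h.mem s s.2).1.1), fun s hs hss => ?_⟩
  · have hne : ∃ s ∈ I, s₁ < s := by
      obtain ⟨e, he, hsub⟩ := Metric.isOpen_iff.1 h.isOpen s₁ hs₁
      exact ⟨s₁ + e / 2, hsub (by simp [abs_of_pos he, he]), by linarith⟩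
    obtain ⟨s₂, hs₂, h12⟩ := hne
    filter_upwards [eventually_ge_atTop (⟨s₂, hs₂⟩ : I)] with s hs
    have hs' : s₁ < s := h12.trans_le hs
    have e := radVel_sq hK (h.mem s s.2)
    rw [h.angMom_eq s.2 hs₁, h.carter_eq hK s.2 hs₁] at e
    rw [← e, ← one_mul (K.radVel r₀ (γ s) ^ 2), ← hκ,
      show κ * κ * K.radVel r₀ (γ s) ^ 2 = (κ * K.radVel r₀ (γ s)) ^ 2 by ring,
      Real.sqrt_sq (hY s s.2 hs')]
    linear_combination K.radVel r₀ (γ s) * hκ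
  · have := hx2 s hs hss
    rw [← mul_assoc, hκ, one_mul]
    exact this

/-- The forward limit of a maximal flow line that is not in the conormal bundle of a horizon. -/
theorem Data.IsMaxFlowLine.forward_limit (hK : K.Subextremal) (hr₀ : r₀ ∈ Icc K.re K.rc)
    (hs : K.IsSide R τ) (hγ : K.IsMaxFlowLine r₀ γ I) {L Q : ℝ} (hQ : 0 < Q)
    (hL : ∀ s ∈ I, angMom (γ s) = L) (hcQ : ∀ s ∈ I, K.carter r₀ (γ s) = Q)
    (hside : ∀ s ∈ I, 0 < τ * (r₀ - (γ s).1.1)) :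
    BddAbove I ∧ ∃ r₁ y₁, Tendsto (fun s : I => (γ s).1.1) atTop (𝓝 r₁) ∧
      Tendsto (fun s : I => K.radVel r₀ (γ s)) atTop (𝓝 y₁) ∧
      (r₁ = R - τ * K.δ ∨ (r₁ = R ∧ K.b * (K.alpha r₀ R * L) + τ * y₁ = 0)) := by
  have hline := hγ.1
  have hτ := hs.sq
  have : Nonempty I := hline.connected.nonempty.to_subtype
  have hlim : ∃ r₁ y₁, Tendsto (fun s : I => (γ s).1.1) atTop (𝓝 r₁) ∧
      Tendsto (fun s : I => K.radVel r₀ (γ s)) atTop (𝓝 y₁) ∧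
      r₁ ∈ Icc (K.re - K.δ) (K.rc + K.δ) := by
    -- Because turning is possible in one direction only, either τY is nonpositive at some time and
    -- negative from then on, or it is positive throughout. In both cases r is eventually monotone.
    by_cases hcase : ∃ s ∈ I, τ * K.radVel r₀ (γ s) ≤ 0
    · obtain ⟨s₁, hs₁, h1⟩ := hcase
      have hneg : ∀ s ∈ I, s₁ < s → τ * K.radVel r₀ (γ s) < 0 := fun s hsI hlt =>
        neg_of_deriv_neg_of_eq_zero hline.connected.isPreconnected.ordConnected
          (fun t ht => (hasDerivAt_radVel_flow hK (hline.deriv t ht) (hline.mem t ht)).const_mul τ)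
          (fun t ht h0 => by
            have hY : K.radVel r₀ (γ t) = 0 := by
              linear_combination τ * h0 - K.radVel r₀ (γ t) * hτ
            have hρ := hK.rho2_pos (hline.mem t ht).1.1 (γ t).1.2
            rw [← mul_div_assoc]
            exact div_neg_of_neg_of_pos (dpot_neg_of_radVel_eq_zero hK hs hr₀ (hline.mem t ht)
              (by rw [hcQ t ht]; exact hQ) (hside t ht) hY) hρ) hs₁ h1 hsI hlt
      obtain ⟨r₁, y₁, a1, a2, a3, -⟩ := hline.exists_limit hK (κ := -τ) (by linarith) hs₁
        (fun s hsI hlt => by have := hneg s hsI hlt; linarith)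
      exact ⟨r₁, y₁, a1, a2, a3⟩
    · push Not at hcase
      obtain ⟨s₁, hs₁⟩ := hline.connected.nonempty
      obtain ⟨r₁, y₁, a1, a2, a3, -⟩ := hline.exists_limit hK hτ hs₁
        (fun s hsI _ => (hcase s hsI).le)
      exact ⟨r₁, y₁, a1, a2, a3⟩
  obtain ⟨r₁, y₁, a1, a2, a3⟩ := hlim
  have hrC : K.rC < r₁ := hK.δ_small.trans_le a3.1
  obtain ⟨hb, hend⟩ := hγ.forward_end hK hr₀ hQ hL hcQ hrC a1 a2
  refine ⟨hb, r₁, y₁, a1, a2, ?_⟩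
  have hle : 0 ≤ τ * (r₀ - r₁) := ge_of_tendsto ((a1.const_sub r₀).const_mul τ)
    (Eventually.of_forall fun s => (hside s s.2).le)
  by_cases hdom : r₁ ∈ K.dom
  · right
    obtain ⟨h1, h2⟩ := hend hdom
    have hR : r₁ = R := by
      by_contra hne
      -- the limit is the other horizon, and it is `r₀`
      have hother : r₁ = r₀ ∧ τ * K.dmu r₀ < 0 := by
        rcases (hK.mu_eq_zero_iff hrC).1 h1 with h | h <;> rcases hs with ⟨rfl, rfl⟩ | ⟨rfl, rfl⟩
        · exact absurd h hne
        · have e : r₁ = r₀ := le_antisymm (by rw [h]; exact hr₀.1) (by linarith)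
          refine ⟨e, ?_⟩
          rw [← e, h]; linarith [hK.dmu_re_pos]
        · have e : r₁ = r₀ := le_antisymm (by linarith) (by rw [h]; exact hr₀.2)
          refine ⟨e, ?_⟩
          rw [← e, h]; linarith [hK.dmu_rc_neg]
        · exact absurd h hne
      obtain ⟨rfl, hd⟩ := hother
      have hα : K.alpha r₁ r₁ = 0 := by simp [Data.alpha]
      have hp0 : K.pot r₁ L Q r₁ = 0 := by unfold Data.pot; rw [h1, hα]; ring
      -- At r₀ = r₁, both α and μ vanish, so V = 0 and τV' = -τμ'Q > 0. Then V would be negative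
      -- just before r₀ on the side of the line, but V = Y² ≥ 0 there.
      have hsl := (hasDerivAt_iff_tendsto_slope.1 (hasDerivAt_pot (K := K) r₁ L Q r₁)).comp
        (tendsto_nhdsWithin_iff.2 ⟨a1, Eventually.of_forall fun s => by
          intro h
          have h' : (γ s).1.1 = r₁ := h
          have := hside s s.2
          rw [h'] at this; simp at this⟩)
      have hle' : τ * K.dpot r₁ L Q r₁ ≤ 0 := by
        refine le_of_tendsto (hsl.const_mul τ) (Eventually.of_forall fun s => ?_)
        have e := radVel_sq hK (hline.mem s s.2)
        rw [hL s s.2, hcQ s s.2] at e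
        have hp : 0 ≤ K.pot r₁ L Q (γ s).1.1 := by rw [← e]; positivity
        have hsd := hside s s.2
        simp only [Function.comp, slope_def_field, hp0, sub_zero]
        rcases hs.cases with rfl | rfl
        · rw [one_mul]
          exact div_nonpos_of_nonneg_of_nonpos hp (by linarith)
        · have : 0 ≤ K.pot r₁ L Q (γ s).1.1 / ((γ s).1.1 - r₁) := div_nonneg hp (by linarith)
          linarith
      unfold Data.dpot at hle'
      rw [hα] at hle'
      have := mul_neg_of_neg_of_pos hd hQ
      linarith
    refine ⟨hR, ?_⟩
    rw [hR, hs.f_eq hK] at h2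
    linarith
  · left
    have hend : r₁ = K.re - K.δ ∨ r₁ = K.rc + K.δ := by
      by_contra hcon
      push Not at hcon
      exact hdom ⟨lt_of_le_of_ne a3.1 (Ne.symm hcon.1), lt_of_le_of_ne a3.2 hcon.2⟩
    have hδ := hK.δ_pos
    have hlt := hK.re_lt
    rcases hs with ⟨rfl, rfl⟩ | ⟨rfl, rfl⟩ <;> rcases hend with h | h
    · rw [h]; ring
    · exfalso; rw [h] at hle; linarith [hr₀.2]
    · exfalso; rw [h] at hle; linarith [hr₀.1]
    · rw [h]; ring

end Lines

/-! ### Ends of future and past directed flow lines -/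

section Lines

variable {r₀ R τ : ℝ} {γ : ℝ → Phase} {I : Set ℝ}

theorem forall_pos_or_forall_neg {I : Set ℝ} {g : ℝ → ℝ} (hI : IsConnected I)
    (hc : ContinuousOn g I) (hne : ∀ s ∈ I, g s ≠ 0) : (∀ s ∈ I, 0 < g s) ∨ ∀ s ∈ I, g s < 0 := by
  by_contra hcon
  push Not at hcon
  obtain ⟨⟨s, hs, h1⟩, t, ht, h2⟩ := hcon
  obtain ⟨u, hu, h0⟩ := hI.isPreconnected.intermediate_value hs ht hc ⟨h1, h2⟩
  exact hne u hu h0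

theorem Data.IsFlowLine.continuousOn_radius (h : K.IsFlowLine r₀ γ I) :
    ContinuousOn (fun s => (γ s).1.1) I := fun _ hs =>
  (continuous_fst.fst.continuousAt.comp (h.continuousAt hs)).continuousWithinAt

/-- The barrier r = r₀ confines the connected line to one of its sides. -/
theorem Data.IsFlowLine.exists_side (hK : K.Subextremal) (hr₀ : r₀ ∈ Icc K.re K.rc)
    (h : K.IsFlowLine r₀ γ I) (hQ : ∀ s ∈ I, 0 < K.carter r₀ (γ s)) :
    ∃ R τ, K.IsSide R τ ∧ ∀ s ∈ I, 0 < τ * (r₀ - (γ s).1.1) := by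
  rcases forall_pos_or_forall_neg (g := fun s => r₀ - (γ s).1.1) h.connected
    (continuousOn_const.sub h.continuousOn_radius)
    (fun s hs h0 => radius_ne hK hr₀ (h.mem s hs) (hQ s hs) (by linarith)) with h1 | h1
  · exact ⟨K.re, 1, Or.inl ⟨rfl, rfl⟩, fun s hs => by have := h1 s hs; linarith⟩
  · exact ⟨K.rc, -1, Or.inr ⟨rfl, rfl⟩, fun s hs => by have := h1 s hs; linarith⟩

theorem continuousAt_energy (hK : K.Subextremal) {q : Phase} (hq : q.1.1 ∈ K.dom) :
    ContinuousAt (K.energy r₀) q := by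
  have h1 : ContinuousAt (fun q : Phase => K.f q.1.1) q :=
    ContinuousAt.comp (g := K.f) (hK.f_analyticAt hq).continuousAt (by fun_prop)
  have h2 : ContinuousAt (fun q : Phase => K.h q.1.1) q :=
    ContinuousAt.comp (g := K.h) (hK.h_analyticAt hq).continuousAt (by fun_prop)
  have h3 : Continuous (fun q : Phase => K.alpha r₀ q.1.1) :=
    (contDiff_alpha (K := K) r₀ (n := 0)).continuous.comp (by fun_prop)
  unfold Data.energy angMom phiComp
  fun_prop

/-- E is continuous along the line and has no zeros on the characteristic set, so its sign is
constant. -/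
theorem Data.IsFlowLine.energy_neg (hK : K.Subextremal) (hr₀ : 0 < r₀)
    (h : K.IsFlowLine r₀ γ I) {s : ℝ} (hs : s ∈ I) (hE : K.energy r₀ (γ s) < 0) :
    ∀ t ∈ I, K.energy r₀ (γ t) < 0 := by
  rcases forall_pos_or_forall_neg (g := fun s => K.energy r₀ (γ s)) h.connected
    (fun s hs => ((continuousAt_energy hK (h.mem s hs).1.1).comp
      (h.continuousAt hs)).continuousWithinAt)
    (fun s hs => energy_ne_zero hK hr₀ (h.mem s hs)) with h1 | h1
  · exact absurd (h1 s hs) (not_lt.2 hE.le)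
  · exact h1

/-- Future directed lines end outside of the domain of outer communication. -/
theorem Data.IsMaxFlowLine.forward_radius (hK : K.Subextremal) (hr₀ : r₀ ∈ Icc K.re K.rc)
    (hs : K.IsSide R τ) (hγ : K.IsMaxFlowLine r₀ γ I) (hQ : ∀ s ∈ I, 0 < K.carter r₀ (γ s))
    (hE : ∀ s ∈ I, K.energy r₀ (γ s) < 0) (hside : ∀ s ∈ I, 0 < τ * (r₀ - (γ s).1.1)) :
    EndsAtRadius (R - τ * K.δ) γ I := by
  have hline := hγ.1
  obtain ⟨s₀, hs₀⟩ := hline.connected.nonempty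
  have : Nonempty I := ⟨⟨s₀, hs₀⟩⟩
  obtain ⟨hb, r₁, y₁, a1, a2, hr₁⟩ := hγ.forward_limit hK hr₀ hs (hQ s₀ hs₀)
    (fun s hsI => hline.angMom_eq hsI hs₀) (fun s hsI => hline.carter_eq hK hsI hs₀) hside
  rcases hr₁ with rfl | ⟨rfl, hD⟩
  · exact ⟨hb, a1⟩
  exfalso
  have hτ := hs.sq
  have hin : ∀ s ∈ I, 0 < τ * ((γ s).1.1 - r₁) := by
    by_contra hcon
    push Not at hcon
    obtain ⟨s₁, hs₁, h1⟩ := hcon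
    have hord := hline.connected.isPreconnected.ordConnected
    -- once outside, the line stays outside and moves away
    have hout : ∀ s ∈ I, s₁ < s → τ * (γ s).1.1 - τ * r₁ < 0 := fun s hsI hlt =>
      neg_of_deriv_neg_of_eq_zero hord
        (fun t ht => ((hasDerivAt_r_flow (hline.deriv t ht)).const_mul τ).sub_const (τ * r₁))
        (fun t ht h0 => by
          have h2 := radVel_neg_outside hK hs (hline.mem t ht) (hQ t ht) (hE t ht) (by linarith)
          have hρ := hK.rho2_pos (hline.mem t ht).1.1 (γ t).1.2
          rw [show τ * (2 * K.radVel r₀ (γ t) / K.rho2 (γ t).1.1 (γ t).1.2)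
            = 2 * (τ * K.radVel r₀ (γ t)) / K.rho2 (γ t).1.1 (γ t).1.2 by ring]
          exact div_neg_of_neg_of_pos (by linarith) hρ) hs₁ (by linarith) hsI hlt
    have hmono := hline.monotoneOn_radius hK (κ := -τ) (s₁ := s₁) fun s hsI hlt => by
      have := radVel_neg_outside hK hs (hline.mem s hsI) (hQ s hsI) (hE s hsI)
        (by linarith [hout s hsI hlt])
      linarith
    obtain ⟨e, he, hsub⟩ := Metric.isOpen_iff.1 hline.isOpen s₁ hs₁
    have hs₂ : s₁ + e / 2 ∈ I := hsub (by simp [abs_of_pos he, he])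
    have h3 : τ * r₁ ≤ τ * (γ (s₁ + e / 2)).1.1 := by
      refine le_of_tendsto (a1.const_mul τ) ?_
      filter_upwards [eventually_ge_atTop (⟨s₁ + e / 2, hs₂⟩ : I)] with s hss
      have hss' : s₁ + e / 2 ≤ s := hss
      have := hmono ⟨hs₂, mem_Ici.2 (by linarith)⟩ ⟨s.2, mem_Ici.2 (by linarith)⟩ hss'
      simp only at this
      linarith
    linarith [hout _ hs₂ (by linarith)]
  -- inside, the angular momentum forces the line to move inwards near the horizon
  have hX0 := angMom_neg_inside hK hs hr₀ (hline.mem s₀ hs₀) (hQ s₀ hs₀) (hE s₀ hs₀) (hin s₀ hs₀)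
    (hside s₀ hs₀)
  have hX : K.alpha r₀ r₁ * angMom (γ s₀) < 0 := by
    have h1 := hin s₀ hs₀
    have h2 := hside s₀ hs₀
    have hr0 := hK.pos_of_mem hr₀
    have hr1 := hK.pos_of_mem (hs.mem_Icc hK)
    have hrs := hK.pos_of_dom (hline.mem s₀ hs₀).1.1
    unfold Data.alpha at hX0 ⊢
    have hden : 0 < r₀ ^ 2 + K.a ^ 2 := by positivity
    rw [div_mul_eq_mul_div] at hX0 ⊢
    have h3 := neg_of_div_neg_left hX0 hden.le
    refine div_neg_of_neg_of_pos ?_ hden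
    have e1 : K.a * (r₀ ^ 2 - (γ s₀).1.1 ^ 2) * angMom (γ s₀) =
        (τ * (r₀ - (γ s₀).1.1)) * (r₀ + (γ s₀).1.1) * (τ * (K.a * angMom (γ s₀))) := by
      linear_combination (-(K.a * (r₀ ^ 2 - (γ s₀).1.1 ^ 2) * angMom (γ s₀))) * hτ
    have e2 : K.a * (r₀ ^ 2 - r₁ ^ 2) * angMom (γ s₀) =
        (τ * (r₀ - r₁)) * (r₀ + r₁) * (τ * (K.a * angMom (γ s₀))) := by
      linear_combination (-(K.a * (r₀ ^ 2 - r₁ ^ 2) * angMom (γ s₀))) * hτ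
    rw [e1] at h3
    have h4 : τ * (K.a * angMom (γ s₀)) < 0 := neg_of_mul_neg_right h3 (by positivity)
    rw [e2]
    exact mul_neg_of_pos_of_neg (mul_pos (by linarith) (by linarith)) h4
  -- The relation in `hD`, which holds in the limit at the horizon, turns the sign of αL into the
  -- inward sign of the limiting radial velocity; a line inside could then not converge outwards to
  -- R.
  have hy : 0 < τ * y₁ := by
    have := mul_neg_of_pos_of_neg hK.b_pos hX
    linarith
  obtain ⟨⟨s₁, hs₁⟩, hev⟩ := eventually_atTop.1 ((a2.const_mul τ).eventually (lt_mem_nhds hy))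
  have hmono := hline.monotoneOn_radius hK (κ := τ) (s₁ := s₁) fun s hsI hlt =>
    (hev ⟨s, hsI⟩ hlt.le).le
  have h3 : τ * (γ s₁).1.1 ≤ τ * r₁ := by
    refine ge_of_tendsto (a1.const_mul τ) ?_
    filter_upwards [eventually_ge_atTop (⟨s₁, hs₁⟩ : I)] with s hss
    exact hmono ⟨hs₁, self_mem_Ici⟩ ⟨s.2, hss⟩ hss
  linarith [hin s₁ hs₁]

/-- By `energy_mul`, E is a quotient whose numerator has a positive limit and whose denominator
tends to 0 through positive values. So E → ∞, and bξ_r = fE + bhY is dominated by fE with f → -τ. -/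
theorem xi_tendsto_atBot (hK : K.Subextremal) (hs : K.IsSide R τ) {ι : Type*}
    {l : Filter ι} {c : ι → Phase} {L Q y₁ : ℝ} (hQ : 0 < Q) (hc : ∀ i, c i ∈ K.Char r₀)
    (hL : ∀ i, angMom (c i) = L) (hcQ : ∀ i, K.carter r₀ (c i) = Q)
    (hE : ∀ i, 0 < K.energy r₀ (c i)) (h1 : Tendsto (fun i => (c i).1.1) l (𝓝 R))
    (h2 : Tendsto (fun i => K.radVel r₀ (c i)) l (𝓝 y₁))
    (hD : K.b * (K.alpha r₀ R * L) + τ * y₁ = 0) :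
    Tendsto (fun i => τ * (c i).2.1) l atBot := by
  have hb := hK.b_pos
  have hdom := hs.mem_dom hK
  have hτ := hs.sq
  have hh := h_pos hK hdom
  have hfc := (hK.f_analyticAt hdom).continuousAt.tendsto.comp h1
  have hhc := (hK.h_analyticAt hdom).continuousAt.tendsto.comp h1
  have hac := ((contDiff_alpha (K := K) r₀ (n := 0)).continuous.tendsto R).comp h1
  have hdt : Tendsto (fun i => K.b * (K.alpha r₀ (c i).1.1 * L)
      - K.f (c i).1.1 * K.radVel r₀ (c i)) l (𝓝 0) := by
    have := ((hac.mul_const L).const_mul K.b).sub (hfc.mul h2)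
    rw [hs.f_eq hK, show K.b * (K.alpha r₀ R * L) - -τ * y₁
      = K.b * (K.alpha r₀ R * L) + τ * y₁ by ring, hD] at this
    exact this
  have hnt : Tendsto (fun i => K.b * (K.h (c i).1.1 * K.b ^ 2 * (K.alpha r₀ (c i).1.1 * L) ^ 2
      + K.f (c i).1.1 ^ 2 * Q)) l
      (𝓝 (K.b * (K.h R * K.b ^ 2 * (K.alpha r₀ R * L) ^ 2 + K.f R ^ 2 * Q))) :=
    (((hhc.mul_const (K.b ^ 2)).mul ((hac.mul_const L).pow 2)).add
      ((hfc.pow 2).mul_const Q)).const_mul K.b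
  have hN : 0 < K.b * (K.h R * K.b ^ 2 * (K.alpha r₀ R * L) ^ 2 + K.f R ^ 2 * Q) := by
    rw [hs.f_eq hK, neg_sq, pow_two τ, hτ]; positivity
  have hmul : ∀ i, K.energy r₀ (c i) * (K.b * (K.alpha r₀ (c i).1.1 * L)
      - K.f (c i).1.1 * K.radVel r₀ (c i)) = K.b * (K.h (c i).1.1 * K.b ^ 2 *
        (K.alpha r₀ (c i).1.1 * L) ^ 2 + K.f (c i).1.1 ^ 2 * Q) := by
    intro i
    have := energy_mul hK (hc i)
    rwa [hL i, hcQ i] at this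
  have hpos : ∀ᶠ i in l, 0 < K.b * (K.alpha r₀ (c i).1.1 * L)
      - K.f (c i).1.1 * K.radVel r₀ (c i) := by
    filter_upwards [hnt.eventually (lt_mem_nhds hN)] with i hi
    rw [← hmul i] at hi
    exact (mul_pos_iff_of_pos_left (hE i)).1 hi
  have hEt : Tendsto (fun i => K.energy r₀ (c i)) l atTop := by
    have hinv := (tendsto_nhdsWithin_iff.2 ⟨hdt, hpos⟩ : Tendsto _ l (𝓝[>] (0 : ℝ))).inv_tendsto_nhdsGT_zero
    refine (hinv.atTop_mul_pos hN hnt).congr' ?_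
    filter_upwards [hpos] with i hi
    rw [← hmul i, Pi.inv_apply, mul_comm (K.energy r₀ (c i)), inv_mul_cancel_left₀ hi.ne']
  have hτf : Tendsto (fun i => τ * K.f (c i).1.1) l (𝓝 (-1)) := by
    have := hfc.const_mul τ
    rw [hs.f_eq hK, show τ * -τ = -1 by linarith] at this
    exact this
  have hfE : Tendsto (fun i => K.energy r₀ (c i) * (τ * K.f (c i).1.1)) l atBot :=
    hEt.atTop_mul_neg (by norm_num) hτf
  have hrest : Tendsto (fun i => τ * (K.b * K.h (c i).1.1 * K.radVel r₀ (c i))) l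
      (𝓝 (τ * (K.b * K.h R * y₁))) := (((hhc.const_mul K.b).mul h2)).const_mul τ
  refine ((hfE.atBot_add hrest).atBot_mul_const (inv_pos.2 hb)).congr fun i => ?_
  have := b_mul_xi hK (hc i)
  rw [show K.energy r₀ (c i) * (τ * K.f (c i).1.1) + τ * (K.b * K.h (c i).1.1 * K.radVel r₀ (c i))
    = τ * (K.b * (c i).2.1) by rw [this]; ring]
  field_simp

/-- Past directed lines tend to the fiber infinity of the conormal bundle of a horizon. -/
theorem Data.IsMaxFlowLine.forward_infinity (hK : K.Subextremal) (hr₀ : r₀ ∈ Icc K.re K.rc)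
    (hs : K.IsSide R τ) (hγ : K.IsMaxFlowLine r₀ γ I) (hQ : ∀ s ∈ I, 0 < K.carter r₀ (γ s))
    (hE : ∀ s ∈ I, 0 < K.energy r₀ (γ s)) (hside : ∀ s ∈ I, 0 < τ * (r₀ - (γ s).1.1)) :
    Tendsto (fun s : I => (γ s).1.1) atTop (𝓝 R) ∧
      Tendsto (fun s : I => τ * (γ s).2.1) atTop atBot := by
  have hline := hγ.1
  obtain ⟨s₀, hs₀⟩ := hline.connected.nonempty
  have : Nonempty I := ⟨⟨s₀, hs₀⟩⟩
  have hτ := hs.sq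
  obtain ⟨hb, r₁, y₁, a1, a2, hr₁⟩ := hγ.forward_limit hK hr₀ hs (hQ s₀ hs₀)
    (fun s hsI => hline.angMom_eq hsI hs₀) (fun s hsI => hline.carter_eq hK hsI hs₀) hside
  rcases hr₁ with rfl | ⟨rfl, hD⟩
  -- Beyond the horizon a line with E > 0 has τY > 0, so τr increases and cannot tend to its
  -- infimum, attained at the boundary.
  · exfalso
    have hlt : τ * (R - τ * K.δ) < τ * R := by
      have : τ * (τ * K.δ) = K.δ := by linear_combination K.δ * hτ
      have := hK.δ_pos
      linarith
    obtain ⟨⟨s₁, hs₁⟩, hev⟩ := eventually_atTop.1 ((a1.const_mul τ).eventually (gt_mem_nhds hlt))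
    have hmono := hline.monotoneOn_radius hK (κ := τ) (s₁ := s₁) fun s hsI hlt =>
      (radVel_pos_outside hK hs (hline.mem s hsI) (hQ s hsI) (hE s hsI)
        (by linarith [hev ⟨s, hsI⟩ hlt.le])).le
    have h3 : τ * (γ s₁).1.1 ≤ τ * (R - τ * K.δ) := by
      refine ge_of_tendsto (a1.const_mul τ) ?_
      filter_upwards [eventually_ge_atTop (⟨s₁, hs₁⟩ : I)] with s hss
      exact hmono ⟨hs₁, self_mem_Ici⟩ ⟨s.2, hss⟩ hss
    have hm : (γ s₁).1.1 ∈ K.dom := (hline.mem s₁ hs₁).1.1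
    rcases hs with ⟨rfl, rfl⟩ | ⟨rfl, rfl⟩
    · linarith [hm.1]
    · linarith [hm.2]
  · exact ⟨a1, xi_tendsto_atBot hK hs (hQ s₀ hs₀) (fun s => hline.mem s s.2)
      (fun s => hline.angMom_eq s.2 hs₀) (fun s => hline.carter_eq hK s.2 hs₀)
      (fun s => hE s s.2) a1 a2 hD⟩

theorem Data.IsMaxFlowLine.backward_infinity (hK : K.Subextremal) (hr₀ : r₀ ∈ Icc K.re K.rc)
    (hs : K.IsSide R τ) (hγ : K.IsMaxFlowLine r₀ γ I) (hQ : ∀ s ∈ I, 0 < K.carter r₀ (γ s))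
    (hE : ∀ s ∈ I, K.energy r₀ (γ s) < 0) (hside : ∀ s ∈ I, 0 < τ * (r₀ - (γ s).1.1)) :
    Tendsto (fun s : I => (γ s).1.1) atBot (𝓝 R) ∧
      Tendsto (fun s : I => τ * (γ s).2.1) atBot atTop := by
  obtain ⟨h1, h2⟩ := hγ.rev.forward_infinity hK hr₀ hs (fun s hsI => by
      rw [KdS.rev, carter_flip]; exact hQ _ hsI)
    (fun s hsI => by rw [KdS.rev, energy_flip]; linarith [hE _ hsI]) (fun s hsI => hside _ hsI)
  refine ⟨tendsto_neg_atTop_iff (g := fun s => (γ s).1.1).1 h1, ?_⟩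
  have h3 : Tendsto (fun s : (-I : Set ℝ) => τ * (γ (-s)).2.1) atTop atTop := by
    refine (tendsto_neg_atBot_atTop.comp h2).congr fun s => ?_
    simp [KdS.rev, flip]
  exact tendsto_neg_atTop_iff (g := fun s => τ * (γ s).2.1).1 h3

theorem Data.IsMaxFlowLine.backward_radius (hK : K.Subextremal) (hr₀ : r₀ ∈ Icc K.re K.rc)
    (hs : K.IsSide R τ) (hγ : K.IsMaxFlowLine r₀ γ I) (hQ : ∀ s ∈ I, 0 < K.carter r₀ (γ s))
    (hE : ∀ s ∈ I, 0 < K.energy r₀ (γ s)) (hside : ∀ s ∈ I, 0 < τ * (r₀ - (γ s).1.1)) :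
    StartsAtRadius (R - τ * K.δ) γ I := by
  obtain ⟨h1, h2⟩ := hγ.rev.forward_radius hK hr₀ hs (fun s hsI => by
      rw [KdS.rev, carter_flip]; exact hQ _ hsI)
    (fun s hsI => by rw [KdS.rev, energy_flip]; linarith [hE _ hsI]) (fun s hsI => hside _ hsI)
  exact ⟨bddAbove_neg.1 h1, tendsto_neg_atTop_iff (g := fun s => (γ s).1.1).1 h2⟩

/-! ### Convergence to fiber infinity -/

/-- The part of a set of covectors on which `ξ_r` has the sign `ς`. -/
def signPart (ς : ℝ) (S : Set Phase) : Set Phase := {q | q ∈ S ∧ 0 < ς * q.2.1}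

theorem posPart_eq (S : Set Phase) : posPart S = signPart 1 S := by simp [posPart, signPart]

theorem negPart_eq (S : Set Phase) : negPart S = signPart (-1) S := by simp [negPart, signPart]

theorem mem_signPart_unit {ς : ℝ} (hς : ς * ς = 1) (hR : R ∈ K.dom) {ω : V} (hω : ‖ω‖ = 1) :
    (((R, ω), (ς, 0)) : Phase) ∈ signPart ς (K.conormal R) ∩ {q | ‖q.2‖ = 1} := by
  have h1 : ς ≠ 0 := by rintro rfl; norm_num at hς
  have h2 : |ς| = 1 := by
    rcases mul_self_eq_one_iff.1 hς with rfl | rfl <;> norm_num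
  refine ⟨⟨⟨⟨hR, hω, by simp, by simp [h1]⟩, rfl, rfl⟩, by simp [hς]⟩, ?_⟩
  simp [Prod.norm_def, h2]

/-- The rescaled covector is compared with the unit conormal (ς, 0) at the point (R, ω) with the
same ω. Since η is bounded and ξ_r is not, convergence of ω is not needed. -/
theorem tendsToFiberInfinity_signPart {ι : Type*} {l : Filter ι} {c : ι → Phase} {ς M : ℝ}
    (hς : ς * ς = 1) (hR : R ∈ K.dom) (hc : ∀ i, c i ∈ K.cotangent)
    (h1 : Tendsto (fun i => (c i).1.1) l (𝓝 R))
    (h2 : Tendsto (fun i => ς * (c i).2.1) l atTop) (hM : ∀ i, ‖(c i).2.2‖ ≤ M) :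
    TendsToFiberInfinity (signPart ς (K.conormal R)) c l := by
  have habs : ∀ x : ℝ, 0 < ς * x → ‖x‖ = ς * x := by
    intro x hx
    rcases mul_self_eq_one_iff.1 hς with rfl | rfl
    · rw [Real.norm_eq_abs, abs_of_pos (by linarith)]; ring
    · rw [Real.norm_eq_abs, abs_of_neg (by linarith)]; ring
  have hnorm : ∀ᶠ i in l, 0 < ς * (c i).2.1 ∧ ‖(c i).2‖ = ς * (c i).2.1 := by
    filter_upwards [h2.eventually_gt_atTop 0, h2.eventually_ge_atTop M] with i hi1 hi2
    refine ⟨hi1, ?_⟩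
    rw [Prod.norm_def, habs _ hi1]
    exact max_eq_left ((hM i).trans hi2)
  refine ⟨h2.congr' ?_, ?_⟩
  · filter_upwards [hnorm] with i hi using hi.2.symm
  · have hb : Tendsto (fun i => max (dist (c i).1.1 R) (M * (ς * (c i).2.1)⁻¹)) l (𝓝 0) := by
      have e1 : Tendsto (fun i => dist (c i).1.1 R) l (𝓝 0) := by
        simpa using h1.dist (tendsto_const_nhds (x := R))
      have e2 : Tendsto (fun i => M * (ς * (c i).2.1)⁻¹) l (𝓝 0) := by
        simpa using (tendsto_inv_atTop_zero.comp h2).const_mul M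
      simpa using e1.max e2
    refine squeeze_zero' (Eventually.of_forall fun i => Metric.infDist_nonneg) ?_ hb
    filter_upwards [hnorm] with i hi
    refine (Metric.infDist_le_dist_of_mem (mem_signPart_unit hς hR (hc i).2.1)).trans ?_
    have hx : ‖(c i).2‖⁻¹ * (c i).2.1 = ς := by
      rw [hi.2]
      have hne : (c i).2.1 ≠ 0 := fun h => by rw [h] at hi; simp at hi
      have hς0 : ς ≠ 0 := by rintro rfl; norm_num at hς
      field_simp
      linarith
    have hy : dist (‖(c i).2‖⁻¹ • (c i).2) (ς, (0 : V)) ≤ M * (ς * (c i).2.1)⁻¹ := by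
      rw [Prod.dist_eq]
      refine max_le ?_ ?_
      · simp only [Prod.smul_fst, smul_eq_mul, hx, dist_self]
        have := (norm_nonneg _).trans (hM i)
        have := hi.1
        positivity
      · simp only [Prod.smul_snd, dist_zero_right, norm_smul, norm_inv, norm_norm]
        rw [hi.2, mul_comm]
        have := inv_pos.2 hi.1
        gcongr
        exact hM i
    rw [Prod.dist_eq, Prod.dist_eq]
    simp only [dist_self]
    refine max_le (max_le (le_max_left _ _) ?_) (hy.trans (le_max_right _ _))
    exact le_max_of_le_left dist_nonneg

theorem norm_le_of_carter (hK : K.Subextremal) (hr₀ : 0 < r₀) {q : Phase} (hq : q ∈ K.cotangent) :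
    ‖q.2.2‖ ≤ Real.sqrt (K.b / K.lowFac r₀ ^ 2 * K.carter r₀ q) := by
  refine Real.le_sqrt_of_sq_le ?_
  have hlow := carter_lower hK hr₀ hq
  have hb := hK.b_pos
  have hd0 := lowFac_pos (K := K) hr₀
  rw [div_mul_eq_mul_div, le_div_iff₀ (by positivity)]
  rw [div_mul_eq_mul_div, div_le_iff₀ hb] at hlow
  linarith

theorem Data.IsFlowLine.tendsToFiberInfinity (hK : K.Subextremal) (hr₀ : 0 < r₀)
    (h : K.IsFlowLine r₀ γ I) {ς : ℝ} (hς : ς * ς = 1) (hR : R ∈ K.dom) {l : Filter I}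
    (h1 : Tendsto (fun s : I => (γ s).1.1) l (𝓝 R))
    (h2 : Tendsto (fun s : I => ς * (γ s).2.1) l atTop) :
    TendsToFiberInfinity (signPart ς (K.conormal R)) (fun s : I => γ s) l := by
  obtain ⟨s₀, hs₀⟩ := h.connected.nonempty
  refine tendsToFiberInfinity_signPart (M := Real.sqrt (K.b / K.lowFac r₀ ^ 2 * K.carter r₀ (γ s₀)))
    hς hR (fun s => (h.mem s s.2).1) h1 h2 fun s => ?_
  rw [← h.carter_eq hK s.2 hs₀]
  exact norm_le_of_carter hK hr₀ (h.mem s s.2).1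

theorem Data.IsMaxFlowLine.future_directed (hK : K.Subextremal) (hr₀ : r₀ ∈ Icc K.re K.rc)
    (hs : K.IsSide R τ) (hγ : K.IsMaxFlowLine r₀ γ I) (hQ : ∀ s ∈ I, 0 < K.carter r₀ (γ s))
    (hE : ∀ s ∈ I, K.energy r₀ (γ s) < 0) (hside : ∀ s ∈ I, 0 < τ * (r₀ - (γ s).1.1)) :
    StartsAtInfinity (signPart τ (K.conormal R)) γ I ∧ EndsAtRadius (R - τ * K.δ) γ I := by
  obtain ⟨h1, h2⟩ := hγ.backward_infinity hK hr₀ hs hQ hE hside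
  exact ⟨hγ.1.tendsToFiberInfinity hK (hK.pos_of_mem hr₀) hs.sq (hs.mem_dom hK) h1 h2,
    hγ.forward_radius hK hr₀ hs hQ hE hside⟩

theorem Data.IsMaxFlowLine.past_directed (hK : K.Subextremal) (hr₀ : r₀ ∈ Icc K.re K.rc)
    (hs : K.IsSide R τ) (hγ : K.IsMaxFlowLine r₀ γ I) (hQ : ∀ s ∈ I, 0 < K.carter r₀ (γ s))
    (hE : ∀ s ∈ I, 0 < K.energy r₀ (γ s)) (hside : ∀ s ∈ I, 0 < τ * (r₀ - (γ s).1.1)) :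
    StartsAtRadius (R - τ * K.δ) γ I ∧ EndsAtInfinity (signPart (-τ) (K.conormal R)) γ I := by
  obtain ⟨h1, h2⟩ := hγ.forward_infinity hK hr₀ hs hQ hE hside
  refine ⟨hγ.backward_radius hK hr₀ hs hQ hE hside,
    hγ.1.tendsToFiberInfinity hK (hK.pos_of_mem hr₀) (by linarith [hs.sq]) (hs.mem_dom hK) h1 ?_⟩
  exact (tendsto_neg_atBot_atTop.comp h2).congr fun s => by simp

end Lines

/-! ### The conormal bundles of the horizons -/

section Conormal

variable {r₀ R τ : ℝ} {q : Phase}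

theorem conormal_subset_char (hK : K.Subextremal) (hs : K.IsSide R τ) :
    K.conormal R ⊆ K.Char r₀ := by
  rintro q ⟨h1, h2, h3⟩
  refine ⟨h1, ?_⟩
  simp [Data.radial, Data.carter, angSq, angMom, phiComp, h2, h3, hs.mu_zero hK]

/-- Positive definiteness gives η = 0, and the characteristic equation reduces to μξ_r² = 0 with ξ_r
≠ 0. This yields the dichotomy between conormal lines and lines with Q > 0. -/
theorem mem_conormal_of_carter_eq_zero (hK : K.Subextremal) (hr₀ : 0 < r₀) (hq : q ∈ K.Char r₀)
    (h0 : K.carter r₀ q = 0) : q ∈ K.conormal K.re ∨ q ∈ K.conormal K.rc := by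
  have hη := (carter_eq_zero_iff hK hr₀ hq.1).1 h0
  have hξ : q.2.1 ≠ 0 := fun h => hq.1.2.2.2 (Prod.ext h hη)
  have h2 := hq.2
  rw [h0] at h2
  simp only [Data.radial, angMom, phiComp, hη, PiLp.zero_apply, mul_zero, sub_zero, zero_mul,
    ne_eq, OfNat.ofNat_ne_zero, not_false_eq_true, zero_pow, add_zero] at h2
  have hmu : K.mu q.1.1 = 0 := by
    rcases mul_eq_zero.1 h2 with h | h
    · exact h
    · exact absurd (pow_eq_zero_iff two_ne_zero |>.1 h) hξ
  rcases (hK.mu_eq_zero_iff (hK.rC_lt_of_dom hq.1.1)).1 hmu with h | h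
  · exact Or.inl ⟨hq.1, h, hη⟩
  · exact Or.inr ⟨hq.1, h, hη⟩

theorem carter_eq_zero_of_mem_conormal (hq : q ∈ K.conormal R) : K.carter r₀ q = 0 := by
  simp [Data.carter, angSq, angMom, phiComp, hq.2.2]

end Conormal

/-! ### The Hamilton vector field off the characteristic set -/

/-- The Hamilton vector field on the cotangent bundle. -/
def Data.hamField (K : Data) (r₀ : ℝ) (q : Phase) : Phase :=
  K.flow r₀ q + (K.psym r₀ q / K.rho2 q.1.1 q.1.2) • K.offChar q

/-- The estimate defining a normal source is required on a neighbourhood in the whole cotangent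
bundle, so the correction by p cannot be dropped there. -/
theorem ham_of_cotangent (hK : K.Subextremal) {r₀ : ℝ} (hr₀ : 0 < r₀) (A : Pt → ℂ) (σ : ℂ)
    {q : Phase} (hq : q ∈ K.cotangent) : ham (K.symb r₀ A σ) q = K.hamField r₀ q := by
  obtain ⟨h1, h2⟩ := dot_of_cotangent hq
  exact ham_symb hK hr₀ A σ hq.1 h1 h2

theorem fcarter_add_smul (r₀ : ℝ) (q v w : Phase) (x : ℝ) :
    K.fcarter r₀ q (v + x • w) = K.fcarter r₀ q v + x * K.fcarter r₀ q w := by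
  simp [Data.fcarter, dot, phiComp]; ring

theorem fcarter_offChar (r₀ : ℝ) {q : Phase} (hω : dot q.1.2 q.1.2 = 1) (hη : dot q.1.2 q.2.2 = 0) :
    K.fcarter r₀ q (K.offChar q) = 4 * K.a ^ 2 * K.c q.1.2 * q.1.2 2 * q.2.2 2 := by
  unfold Data.fcarter
  rw [hω, hη]
  generalize K.c q.1.2 = c
  generalize K.kap r₀ (q.1.2 2 ^ 2) = k
  unfold dot at hω hη
  simp [Data.offChar, e3, dot, phiComp]
  linear_combination (-4 * K.a ^ 2 * c * q.1.2 2 ^ 2) * hη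

section Curve

variable (hK : K.Subextremal) {r₀ : ℝ} {c : ℝ → Phase} {s : ℝ}
  (h : HasDerivAt c (K.hamField r₀ (c s)) s)
include h

theorem hasDerivAt_xi_ham : HasDerivAt (fun s => (c s).2.1)
    ((-K.dradial r₀ (c s) + 2 * (c s).1.1 * K.psym r₀ (c s)) / K.rho2 (c s).1.1 (c s).1.2) s := by
  have h1 : HasDerivAt (fun s => (c s).2.1) (K.hamField r₀ (c s)).2.1 s := h.snd.fst
  refine h1.congr_deriv ?_
  simp [Data.hamField, Data.flow, Data.offChar]; ring

include hK

theorem hasDerivAt_carter_ham (hq : c s ∈ K.cotangent) : HasDerivAt (fun s => K.carter r₀ (c s))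
    (K.psym r₀ (c s) / K.rho2 (c s).1.1 (c s).1.2
      * (4 * K.a ^ 2 * K.c (c s).1.2 * (c s).1.2 2 * (c s).2.2 2)) s := by
  obtain ⟨h1, h2⟩ := dot_of_cotangent hq
  refine (hasDerivAt_carter hK r₀ h).congr_deriv ?_
  rw [Data.hamField, fcarter_add_smul, fcarter_flow r₀ h1, fcarter_offChar r₀ h1 h2, zero_add]

/-- A symbol is constant along its own Hamilton flow. Carter's constant, by contrast, is conserved
only up to a multiple of p. -/
theorem hasDerivAt_psym_ham (hq : c s ∈ K.cotangent) :
    HasDerivAt (fun s => K.psym r₀ (c s)) 0 s := by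
  obtain ⟨h1, h2⟩ := dot_of_cotangent hq
  have hρ := (hK.rho2_pos hq.1 (c s).1.2).ne'
  have hr : HasDerivAt (fun s => (c s).1.1) (K.hamField r₀ (c s)).1.1 s := h.fst.fst
  have hz := hasDerivAt_coord h.fst.snd 2
  have hd := ((hasDerivAt_radial hK r₀ h hq.1).add (hasDerivAt_carter_ham hK h hq)).div
    ((hr.pow 2).add ((hz.pow 2).const_mul (K.a ^ 2))) hρ
  refine HasDerivAt.congr_deriv hd ?_
  have e1 : phiComp (K.hamField r₀ (c s)).1.2 (c s).2.2 +
      phiComp (c s).1.2 (K.hamField r₀ (c s)).2.2 = 0 := by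
    have := angMom_flow (K := K) r₀ (c s)
    have e : ∀ x : ℝ, phiComp (c s).1.2 ((x • K.offChar (c s)).2.2) = 0 := by
      intro x; simp [Data.offChar, phiComp, e3]; ring
    have e' : ∀ x : ℝ, phiComp ((x • K.offChar (c s)).1.2) (c s).2.2 = 0 := by
      intro x; simp [Data.offChar, phiComp]
    have a1 : ∀ u v w : V, phiComp (u + v) w = phiComp u w + phiComp v w := by
      intro u v w; simp [phiComp]; ring
    have a2 : ∀ u v w : V, phiComp w (u + v) = phiComp w u + phiComp w v := by
      intro u v w; simp [phiComp]; ring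
    unfold Data.hamField
    simp only [Prod.fst_add, Prod.snd_add] at *
    rw [a1, a2, e, e']
    linarith
  rw [e1]
  have v1 : (K.hamField r₀ (c s)).1.1 = 2 * K.radVel r₀ (c s) / K.rho2 (c s).1.1 (c s).1.2 := by
    simp [Data.hamField, Data.flow, Data.offChar]; ring
  have v2 : (K.hamField r₀ (c s)).2.1 = (-K.dradial r₀ (c s) + 2 * (c s).1.1 * K.psym r₀ (c s))
      / K.rho2 (c s).1.1 (c s).1.2 := by
    simp [Data.hamField, Data.flow, Data.offChar]; ring
  have v3 : (K.hamField r₀ (c s)).1.2 2 = 2 * K.c (c s).1.2 * (c s).2.2 2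
      / K.rho2 (c s).1.1 (c s).1.2 := by
    simp [Data.hamField, Data.flow, Data.offChar, dPhi, h1, h2]; ring
  have hp : K.radial r₀ (c s) + K.carter r₀ (c s)
      = K.psym r₀ (c s) * K.rho2 (c s).1.1 (c s).1.2 := by
    unfold Data.psym; field_simp
  simp only [Pi.add_apply, Pi.pow_apply]
  rw [v1, v2, v3]
  have e2 : (c s).1.1 ^ 2 + K.a ^ 2 * (c s).1.2 2 ^ 2 = K.rho2 (c s).1.1 (c s).1.2 := rfl
  rw [e2, hp]
  field_simp
  push_cast
  ring

/-- The derivative along the flow of the quadratic defining function. -/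
theorem hasDerivAt_quadratic_ham (hq : c s ∈ K.cotangent) (hξ : (c s).2.1 ≠ 0) (N : ℝ) :
    HasDerivAt (fun s => K.carter r₀ (c s) / (c s).2.1 ^ 2 + N * (K.psym r₀ (c s) / (c s).2.1 ^ 2) ^ 2)
      (2 * (c s).2.1 * ((K.dradial r₀ (c s) - 2 * (c s).1.1 * K.psym r₀ (c s))
          / (K.rho2 (c s).1.1 (c s).1.2 * (c s).2.1 ^ 2))
          * (K.carter r₀ (c s) / (c s).2.1 ^ 2 + 2 * N * (K.psym r₀ (c s) / (c s).2.1 ^ 2) ^ 2)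
        + K.psym r₀ (c s) / (c s).2.1 ^ 2 / K.rho2 (c s).1.1 (c s).1.2
          * (4 * K.a ^ 2 * K.c (c s).1.2 * (c s).1.2 2 * (c s).2.2 2)) s := by
  have hρ := (hK.rho2_pos hq.1 (c s).1.2).ne'
  have hx := (hasDerivAt_xi_ham h).pow 2
  have hne : (c s).2.1 ^ 2 ≠ 0 := pow_ne_zero 2 hξ
  have hd := ((hasDerivAt_carter_ham hK h hq).div hx hne).add
    ((((hasDerivAt_psym_ham hK h hq).div hx hne).pow 2).const_mul N)
  refine HasDerivAt.congr_deriv hd ?_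
  simp only [Pi.pow_apply, Pi.div_apply, Nat.add_one_sub_one, pow_one, Nat.cast_ofNat]
  field_simp
  ring

end Curve

theorem hasDerivAt_line_ham (r₀ : ℝ) (q : Phase) :
    HasDerivAt (fun s : ℝ => q + s • K.hamField r₀ q)
      (K.hamField r₀ ((fun s : ℝ => q + s • K.hamField r₀ q) 0)) 0 := by
  have := hasDerivAt_line q (K.hamField r₀ q)
  simpa using this

/-! ### Homogeneity -/

section Homogeneity

variable (q : Phase) (t r₀ : ℝ)

theorem angMom_smul : angMom (q.1, t • q.2) = t * angMom q := by
  simp [angMom, phiComp]; ring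

theorem carter_smul : K.carter r₀ (q.1, t • q.2) = t ^ 2 * K.carter r₀ q := by
  unfold Data.carter; rw [angMom_smul]; simp [angSq]; ring

theorem radial_smul : K.radial r₀ (q.1, t • q.2) = t ^ 2 * K.radial r₀ q := by
  unfold Data.radial; rw [angMom_smul]; simp; ring

theorem dradial_smul : K.dradial r₀ (q.1, t • q.2) = t ^ 2 * K.dradial r₀ q := by
  unfold Data.dradial; rw [angMom_smul]; simp; ring

theorem psym_smul : K.psym r₀ (q.1, t • q.2) = t ^ 2 * K.psym r₀ q := by
  unfold Data.psym; rw [carter_smul, radial_smul]; ring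

end Homogeneity

theorem isConic_cotangent : IsConic K.cotangent := by
  rintro q ⟨h1, h2, h3, h4⟩ t ht
  exact ⟨h1, h2, by simp [inner_smul_right, h3], by simp [ht.ne', h4]⟩

theorem isConic_conormal (R : ℝ) : IsConic (K.conormal R) := by
  rintro q ⟨h1, h2, h3⟩ t ht
  exact ⟨isConic_cotangent q h1 t ht, h2, by simp [h3]⟩

theorem IsConic.signPart {S : Set Phase} (hS : IsConic S) (ς : ℝ) : IsConic (signPart ς S) := by
  rintro q ⟨h1, h2⟩ t ht
  refine ⟨hS q h1 t ht, ?_⟩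
  have : 0 < t * (ς * q.2.1) := mul_pos ht h2
  simpa [mul_left_comm] using this

/-! ### Invariance and radiality of the conormal bundles -/

section Radial

variable {r₀ R τ : ℝ} {γ : ℝ → Phase} {I : Set ℝ}

theorem xi_ne_zero_of_conormal {q : Phase} (hq : q ∈ K.conormal R) : q.2.1 ≠ 0 := fun h =>
  hq.1.2.2.2 (Prod.ext h hq.2.2)

/-- Conservation of Q = 0 keeps η = 0 and μ = 0; then Y = 0 and the radius is constant. -/
theorem Data.IsFlowLine.mem_conormal (hK : K.Subextremal) (hr₀ : 0 < r₀)
    (h : K.IsFlowLine r₀ γ I) {s : ℝ} (hs : s ∈ I) (hm : γ s ∈ K.conormal R) :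
    ∀ t ∈ I, γ t ∈ K.conormal R := by
  have hQ : ∀ t ∈ I, K.carter r₀ (γ t) = 0 := fun t ht => by
    rw [h.carter_eq hK ht hs]; exact carter_eq_zero_of_mem_conormal hm
  have hη : ∀ t ∈ I, (γ t).2.2 = 0 := fun t ht =>
    (carter_eq_zero_iff hK hr₀ (h.mem t ht).1).1 (hQ t ht)
  have hmu : ∀ t ∈ I, K.mu (γ t).1.1 = 0 := by
    intro t ht
    rcases mem_conormal_of_carter_eq_zero hK hr₀ (h.mem t ht) (hQ t ht) with h1 | h1
    · rw [h1.2.1]; exact hK.mu_re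
    · rw [h1.2.1]; exact hK.mu_rc
  intro t ht
  refine ⟨(h.mem t ht).1, ?_, hη t ht⟩
  rw [← hm.2.1]
  refine eq_of_hasDerivAt_zero (g := fun s => (γ s).1.1) h.isOpen h.connected.isPreconnected
    (fun u hu => ?_) ht hs
  refine (hasDerivAt_r_flow (h.deriv u hu)).congr_deriv ?_
  simp [Data.radVel, hmu u hu, angMom, phiComp, hη u hu]

theorem Data.IsFlowLine.mem_signPart (hK : K.Subextremal) (hr₀ : 0 < r₀)
    (h : K.IsFlowLine r₀ γ I) {s ς : ℝ} (hs : s ∈ I) (hm : γ s ∈ signPart ς (K.conormal R)) :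
    ∀ t ∈ I, γ t ∈ signPart ς (K.conormal R) := by
  have hc := h.mem_conormal hK hr₀ hs hm.1
  have hς : ς ≠ 0 := by
    rintro rfl
    have := hm.2
    simp at this
  rcases forall_pos_or_forall_neg (g := fun s => ς * (γ s).2.1) h.connected
    (fun t ht => ((continuous_snd.fst.continuousAt.comp
      (h.continuousAt ht)).const_smul ς).continuousWithinAt)
    (fun t ht => mul_ne_zero hς (xi_ne_zero_of_conormal (hc t ht))) with h1 | h1
  · exact fun t ht => ⟨hc t ht, h1 t ht⟩
  · exact absurd hm.2 (not_lt.2 (h1 s hs).le)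

/-- `|ξ_r|⁻¹` is a defining function of fiber infinity. -/
theorem isInfinityDefining_inv {U : Set Phase} (hU : ∀ q ∈ U, q.2.1 ≠ 0) :
    IsInfinityDefining U fun q => |q.2.1|⁻¹ := by
  refine ⟨fun q hq => ?_, fun q hq => ?_, fun q hq t ht => ?_⟩
  · have h1 : ContDiffAt ℝ ((⊤ : ℕ∞) : WithTop ℕ∞) (fun q : Phase => |q.2.1|) q :=
      ContDiffAt.comp q (g := fun x : ℝ => |x|) (contDiffAt_abs (hU q hq)) (by fun_prop)
    exact (h1.inv (abs_ne_zero.2 (hU q hq))).contDiffWithinAt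
  · exact inv_pos.2 (abs_pos.2 (hU q hq))
  · simp [abs_mul, abs_of_pos ht, mul_comm]

theorem fderiv_inv_abs {q : Phase} {ς : ℝ} (hς : ς * ς = 1) (hq : 0 < ς * q.2.1) (v : Phase) :
    fderiv ℝ (fun q : Phase => |q.2.1|⁻¹) q v = -(ς * v.2.1 / q.2.1 ^ 2) := by
  have hξ : q.2.1 ≠ 0 := by intro h; rw [h] at hq; simp at hq
  have hς0 : ς ≠ 0 := by rintro rfl; norm_num at hς
  have habs : ∀ x : ℝ, 0 < ς * x → |x| = ς * x := by
    intro x hx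
    rcases mul_self_eq_one_iff.1 hς with rfl | rfl
    · rw [abs_of_pos (by linarith)]; ring
    · rw [abs_of_neg (by linarith)]; ring
  have hev : (fun q : Phase => |q.2.1|⁻¹) =ᶠ[𝓝 q] fun q => (ς * q.2.1)⁻¹ := by
    have hc : Continuous fun q : Phase => ς * q.2.1 := by fun_prop
    filter_upwards [hc.continuousAt.eventually (lt_mem_nhds hq)] with x hx
    rw [habs _ hx]
  rw [hev.fderiv_eq]
  refine fderiv_apply_of_hasDerivAt (by fun_prop (disch := exact hq.ne')) ?_
  have h1 : HasDerivAt (fun s : ℝ => ς * (q + s • v).2.1) (ς * v.2.1) 0 :=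
    (show HasDerivAt (fun s : ℝ => (q + s • v).2.1) v.2.1 0 from
      (hasDerivAt_line q v).snd.fst).const_mul ς
  refine (h1.inv (by simpa using hq.ne')).congr_deriv ?_
  simp
  field_simp
  linear_combination v.2.1 * hς

variable (hK : K.Subextremal) (hr₀ : 0 < r₀) (hs : K.IsSide R τ) (A : Pt → ℂ) (σ : ℂ)
include hK hr₀ hs

/-- On the conormal bundle L = 0, and the equation for ξ_r reduces to ξ_r' = -μ'(R)ξ_r²/ρ². The sign
of the result is thus governed by the surface gravity. -/
theorem fderiv_inv_abs_ham {q : Phase} {ς : ℝ} (hς : ς * ς = 1)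
    (hq : q ∈ signPart ς (K.conormal R)) :
    fderiv ℝ (fun q : Phase => |q.2.1|⁻¹) q (ham (K.symb r₀ A σ) q)
      = ς * K.dmu R / K.rho2 R q.1.2 := by
  have hchar := conormal_subset_char (r₀ := r₀) hK hs hq.1
  have hξ := xi_ne_zero_of_conormal hq.1
  have hρ := hK.rho2_pos hq.1.1.1 q.1.2
  rw [hq.1.2.1] at hρ
  rw [fderiv_inv_abs hς hq.2, ham_of_char hK hr₀ A σ hchar]
  simp [Data.flow, Data.dradial, angMom, phiComp, hq.1.2.1, hq.1.2.2]
  field_simp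

theorem isGeneralizedRadial_conormal :
    IsGeneralizedRadial K.cotangent (K.symb r₀ A σ) (K.conormal R) := by
  refine ⟨by rw [charSet_symb hK hr₀]; exact conormal_subset_char hK hs, isConic_conormal R, ?_,
    {q | q.2.1 ≠ 0}, _, ?_, ?_, fun q hq => xi_ne_zero_of_conormal hq,
    isInfinityDefining_inv fun q hq => hq, ?_⟩
  · rintro γ I hγ ⟨s, hsI, hm⟩
    exact ((isBichar_iff hK hr₀ A σ γ I).1 hγ).mem_conormal hK hr₀ hsI hm
  · exact isOpen_ne_fun (by fun_prop) continuous_const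
  · intro q hq t ht
    simpa [ht.ne'] using hq
  · intro q hq
    have hξ := xi_ne_zero_of_conormal hq
    have hρ := hK.rho2_pos hq.1.1 q.1.2
    rw [hq.2.1] at hρ
    have hd : K.dmu R ≠ 0 := fun h => by have := hs.dmu_pos hK; rw [h] at this; simp at this
    rcases lt_or_gt_of_ne hξ with h | h
    · rw [fderiv_inv_abs_ham hK hr₀ hs A σ (ς := -1) (by norm_num) ⟨hq, by linarith⟩]
      exact div_ne_zero (mul_ne_zero (by norm_num) hd) hρ.ne'
    · rw [fderiv_inv_abs_ham hK hr₀ hs A σ (ς := 1) (by norm_num) ⟨hq, by linarith⟩]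
      exact div_ne_zero (mul_ne_zero (by norm_num) hd) hρ.ne'

theorem isGeneralizedRadial_signPart (ς : ℝ) :
    IsGeneralizedRadial K.cotangent (K.symb r₀ A σ) (signPart ς (K.conormal R)) := by
  obtain ⟨h1, h2, -, U, ρ, h4, h5, h6, h7, h8⟩ := isGeneralizedRadial_conormal hK hr₀ hs A σ
  refine ⟨fun q hq => h1 hq.1, h2.signPart ς, ?_, U, ρ, h4, h5, fun q hq => h6 hq.1, h7,
    fun q hq => h8 q hq.1⟩
  rintro γ I hγ ⟨s, hsI, hm⟩
  exact ((isBichar_iff hK hr₀ A σ γ I).1 hγ).mem_signPart hK hr₀ hsI hm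

end Radial

/-! ### Smoothness of the symbol -/

section Smooth

variable (hK : K.Subextremal) {r₀ : ℝ} {q : Phase} {n : WithTop ℕ∞}
include hK

theorem contDiff_carter : ContDiff ℝ n (K.carter r₀) := by
  have h0 : ∀ q : Phase, 1 + K.Λ * K.a ^ 2 / 3 * q.1.2 2 ^ 2 ≠ 0 := fun q => (hK.cz_pos _).ne'
  have hk : ContDiff ℝ n (fun q : Phase => K.kap r₀ (q.1.2 2 ^ 2)) := by
    unfold Data.kap
    refine ContDiff.div ?_ ?_ h0 <;> fun_prop
  unfold Data.carter Data.c angSq angMom phiComp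
  fun_prop

variable (hr : q.1.1 ∈ K.dom)
include hr

omit hK hr in
theorem contDiffAt_radius_comp {g : ℝ → ℝ} (hg : AnalyticAt ℝ g q.1.1) :
    ContDiffAt ℝ n (fun q : Phase => g q.1.1) q :=
  ContDiffAt.comp q (g := g) hg.contDiffAt (by fun_prop)

theorem contDiffAt_rho2_inv : ContDiffAt ℝ n (fun q : Phase => (K.rho2 q.1.1 q.1.2)⁻¹) q :=
  ContDiffAt.inv (by unfold Data.rho2; fun_prop) (hK.rho2_pos hr _).ne'

theorem contDiffAt_psym : ContDiffAt ℝ n (K.psym r₀) q := by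
  have hfa := contDiffAt_radius_comp (n := n) (hK.fa_analyticAt r₀ hr)
  have hha := contDiffAt_radius_comp (n := n) (hK.ha_analyticAt r₀ hr)
  have hmu : ContDiffAt ℝ n (fun q : Phase => K.mu q.1.1) q :=
    ContDiffAt.comp q (g := K.mu) contDiff_mu.contDiffAt (by fun_prop)
  have hL : ContDiffAt ℝ n angMom q := by unfold angMom phiComp; fun_prop
  have hR : ContDiffAt ℝ n (K.radial r₀) q := by
    rw [show K.radial r₀ = _ from funext fun q => radial_eq r₀ q]
    fun_prop
  have hC : ContDiffAt ℝ n (K.carter r₀) q := (contDiff_carter hK).contDiffAt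
  have hρ := contDiffAt_rho2_inv (n := n) hK hr
  unfold Data.psym
  simp only [div_eq_mul_inv]
  fun_prop

theorem contDiffAt_dradial : ContDiffAt ℝ n (K.dradial r₀) q := by
  have hfa := contDiffAt_radius_comp (n := n) (hK.fa_analyticAt r₀ hr).deriv
  have hha := contDiffAt_radius_comp (n := n) (hK.ha_analyticAt r₀ hr).deriv
  have hmu : ContDiffAt ℝ n (fun q : Phase => K.dmu q.1.1) q :=
    ContDiffAt.comp q (g := K.dmu) contDiff_dmu.contDiffAt (by fun_prop)
  have hL : ContDiffAt ℝ n angMom q := by unfold angMom phiComp; fun_prop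
  unfold Data.dradial
  fun_prop

end Smooth

/-! ### Normal sources and sinks -/

/-- The rate `-ξ_r' / ξ_r²`. -/
def Data.rate (K : Data) (r₀ : ℝ) (q : Phase) : ℝ :=
  (K.dradial r₀ q - 2 * q.1.1 * K.psym r₀ q) / (K.rho2 q.1.1 q.1.2 * q.2.1 ^ 2)

/-- The quadratic defining function of the conormal bundle of a horizon. -/
def Data.quadratic (K : Data) (r₀ N : ℝ) (q : Phase) : ℝ :=
  K.carter r₀ q / q.2.1 ^ 2 + N * (K.psym r₀ q / q.2.1 ^ 2) ^ 2

section Normal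

variable {r₀ R τ ς : ℝ}

theorem rate_smul (q : Phase) {t : ℝ} (ht : 0 < t) : K.rate r₀ (q.1, t • q.2) = K.rate r₀ q := by
  unfold Data.rate
  rw [dradial_smul, psym_smul]
  simp only [Prod.smul_fst, smul_eq_mul]
  rw [show t ^ 2 * K.dradial r₀ q - 2 * q.1.1 * (t ^ 2 * K.psym r₀ q)
    = t ^ 2 * (K.dradial r₀ q - 2 * q.1.1 * K.psym r₀ q) by ring,
    show K.rho2 q.1.1 q.1.2 * (t * q.2.1) ^ 2 = t ^ 2 * (K.rho2 q.1.1 q.1.2 * q.2.1 ^ 2) by ring,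
    mul_div_mul_left _ _ (by positivity)]

theorem carter_div_smul (q : Phase) {t : ℝ} (ht : 0 < t) :
    K.carter r₀ (q.1, t • q.2) / (q.1, t • q.2).2.1 ^ 2 = K.carter r₀ q / q.2.1 ^ 2 := by
  rw [carter_smul]
  simp only [Prod.smul_fst, smul_eq_mul, mul_pow]
  rw [mul_div_mul_left _ _ (by positivity)]

theorem quadratic_smul (N : ℝ) (q : Phase) {t : ℝ} (ht : 0 < t) :
    K.quadratic r₀ N (q.1, t • q.2) = K.quadratic r₀ N q := by
  unfold Data.quadratic
  rw [carter_div_smul q ht, psym_smul]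
  simp only [Prod.smul_fst, smul_eq_mul, mul_pow]
  rw [mul_div_mul_left _ _ (by positivity)]

theorem rho2_le (hK : K.Subextremal) {q : Phase} (hq : q ∈ K.cotangent) :
    K.rho2 q.1.1 q.1.2 ≤ (K.rc + K.δ) ^ 2 + K.a ^ 2 := by
  have hz := z_sq_le hq
  have hr0 := hK.pos_of_dom hq.1
  have hrlt : q.1.1 < K.rc + K.δ := hq.1.2
  unfold Data.rho2
  have : K.a ^ 2 * q.1.2 2 ^ 2 ≤ K.a ^ 2 * 1 := by gcongr
  have : q.1.1 ^ 2 ≤ (K.rc + K.δ) ^ 2 := by gcongr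
  linarith

theorem le_rho2 (hK : K.Subextremal) {q : Phase} (hq : q ∈ K.cotangent) :
    (K.re - K.δ) ^ 2 ≤ K.rho2 q.1.1 q.1.2 := by
  have h1 := hK.left_pos
  have h2 : K.re - K.δ < q.1.1 := hq.1.1
  unfold Data.rho2
  have : (K.re - K.δ) ^ 2 ≤ q.1.1 ^ 2 := by gcongr
  nlinarith [mul_nonneg (sq_nonneg K.a) (sq_nonneg (q.1.2 2))]

/-- Bounds for the coefficients of the symbol near a horizon. -/
theorem exists_bounds_near (hK : K.Subextremal) (r₀ : ℝ) (hs : K.IsSide R τ) :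
    ∃ ε > 0, ∃ m > 0, ∃ a₁ ≥ 0, ∃ a₂ ≥ 0, ∀ r, |r - R| < ε → r ∈ K.dom ∧
      m * |r - R| ≤ |K.mu r| ∧ |2 * K.b * K.fa r₀ r| ≤ a₁ ∧ |K.b ^ 2 * K.ha r₀ r| ≤ a₂ := by
  have hdom := hs.mem_dom hK
  have hd : K.dmu R ≠ 0 := fun h => by have := hs.dmu_pos hK; rw [h] at this; simp at this
  have h1 : ∀ᶠ r in 𝓝 R, r ∈ K.dom := isOpen_Ioo.mem_nhds hdom
  have h2 : ∀ᶠ r in 𝓝 R, |K.dmu R| / 2 * |r - R| ≤ |K.mu r| := by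
    have := (hasDerivAt_iff_isLittleO.1 (hasDerivAt_mu (K := K) R)).def
      (c := |K.dmu R| / 2) (by positivity)
    filter_upwards [this] with r hr
    rw [hs.mu_zero hK, sub_zero, smul_eq_mul, Real.norm_eq_abs, Real.norm_eq_abs] at hr
    have := abs_sub_abs_le_abs_sub ((r - R) * K.dmu R) (K.mu r)
    rw [abs_mul, abs_sub_comm _ (K.mu r)] at this
    linarith
  have h3 : ∀ᶠ r in 𝓝 R, |2 * K.b * K.fa r₀ r| ≤ |2 * K.b * K.fa r₀ R| + 1 := by
    have : ContinuousAt (fun r => |2 * K.b * K.fa r₀ r|) R :=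
      ((hK.fa_analyticAt r₀ hdom).continuousAt.const_smul (2 * K.b)).abs
    filter_upwards [this.eventually (gt_mem_nhds (lt_add_one _))] with r hr using hr.le
  have h4 : ∀ᶠ r in 𝓝 R, |K.b ^ 2 * K.ha r₀ r| ≤ |K.b ^ 2 * K.ha r₀ R| + 1 := by
    have : ContinuousAt (fun r => |K.b ^ 2 * K.ha r₀ r|) R :=
      ((hK.ha_analyticAt r₀ hdom).continuousAt.const_smul (K.b ^ 2)).abs
    filter_upwards [this.eventually (gt_mem_nhds (lt_add_one _))] with r hr using hr.le
  obtain ⟨ε, hε, hball⟩ := Metric.eventually_nhds_iff.1 (h1.and (h2.and (h3.and h4)))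
  exact ⟨ε, hε, |K.dmu R| / 2, by positivity, _, by positivity, _, by positivity, fun r hr =>
    hball (by rwa [Real.dist_eq])⟩

/-- Nondegeneracy of the quadratic defining function in the radial direction. -/
theorem exists_sq_radius_le (hK : K.Subextremal) (hr₀ : 0 < r₀) (hs : K.IsSide R τ) :
    ∃ ε > 0, ∃ C > 0, (∀ r, |r - R| < ε → r ∈ K.dom) ∧ ∀ q ∈ K.cotangent, |q.1.1 - R| < ε →
      q.2.1 ≠ 0 → K.carter r₀ q / q.2.1 ^ 2 ≤ 1 → ∀ N ≥ 1, (q.1.1 - R) ^ 2 ≤ C * K.quadratic r₀ N q := by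
  obtain ⟨ε, hε, m, hm, a₁, ha₁, a₂, ha₂, hbd⟩ := exists_bounds_near hK r₀ hs
  have hb := hK.b_pos
  have hd0 := lowFac_pos (K := K) hr₀
  set CL := K.b / K.lowFac r₀ ^ 2 with hCL
  have hCLpos : 0 < CL := by positivity
  set P := (K.rc + K.δ) ^ 2 + K.a ^ 2 with hP
  set G := 1 + a₁ * Real.sqrt CL + a₂ * CL with hG
  have hGpos : 0 < G := by positivity
  have hPpos : 0 < P := by have := hK.rc_pos; have := hK.δ_pos; positivity
  refine ⟨ε, hε, (2 * P ^ 2 + 2 * G ^ 2) / m ^ 2, by positivity, fun r hr => (hbd r hr).1,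
    fun q hq hqr hξ hQ1 N hN => ?_⟩
  obtain ⟨hdom, hmu, hA, hB⟩ := hbd _ hqr
  have hρ := hK.rho2_pos hdom q.1.2
  have hQ0 := carter_nonneg hK hr₀ hq
  set Qh := K.carter r₀ q / q.2.1 ^ 2 with hQh
  set p := K.psym r₀ q / q.2.1 ^ 2 with hp
  set l := angMom q / q.2.1 with hl
  have hξ2 : 0 < q.2.1 ^ 2 := by positivity
  have hQh0 : 0 ≤ Qh := by positivity
  have hl2 : l ^ 2 ≤ CL * Qh := by
    rw [hl, hQh, div_pow, ← mul_div_assoc]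
    gcongr
    exact angMom_sq_le_carter hK hr₀ hq
  -- The definition of p solved for μ, after division by ξ_r². Since μ has a simple zero at R, this
  -- bounds |r - R| by |p|/ξ_r² and √Q/|ξ_r|.
  have hmueq : K.mu q.1.1 = K.rho2 q.1.1 q.1.2 * p - Qh + 2 * K.b * K.fa r₀ q.1.1 * l
      + K.b ^ 2 * K.ha r₀ q.1.1 * l ^ 2 := by
    have h1 : K.radial r₀ q + K.carter r₀ q = K.psym r₀ q * K.rho2 q.1.1 q.1.2 := by
      unfold Data.psym; field_simp
    rw [radial_eq] at h1
    rw [hp, hQh, hl]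
    field_simp
    linarith
  -- As x ≤ 1, the terms quadratic in x are bounded by linear ones.
  set x := Real.sqrt Qh with hx
  have hx0 : 0 ≤ x := Real.sqrt_nonneg _
  have hx2 : x ^ 2 = Qh := Real.sq_sqrt hQh0
  have hx1 : x ≤ 1 := Real.sqrt_le_one.2 hQ1
  have hxx : x ^ 2 ≤ x := by nlinarith
  have hlabs : |l| ≤ Real.sqrt CL * x := by
    rw [hx, ← Real.sqrt_mul hCLpos.le]
    exact Real.abs_le_sqrt hl2
  have hbound : |K.mu q.1.1| ≤ P * |p| + G * x := by
    have t1 : |K.rho2 q.1.1 q.1.2 * p| ≤ P * |p| := by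
      rw [abs_mul, abs_of_pos hρ]
      gcongr
      exact rho2_le hK hq
    have t2 : |2 * K.b * K.fa r₀ q.1.1 * l| ≤ a₁ * (Real.sqrt CL * x) := by
      rw [abs_mul]; gcongr
    have t3 : |K.b ^ 2 * K.ha r₀ q.1.1 * l ^ 2| ≤ a₂ * (CL * x) := by
      rw [abs_mul, abs_of_nonneg (sq_nonneg l)]
      gcongr
      calc l ^ 2 ≤ CL * Qh := hl2
        _ ≤ CL * x := by rw [← hx2]; gcongr
    have t4 : |Qh| ≤ x := by rw [abs_of_nonneg hQh0, ← hx2]; exact hxx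
    rw [hmueq]
    calc _ ≤ |K.rho2 q.1.1 q.1.2 * p - Qh + 2 * K.b * K.fa r₀ q.1.1 * l|
          + |K.b ^ 2 * K.ha r₀ q.1.1 * l ^ 2| := abs_add_le _ _
      _ ≤ |K.rho2 q.1.1 q.1.2 * p - Qh| + |2 * K.b * K.fa r₀ q.1.1 * l|
          + |K.b ^ 2 * K.ha r₀ q.1.1 * l ^ 2| := by gcongr; exact abs_add_le _ _
      _ ≤ |K.rho2 q.1.1 q.1.2 * p| + |Qh| + |2 * K.b * K.fa r₀ q.1.1 * l|
          + |K.b ^ 2 * K.ha r₀ q.1.1 * l ^ 2| := by gcongr; exact abs_sub _ _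
      _ ≤ P * |p| + x + a₁ * (Real.sqrt CL * x) + a₂ * (CL * x) := by gcongr
      _ = _ := by rw [hG]; ring
  have h1 : m * |q.1.1 - R| ≤ P * |p| + G * x := hmu.trans hbound
  have h2 : (m * |q.1.1 - R|) ^ 2 ≤ (P * |p| + G * x) ^ 2 := by gcongr
  have h3 : (P * |p| + G * x) ^ 2 ≤ 2 * P ^ 2 * p ^ 2 + 2 * G ^ 2 * Qh := by
    have := add_sq_le (a := P * |p|) (b := G * x)
    rw [mul_pow, mul_pow, sq_abs, hx2] at this
    linarith
  have h4 : 2 * P ^ 2 * p ^ 2 + 2 * G ^ 2 * Qh ≤ (2 * P ^ 2 + 2 * G ^ 2) * K.quadratic r₀ N q := by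
    have e : K.quadratic r₀ N q = Qh + N * p ^ 2 := rfl
    have e1 : p ^ 2 ≤ N * p ^ 2 := le_mul_of_one_le_left (sq_nonneg p) hN
    have e2 : p ^ 2 ≤ K.quadratic r₀ N q := by rw [e]; linarith
    have e3 : Qh ≤ K.quadratic r₀ N q := by rw [e]; linarith [sq_nonneg p]
    rw [add_mul]
    gcongr
  rw [div_mul_eq_mul_div, le_div_iff₀ (by positivity)]
  rw [mul_pow, sq_abs] at h2
  linarith

theorem source_identity {ξ k Q N p ρ a c z η : ℝ} (hς : ς * ς = 1) (hξ : ξ ≠ 0) (hρ : ρ ≠ 0) :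
    ς * τ * (ς * ξ⁻¹ * (2 * ξ * k * (Q + 2 * N * p ^ 2) + p / ρ * (4 * a ^ 2 * c * z * η)))
      = 2 * (τ * k) * (Q + 2 * N * p ^ 2) + τ * (p * (4 * a ^ 2 * c * z * (η / ξ) / ρ)) := by
  field_simp
  linear_combination (2 * τ * k * ξ * ρ * (Q + 2 * N * p ^ 2) + τ * p * 4 * a ^ 2 * c * z * η) * hς

/-- The leading terms grow at rate at least 2λ. Half of this absorbs the cross term by the
arithmetic-geometric mean inequality, and N is chosen so that the p² term is large enough for it. -/
theorem source_inequality {lam M N Q p x w k : ℝ} (hlam : 0 < lam) (hτ : τ * τ = 1)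
    (hN : N = M ^ 2 / (4 * lam ^ 2) + 1) (hk : lam ≤ τ * k) (hx2 : x ^ 2 = Q)
    (hw : |w| ≤ M * x) :
    lam * (Q + N * p ^ 2) ≤ 2 * (τ * k) * (Q + 2 * N * p ^ 2) + τ * (p * w) := by
  have hN0 : 0 ≤ N := by rw [hN]; positivity
  have hQ0 : 0 ≤ Q := by rw [← hx2]; positivity
  have hcross : -(M * (|p| * x)) ≤ τ * (p * w) := by
    have h1 : |τ * (p * w)| ≤ M * (|p| * x) := by
      have hτ1 : |τ| = 1 := by rcases mul_self_eq_one_iff.1 hτ with rfl | rfl <;> norm_num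
      rw [abs_mul, abs_mul, hτ1, one_mul]
      calc |p| * |w| ≤ |p| * (M * x) := by gcongr
        _ = _ := by ring
    linarith [neg_abs_le (τ * (p * w))]
  have hmain : 2 * lam * (Q + 2 * N * p ^ 2) ≤ 2 * (τ * k) * (Q + 2 * N * p ^ 2) := by gcongr
  have hamgm : M * (|p| * x) ≤ lam * Q + lam * N * p ^ 2 := by
    have h1 : lam * N * p ^ 2 = M ^ 2 / (4 * lam) * |p| ^ 2 + lam * |p| ^ 2 := by
      rw [hN, sq_abs]; field_simp
    have h2 : 0 ≤ lam * |p| ^ 2 := by positivity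
    have h3 : 0 ≤ lam * (x - M / (2 * lam) * |p|) ^ 2 := by positivity
    have h4 : lam * (x - M / (2 * lam) * |p|) ^ 2
        = lam * x ^ 2 - M * (|p| * x) + M ^ 2 / (4 * lam) * |p| ^ 2 := by
      field_simp; ring
    rw [← hx2]
    linarith
  have h5 : 0 ≤ lam * N * p ^ 2 := by positivity
  linarith

theorem isNormalSourceSink_signPart (hK : K.Subextremal) (hr₀ : 0 < r₀) (hs : K.IsSide R τ)
    (A : Pt → ℂ) (σ : ℂ) (hς : ς * ς = 1) :
    IsNormalSourceSink (ς * τ) K.cotangent (K.symb r₀ A σ) (signPart ς (K.conormal R)) := by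
  refine ⟨isGeneralizedRadial_signPart hK hr₀ hs A σ ς, ?_⟩
  obtain ⟨ε, hε, C, hC, hdom, hnd⟩ := exists_sq_radius_le hK hr₀ hs
  have hτ := hs.sq
  have hdmu := hs.dmu_pos hK
  have hb := hK.b_pos
  have hd0 := lowFac_pos (K := K) hr₀
  set CL := K.b / K.lowFac r₀ ^ 2 with hCL
  have hCLpos : 0 < CL := by positivity
  set P := (K.rc + K.δ) ^ 2 + K.a ^ 2 with hP
  have hPpos : 0 < P := by have := hK.rc_pos; have := hK.δ_pos; positivity
  -- On the conormal bundle the rate times τ is τμ'(R)/ρ² ≥ τμ'(R)/P. Half of this lower bound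
  -- persists in a neighbourhood.
  set lam := τ * K.dmu R / (2 * P) with hlam
  have hlampos : 0 < lam := by positivity
  have hleft := hK.left_pos
  -- A bound for the coefficient of the cross term, using c ≤ b, |cos θ| ≤ 1, ρ² ≥ (r_e - δ)² and
  -- the bound of η by Carter's constant.
  set M := 4 * K.a ^ 2 * K.b * Real.sqrt CL / (K.re - K.δ) ^ 2 with hM
  set N := M ^ 2 / (4 * lam ^ 2) + 1 with hN
  have hN1 : 1 ≤ N := by
    have : 0 ≤ M ^ 2 / (4 * lam ^ 2) := by positivity
    linarith
  have hς0 : ς ≠ 0 := by rintro rfl; norm_num at hς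
  set O : Set Phase := {q | 0 < ς * q.2.1 ∧ |q.1.1 - R| < ε} with hO
  have hOξ : ∀ q ∈ O, q.2.1 ≠ 0 := by
    intro q hq h
    have := hq.1
    rw [h] at this; simp at this
  have hOopen : IsOpen O := by
    have h1 : IsOpen {q : Phase | 0 < ς * q.2.1} := isOpen_lt continuous_const (by fun_prop)
    have h2 : IsOpen {q : Phase | |q.1.1 - R| < ε} := isOpen_lt (by fun_prop) continuous_const
    exact h1.inter h2
  have hrate : ContinuousOn (K.rate r₀) O := by
    intro q hq
    have hd := hdom _ hq.2
    have h1 := (contDiffAt_dradial (n := 0) hK (r₀ := r₀) hd).continuousAt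
    have h2 := (contDiffAt_psym (n := 0) hK (r₀ := r₀) hd).continuousAt
    have hρ := (hK.rho2_pos hd q.1.2).ne'
    have hξ := hOξ q hq
    refine ContinuousAt.continuousWithinAt ?_
    unfold Data.rate
    refine ContinuousAt.div (by fun_prop) ?_ (mul_ne_zero hρ (pow_ne_zero 2 hξ))
    unfold Data.rho2
    fun_prop
  have hcart : ContinuousOn (fun q : Phase => K.carter r₀ q / q.2.1 ^ 2) O := by
    intro q hq
    refine ContinuousAt.continuousWithinAt (ContinuousAt.div
      (contDiff_carter (n := 0) hK).continuous.continuousAt (by fun_prop)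
      (pow_ne_zero 2 (hOξ q hq)))
  -- All three conditions are homogeneous of degree 0 in the covector, so U is conic; the last one
  -- is what `exists_sq_radius_le` requires.
  set U : Set Phase := {q | q ∈ O ∧ lam < τ * K.rate r₀ q ∧ K.carter r₀ q / q.2.1 ^ 2 < 1} with hU
  have hUopen : IsOpen U := by
    have h1 := (hrate.const_smul τ).isOpen_inter_preimage hOopen (isOpen_Ioi (a := lam))
    have h2 := hcart.isOpen_inter_preimage hOopen (isOpen_Iio (a := 1))
    convert h1.inter h2 using 1
    ext q
    simp only [hU, mem_ofPred_eq, mem_inter_iff, mem_preimage, mem_Ioi, mem_Iio, Pi.smul_apply,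
      smul_eq_mul]
    tauto
  have hUconic : IsConic U := by
    rintro q ⟨⟨h1, h2⟩, h3, h4⟩ t ht
    refine ⟨⟨?_, h2⟩, by rwa [rate_smul q ht], by rwa [carter_div_smul q ht]⟩
    have : 0 < t * (ς * q.2.1) := mul_pos ht h1
    simpa [mul_left_comm] using this
  have hSU : signPart ς (K.conormal R) ⊆ U := by
    intro q hq
    have hchar := conormal_subset_char (r₀ := r₀) hK hs hq.1
    have hξ := xi_ne_zero_of_conormal hq.1
    have hρ := hK.rho2_pos hq.1.1.1 q.1.2
    have hρP := rho2_le hK hq.1.1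
    refine ⟨⟨hq.2, by rw [hq.1.2.1]; simpa using hε⟩, ?_, ?_⟩
    · have e : K.rate r₀ q = K.dmu R / K.rho2 q.1.1 q.1.2 := by
        unfold Data.rate
        rw [(psym_eq_zero_iff hK r₀ hchar.1).2 hchar.2]
        simp [Data.dradial, angMom, phiComp, hq.1.2.1, hq.1.2.2]
        rw [hq.1.2.1] at hρ
        field_simp
      rw [e, ← mul_div_assoc, hlam]
      refine div_lt_div_of_pos_left hdmu hρ ?_
      linarith
    · rw [carter_eq_zero_of_mem_conormal hq.1]; simp
  have hUD : ∀ q ∈ U ∩ K.cotangent, (q.1.1 - R) ^ 2 ≤ C * K.quadratic r₀ N q ∧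
      K.carter r₀ q / q.2.1 ^ 2 ≤ K.quadratic r₀ N q ∧ 0 ≤ K.quadratic r₀ N q := by
    rintro q ⟨hqU, hqD⟩
    have hQ0 := carter_nonneg hK hr₀ hqD
    have h1 := hnd q hqD hqU.1.2 (hOξ q hqU.1) hqU.2.2.le N hN1
    have h2 : 0 ≤ N * (K.psym r₀ q / q.2.1 ^ 2) ^ 2 := by positivity
    have h3 : 0 ≤ K.carter r₀ q / q.2.1 ^ 2 := by positivity
    refine ⟨h1, ?_, ?_⟩ <;> unfold Data.quadratic <;> linarith
  have hzero : ∀ q ∈ K.cotangent, 0 < ς * q.2.1 → q.1.1 = R → K.carter r₀ q = 0 →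
      q ∈ signPart ς (K.conormal R) := fun q h1 h2 h3 h4 =>
    ⟨⟨h1, h3, (carter_eq_zero_iff hK hr₀ h1).1 h4⟩, h2⟩
  have hsmooth : ∀ q ∈ U, ContDiffAt ℝ ((⊤ : ℕ∞) : WithTop ℕ∞) (K.quadratic r₀ N) q := by
    intro q hq
    have hd := hdom _ hq.1.2
    have h1 := contDiffAt_psym (n := ((⊤ : ℕ∞) : WithTop ℕ∞)) hK (r₀ := r₀) hd
    have h2 := (contDiff_carter (n := ((⊤ : ℕ∞) : WithTop ℕ∞)) hK (r₀ := r₀)).contDiffAt (x := q)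
    have hξ := pow_ne_zero 2 (hOξ q hq.1)
    have hx : ContDiffAt ℝ ((⊤ : ℕ∞) : WithTop ℕ∞) (fun q : Phase => q.2.1 ^ 2) q := by fun_prop
    exact (h2.div hx hξ).add (contDiffAt_const.mul ((h1.div hx hξ).pow 2))
  refine ⟨U, fun q => |q.2.1|⁻¹, K.quadratic r₀ N, hUopen, hUconic, hSU,
    isInfinityDefining_inv fun q hq => hOξ q hq.1, ?_, ?_, lam, hlampos, ?_⟩
  · refine ⟨fun q hq => (hsmooth q hq).contDiffWithinAt, fun q _ t ht => quadratic_smul N q ht,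
      fun q hq => (hUD q hq).2.2, fun q hq => ?_, ?_⟩
    · constructor
      · intro h0
        obtain ⟨h1, h2, -⟩ := hUD q hq
        rw [h0] at h1 h2
        have hξ := hOξ q hq.1.1
        refine hzero q hq.2 hq.1.1.1 ?_ ?_
        · have : q.1.1 - R = 0 := by
            refine pow_eq_zero_iff two_ne_zero |>.1 (le_antisymm (by linarith) (sq_nonneg _))
          linarith
        · have hQ0 := carter_nonneg hK hr₀ hq.2
          rw [div_le_iff₀ (by positivity), zero_mul] at h2
          linarith
      · intro h
        have hchar := conormal_subset_char (r₀ := r₀) hK hs h.1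
        unfold Data.quadratic
        rw [carter_eq_zero_of_mem_conormal h.1, (psym_eq_zero_iff hK r₀ hchar.1).2 hchar.2]
        simp
    · refine ⟨(C + CL)⁻¹, by positivity, fun q hq hnorm => ?_⟩
      obtain ⟨h1, h2, h3⟩ := hUD q hq
      have hξ := hOξ q hq.1.1
      have hmem : (((R, q.1.2), (q.2.1, 0)) : Phase) ∈ signPart ς (K.conormal R) :=
        ⟨⟨⟨hs.mem_dom hK, hq.2.2.1, by simp, by simp [hξ]⟩, rfl, rfl⟩, hq.1.1.1⟩
      have hdist : Metric.infDist q (signPart ς (K.conormal R)) ≤ max |q.1.1 - R| ‖q.2.2‖ := by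
        refine (Metric.infDist_le_dist_of_mem hmem).trans ?_
        rw [Prod.dist_eq, Prod.dist_eq, Prod.dist_eq]
        simp [Real.dist_eq]
      have hξ1 : q.2.1 ^ 2 ≤ 1 := by
        have : ‖q.2.1‖ ≤ 1 := by rw [← hnorm]; exact norm_fst_le q.2
        rw [Real.norm_eq_abs] at this
        exact (sq_le_one_iff_abs_le_one _).2 this
      have hη : ‖q.2.2‖ ^ 2 ≤ CL * K.quadratic r₀ N q := by
        -- On unit covectors ξ_r² ≤ 1, so Carter's constant is at most its quotient by ξ_r².
        have h5 := carter_lower hK hr₀ hq.2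
        have hQ0 := carter_nonneg hK hr₀ hq.2
        have h6 : K.carter r₀ q ≤ K.carter r₀ q / q.2.1 ^ 2 := le_div_self hQ0 (by positivity) hξ1
        calc ‖q.2.2‖ ^ 2 = CL * (K.lowFac r₀ ^ 2 / K.b * ‖q.2.2‖ ^ 2) := by
              rw [hCL]; field_simp
          _ ≤ CL * K.quadratic r₀ N q := by gcongr; linarith
      have hsq : Metric.infDist q (signPart ς (K.conormal R)) ^ 2
          ≤ (q.1.1 - R) ^ 2 + ‖q.2.2‖ ^ 2 := by
        calc _ ≤ (max |q.1.1 - R| ‖q.2.2‖) ^ 2 := by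
              gcongr
              exact Metric.infDist_nonneg
          _ ≤ _ := by
              rcases max_choice |q.1.1 - R| ‖q.2.2‖ with h | h <;> rw [h]
              · rw [sq_abs]; linarith [sq_nonneg ‖q.2.2‖]
              · linarith [sq_nonneg (q.1.1 - R)]
      rw [inv_mul_le_iff₀ (by positivity)]
      linarith
  · intro q hq
    have hρ := hK.rho2_pos hq.1.1.1 q.1.2
    rw [hq.1.2.1] at hρ
    rw [fderiv_inv_abs_ham hK hr₀ hs A σ hς hq, show ς * τ * (ς * K.dmu R / K.rho2 R q.1.2)
      = ς * ς * (τ * K.dmu R) / K.rho2 R q.1.2 by ring, hς, one_mul]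
    positivity
  · rintro q ⟨hqU, hqD⟩
    have hξ := hOξ q hqU.1
    have hρ := hK.rho2_pos hqD.1 q.1.2
    have hder : fderiv ℝ (K.quadratic r₀ N) q (ham (K.symb r₀ A σ) q)
        = 2 * q.2.1 * K.rate r₀ q
          * (K.carter r₀ q / q.2.1 ^ 2 + 2 * N * (K.psym r₀ q / q.2.1 ^ 2) ^ 2)
        + K.psym r₀ q / q.2.1 ^ 2 / K.rho2 q.1.1 q.1.2
          * (4 * K.a ^ 2 * K.c q.1.2 * q.1.2 2 * q.2.2 2) := by
      rw [ham_of_cotangent hK hr₀ A σ hqD]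
      refine fderiv_apply_of_hasDerivAt ((hsmooth q hqU).differentiableAt (by simp)) ?_
      have := hasDerivAt_quadratic_ham hK (hasDerivAt_line_ham r₀ q) (by simpa using hqD)
        (by simpa using hξ) N
      simp only [zero_smul, add_zero] at this
      exact this
    have habs : |q.2.1|⁻¹ = ς * q.2.1⁻¹ := by
      have hpos : 0 < ς * q.2.1 := hqU.1.1
      rcases mul_self_eq_one_iff.1 hς with rfl | rfl
      · rw [abs_of_pos (by linarith)]; ring
      · rw [abs_of_neg (by linarith)]; ring
    rw [hder]
    simp only [habs]
    set Qh := K.carter r₀ q / q.2.1 ^ 2 with hQh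
    set p := K.psym r₀ q / q.2.1 ^ 2 with hp
    have hQ0 := carter_nonneg hK hr₀ hqD
    have hQh0 : 0 ≤ Qh := by positivity
    set x := Real.sqrt Qh with hx
    have hx2 : x ^ 2 = Qh := Real.sq_sqrt hQh0
    set w := 4 * K.a ^ 2 * K.c q.1.2 * q.1.2 2 * (q.2.2 2 / q.2.1) / K.rho2 q.1.1 q.1.2 with hw
    have hwabs : |w| ≤ M * x := by
      have hη : |q.2.2 2 / q.2.1| ≤ Real.sqrt CL * x := by
        rw [hx, ← Real.sqrt_mul hCLpos.le]
        refine Real.abs_le_sqrt ?_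
        rw [hQh, div_pow, ← mul_div_assoc]
        gcongr
        have h1 : q.2.2 2 ^ 2 ≤ ‖q.2.2‖ ^ 2 := by
          rw [norm_sq_V]; nlinarith [sq_nonneg (q.2.2 0), sq_nonneg (q.2.2 1)]
        have h5 := carter_lower hK hr₀ hqD
        calc _ ≤ ‖q.2.2‖ ^ 2 := h1
          _ = CL * (K.lowFac r₀ ^ 2 / K.b * ‖q.2.2‖ ^ 2) := by rw [hCL]; field_simp
          _ ≤ _ := by gcongr
      have hz : |q.1.2 2| ≤ 1 := (sq_le_one_iff_abs_le_one _).1 (z_sq_le hqD)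
      have hc := hK.c_pos q.1.2
      rw [hw, abs_div, abs_mul, abs_mul, abs_mul, abs_of_pos hρ, abs_of_pos hc,
        abs_of_nonneg (a := 4 * K.a ^ 2) (by positivity)]
      calc _ ≤ 4 * K.a ^ 2 * K.b * 1 * (Real.sqrt CL * x) / (K.re - K.δ) ^ 2 := by
            gcongr
            · exact hK.c_le_b hqD
            · exact le_rho2 hK hqD
        _ = M * x := by rw [hM]; ring
    rw [source_identity hς hξ hρ.ne', ← hw]
    have hquad : K.quadratic r₀ N q = Qh + N * p ^ 2 := rfl
    rw [hquad]
    exact source_inequality hlampos hs.sq hN hqU.2.1.le hx2 hwabs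

end Normal

theorem tendsto_neg_atBot_iff {α : Type*} {g : ℝ → α} {l : Filter α} {I : Set ℝ} :
    Tendsto (fun s : (-I : Set ℝ) => g (-s)) atBot l ↔ Tendsto (fun s : I => g s) atTop l := by
  have h := tendsto_neg_atTop_iff (g := fun s => g (-s)) (l := l) (I := -I)
  simp only [neg_neg] at h
  rw [← h]
  rw [neg_neg]

/-! ### The flow when `T` is tangent to the generators of a horizon -/

section Stable

variable {R τ : ℝ} {γ : ℝ → Phase} {I : Set ℝ}

theorem alpha_self (R : ℝ) : K.alpha R R = 0 := by simp [Data.alpha]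

/-- With r₀ = R the factor α vanishes at the horizon, and with it the angular velocity that would
otherwise be caused by ξ_r when a ≠ 0. -/
theorem flow_of_conormal (hmu : K.mu R = 0) {q : Phase} (hq : q ∈ K.conormal R) :
    K.flow R q = (0, (-(K.dmu R * q.2.1 / K.rho2 R q.1.2)) • q.2) := by
  have hη := hq.2.2
  have hL : angMom q = 0 := by simp [angMom, phiComp, hη]
  have hJ : angSq q = 0 := by simp [angSq, hη]
  refine Prod.ext (Prod.ext ?_ ?_) (Prod.ext ?_ ?_)
  · simp [Data.flow, Data.radVel, hq.2.1, hL, hmu]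
  · simp [Data.flow, Data.angVelocity, Data.fa, hq.2.1, hL, alpha_self, hη, dot]
  · simp [Data.flow, Data.dradial, hq.2.1, hL]; ring
  · simp [Data.flow, Data.angVelocity, Data.fa, Data.dcarter, hq.2.1, hL, hJ, alpha_self, hη, dot]

theorem isExactlyRadial_conormal (hK : K.Subextremal) (hs : K.IsSide R τ) (A : Pt → ℂ) (σ : ℂ) :
    IsExactlyRadial (K.symb R A σ) (K.conormal R) := by
  intro q hq
  have hR := hK.pos_of_mem (hs.mem_Icc hK)
  have hρ := hK.rho2_pos hq.1.1 q.1.2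
  rw [hq.2.1] at hρ
  have hd : K.dmu R ≠ 0 := fun h => by have := hs.dmu_pos hK; rw [h] at this; simp at this
  refine ⟨-(K.dmu R * q.2.1 / K.rho2 R q.1.2),
    neg_ne_zero.2 (div_ne_zero (mul_ne_zero hd (xi_ne_zero_of_conormal hq)) hρ.ne'), ?_⟩
  rw [ham_of_char hK hR A σ (conormal_subset_char hK hs hq), flow_of_conormal (hs.mu_zero hK) hq]

/-- Lines with respect to the horizon's own generator never cross the horizon. -/
theorem Data.IsMaxFlowLine.notMem_Ioo (hK : K.Subextremal) (hs : K.IsSide R τ)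
    (hγ : K.IsMaxFlowLine R γ I) {l : Filter I} [l.NeBot]
    (hl : Tendsto (fun s : I => (γ s).1.1) l (𝓝 (R - τ * K.δ))) :
    ∀ s ∈ I, (γ s).1.1 ∉ Ioo K.re K.rc := by
  intro s hsI hmem
  have hR := hK.pos_of_mem (hs.mem_Icc hK)
  have hline := hγ.1
  rcases (carter_nonneg hK hR (hline.mem s hsI).1).eq_or_lt with h0 | h0
  · rcases mem_conormal_of_carter_eq_zero hK hR (hline.mem s hsI) h0.symm with h | h
    · rw [h.2.1] at hmem; exact lt_irrefl _ hmem.1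
    · rw [h.2.1] at hmem; exact lt_irrefl _ hmem.2
  · obtain ⟨R', τ', hs', hside⟩ := hline.exists_side hK (hs.mem_Icc hK) fun t ht => by
      rw [hline.carter_eq hK ht hsI]; exact h0
    have hτ := hs.sq
    have hδ := hK.δ_pos
    -- The radius stays on one side of R = r₀, and the limit R - τδ identifies that side as the
    -- exterior one.
    have hlim : 0 ≤ τ' * (R - (R - τ * K.δ)) :=
      ge_of_tendsto ((hl.const_sub R).const_mul τ') (Eventually.of_forall fun t => (hside t t.2).le)
    have h1 := hside s hsI
    rcases hs with ⟨rfl, rfl⟩ | ⟨rfl, rfl⟩ <;> rcases hs'.cases with rfl | rfl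
    · linarith [hmem.1]
    · linarith
    · linarith
    · linarith [hmem.2]

/-- Lines in the conormal bundle reach fiber infinity in finite time. -/
theorem Data.IsMaxFlowLine.xi_tendsto_of_conormal {r₀ : ℝ} (hK : K.Subextremal) (hr₀ : 0 < r₀)
    (hs : K.IsSide R τ) (hγ : K.IsMaxFlowLine r₀ γ I)
    (hS : ∀ s ∈ I, γ s ∈ signPart (-τ) (K.conormal R)) :
    Tendsto (fun s : I => τ * (γ s).2.1) atTop atBot := by
  have hline := hγ.1
  obtain ⟨s₀, hs₀⟩ := hline.connected.nonempty
  have : Nonempty I := ⟨⟨s₀, hs₀⟩⟩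
  have hτ := hs.sq
  have hdmu := hs.dmu_pos hK
  set P := (K.rc + K.δ) ^ 2 + K.a ^ 2 with hP
  have hPpos : 0 < P := by have := hK.rc_pos; have := hK.δ_pos; positivity
  have hu : ∀ s ∈ I, 0 < -τ * (γ s).2.1 := fun s hsI => (hS s hsI).2
  have hξ : ∀ s ∈ I, (γ s).2.1 ≠ 0 := fun s hsI => xi_ne_zero_of_conormal (hS s hsI).1
  -- The Riccati equation for ξ_r becomes linear growth of its negative reciprocal v < 0, at a rate
  -- bounded below. So the interval is bounded, and by maximality v must tend to 0.
  set v : ℝ → ℝ := fun s => -(-τ * (γ s).2.1)⁻¹ with hv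
  have hvd : ∀ s ∈ I, HasDerivAt v (τ * K.dmu R / K.rho2 R (γ s).1.2) s := by
    intro s hsI
    have h1 := (((hasDerivAt_xi_flow (hline.deriv s hsI)).const_mul (-τ)).inv (hu s hsI).ne').neg
    refine h1.congr_deriv ?_
    have hm := (hS s hsI).1
    have hd : K.dradial r₀ (γ s) = K.dmu R * (γ s).2.1 ^ 2 := by
      simp [Data.dradial, angMom, phiComp, hm.2.1, hm.2.2]
    have hξs := hξ s hsI
    have hτ0 : τ ≠ 0 := by rintro rfl; norm_num at hτ
    rw [hd, hm.2.1]
    field_simp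
    linear_combination -(K.dmu R / K.rho2 R (γ s).1.2) * hτ
  have hlow : ∀ s ∈ I, τ * K.dmu R / P ≤ τ * K.dmu R / K.rho2 R (γ s).1.2 := by
    intro s hsI
    have hm := (hS s hsI).1
    have hρ := hK.rho2_pos hm.1.1 (γ s).1.2
    have hle := rho2_le hK hm.1
    rw [hm.2.1] at hρ hle
    gcongr
  have hconv : Convex ℝ I := hline.connected.isPreconnected.ordConnected.convex
  have hgrow : ∀ s ∈ I, ∀ t ∈ I, s ≤ t → τ * K.dmu R / P * (t - s) ≤ v t - v s := by
    refine hconv.mul_sub_le_image_sub_of_le_deriv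
      (fun s hsI => (hvd s hsI).continuousAt.continuousWithinAt)
      (fun s hsI => (hvd s (interior_subset hsI)).differentiableAt.differentiableWithinAt)
      fun s hsI => ?_
    rw [(hvd s (interior_subset hsI)).deriv]
    exact hlow s (interior_subset hsI)
  have hvneg : ∀ s ∈ I, v s < 0 := fun s hsI => neg_lt_zero.2 (inv_pos.2 (hu s hsI))
  have hc : 0 < τ * K.dmu R / P := by positivity
  have hbdd : BddAbove I := by
    refine ⟨max s₀ (s₀ + -v s₀ / (τ * K.dmu R / P)), fun s hsI => ?_⟩
    rcases le_total s s₀ with h | h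
    · exact h.trans (le_max_left _ _)
    · refine le_max_of_le_right ?_
      have h1 := hgrow s₀ hs₀ s hsI h
      have h2 := hvneg s hsI
      rw [← sub_le_iff_le_add', le_div_iff₀ hc]
      linarith
  have hmono : MonotoneOn v (I ∩ Ici s₀) := fun s hsI t htI hst => by
    have := hgrow s hsI.1 t htI.1 hst
    have : 0 ≤ τ * K.dmu R / P * (t - s) := mul_nonneg hc.le (by linarith)
    linarith
  obtain ⟨v₁, hv₁, -⟩ := exists_tendsto_of_monotoneOn hs₀ hmono fun s hsI => (hvneg s hsI).le
  have hv0 : v₁ = 0 := by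
    by_contra hne
    have hr : Tendsto (fun s : I => (γ s).1.1) atTop (𝓝 R) :=
      tendsto_const_nhds.congr fun s => ((hS s s.2).1.2.1).symm
    refine hγ.false_of_tendsto hK hr₀ hbdd (hs.mem_dom hK) hr (ξ₁ := τ * v₁⁻¹) ?_
      (Or.inl (mul_ne_zero (by rintro rfl; norm_num at hτ) (inv_ne_zero hne)))
    refine ((hv₁.inv₀ hne).const_mul τ).congr fun s => ?_
    rw [hv]
    simp only [neg_mul, inv_neg, neg_neg, inv_inv]
    linear_combination (γ s).2.1 * hτ
  have hlim : Tendsto (fun s : I => v s) atTop (𝓝[<] 0) :=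
    tendsto_nhdsWithin_iff.2 ⟨hv0 ▸ hv₁, Eventually.of_forall fun s => hvneg s s.2⟩
  refine (tendsto_inv_nhdsLT_zero.comp hlim).congr fun s => ?_
  simp [hv]

/-- Estimates near a horizon for the flow of its own generator. -/
theorem exists_near_horizon (hK : K.Subextremal) (hs : K.IsSide R τ) {ε : ℝ} (hε : 0 < ε) :
    ∃ ε' > 0, ∀ q ∈ K.Char R, |q.1.1 - R| < ε' →
      ‖q.2.2‖ < ε * |q.2.1| ∧ (K.carter R q = 0 → q.1.1 = R) ∧
        (0 < K.carter R q → ¬ 0 < τ * (q.1.1 - R)) := by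
  have hR := hK.pos_of_mem (hs.mem_Icc hK)
  have hdom := hs.mem_dom hK
  have hb := hK.b_pos
  have hd0 := lowFac_pos (K := K) hR
  have hdmu := hs.dmu_pos hK
  have hτ := hs.sq
  set CL := K.b / K.lowFac R ^ 2 with hCL
  have hCLpos : 0 < CL := by positivity
  have hfac := (hK.fa_analyticAt R hdom).continuousAt
  have hhac := (hK.ha_analyticAt R hdom).continuousAt
  have hmuc : ContinuousAt K.mu R := (contDiff_mu (n := 0)).continuous.continuousAt
  have hfa0 : K.fa R R = 0 := by simp [Data.fa, alpha_self]
  have hha0 : K.ha R R = 0 := by simp [Data.ha, alpha_self]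
  have h1 : ∀ᶠ r in 𝓝 R, K.b ^ 2 * |K.ha R r| * CL < 1 / 4 := by
    have : ContinuousAt (fun r => K.b ^ 2 * |K.ha R r| * CL) R := by fun_prop
    refine this.eventually (gt_mem_nhds ?_)
    simp only [hha0]; norm_num
  have h2 : ∀ᶠ r in 𝓝 R, CL * (2 * (|K.mu r| + 4 * K.b ^ 2 * K.fa R r ^ 2 * CL)) < ε ^ 2 := by
    have : ContinuousAt (fun r => CL * (2 * (|K.mu r| + 4 * K.b ^ 2 * K.fa R r ^ 2 * CL))) R := by
      fun_prop
    refine this.eventually (gt_mem_nhds ?_)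
    simp only [hfa0, hs.mu_zero hK]
    simpa using pow_pos hε 2
  -- On the inner side V ≤ (b²α²C - μ)Q, where C is the constant `CL`. As α² vanishes to second
  -- order at R and μ only to first, this is negative there, so the characteristic set has no points
  -- with Q > 0 just inside.
  have h3 : ∀ᶠ r in 𝓝 R, 0 < τ * (r - R) → K.b ^ 2 * K.alpha R r ^ 2 * CL - K.mu r < 0 := by
    have hd : HasDerivAt (fun r => K.b ^ 2 * K.alpha R r ^ 2 * CL - K.mu r) (-K.dmu R) R := by
      have := ((((hasDerivAt_alpha (K := K) R R).pow 2).const_mul (K.b ^ 2)).mul_const CL).sub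
        (hasDerivAt_mu (K := K) R)
      refine HasDerivAt.congr_deriv this ?_
      rw [alpha_self]; simp
    have hev := ((hasDerivAt_iff_tendsto_slope.1 hd).const_mul τ).eventually
      (gt_mem_nhds (show τ * -K.dmu R < 0 by linarith))
    rw [eventually_nhdsWithin_iff] at hev
    filter_upwards [hev] with r hr hpos
    have hne : r ≠ R := by rintro rfl; simp at hpos
    have := hr hne
    rw [slope_def_field, alpha_self, hs.mu_zero hK] at this
    simp only [ne_eq, OfNat.ofNat_ne_zero, not_false_eq_true, zero_pow, mul_zero, zero_mul,
      sub_zero] at this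
    have hk := mul_neg_of_neg_of_pos this hpos
    have hsub : r - R ≠ 0 := sub_ne_zero.2 hne
    have e : τ * ((K.b ^ 2 * K.alpha R r ^ 2 * CL - K.mu r) / (r - R)) * (τ * (r - R))
        = K.b ^ 2 * K.alpha R r ^ 2 * CL - K.mu r := by
      field_simp
      linear_combination (K.b ^ 2 * K.alpha R r ^ 2 * CL - K.mu r) * hτ
    linarith
  have h4 : ∀ᶠ r in 𝓝 R, |r - R| < K.rc - K.re := by
    have : ContinuousAt (fun r => |r - R|) R := by fun_prop
    refine this.eventually (gt_mem_nhds ?_)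
    simpa using hK.re_lt
  obtain ⟨ε', hε', hball⟩ := Metric.eventually_nhds_iff.1 (h1.and (h2.and (h3.and h4)))
  refine ⟨ε', hε', fun q hq hqr => ?_⟩
  obtain ⟨b1, b2, b3, b4⟩ := hball (y := q.1.1) (by rwa [Real.dist_eq])
  have hQ0 := carter_nonneg hK hR hq.1
  have hL := angMom_sq_le_carter hK hR hq.1
  rw [← hCL] at hL
  refine ⟨?_, fun h0 => ?_, fun hQ hpos => ?_⟩
  · -- the characteristic equation bounds Carter's constant by `ξ²`
    have hchar := hq.2
    rw [radial_eq] at hchar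
    set Q := K.carter R q with hQ
    set L := angMom q with hLdef
    set ξ := q.2.1 with hξdef
    set F := K.fa R q.1.1 with hF
    set H := K.ha R q.1.1 with hH
    have t1 : K.b ^ 2 * H * L ^ 2 ≤ 1 / 4 * Q := by
      calc K.b ^ 2 * H * L ^ 2 ≤ K.b ^ 2 * |H| * (CL * Q) := by
            gcongr
            exact le_abs_self H
        _ = K.b ^ 2 * |H| * CL * Q := by ring
        _ ≤ 1 / 4 * Q := by gcongr
    -- The mixed term is split by the arithmetic-geometric mean inequality so that only a quarter of
    -- Q is spent; with `t1`, half of Q remains on the left.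
    have t2 : 2 * K.b * F * L * ξ ≤ 1 / 4 * Q + 4 * K.b ^ 2 * F ^ 2 * CL * ξ ^ 2 := by
      have : 0 ≤ (L / (2 * CL) - 2 * K.b * F * ξ) ^ 2 := sq_nonneg _
      have e : CL * (L / (2 * CL) - 2 * K.b * F * ξ) ^ 2
          = L ^ 2 / (4 * CL) - 2 * K.b * F * L * ξ + 4 * K.b ^ 2 * F ^ 2 * CL * ξ ^ 2 := by
        field_simp; ring
      have h5 : L ^ 2 / (4 * CL) ≤ 1 / 4 * Q := by
        rw [div_le_iff₀ (by positivity)]; linarith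
      have h6 := mul_nonneg hCLpos.le this
      linarith
    have t3 : -(K.mu q.1.1 * ξ ^ 2) ≤ |K.mu q.1.1| * ξ ^ 2 := by
      have := neg_abs_le (K.mu q.1.1)
      nlinarith [sq_nonneg ξ]
    have t4 : Q ≤ 2 * (|K.mu q.1.1| + 4 * K.b ^ 2 * F ^ 2 * CL) * ξ ^ 2 := by linarith
    have hξ0 : ξ ≠ 0 := by
      intro h
      rw [h] at t4
      have hQz : Q = 0 := by linarith
      have := (carter_eq_zero_iff hK hR hq.1).1 hQz
      exact hq.1.2.2.2 (Prod.ext h this)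
    have hlow := carter_lower hK hR hq.1
    have hn : ‖q.2.2‖ ^ 2 ≤ CL * Q := by
      calc ‖q.2.2‖ ^ 2 = CL * (K.lowFac R ^ 2 / K.b * ‖q.2.2‖ ^ 2) := by
            rw [hCL]; field_simp
        _ ≤ _ := by gcongr
    have hfin : ‖q.2.2‖ ^ 2 < (ε * |ξ|) ^ 2 := by
      have hξ2 : 0 < ξ ^ 2 := by positivity
      calc ‖q.2.2‖ ^ 2 ≤ CL * Q := hn
        _ ≤ CL * (2 * (|K.mu q.1.1| + 4 * K.b ^ 2 * F ^ 2 * CL) * ξ ^ 2) := by gcongr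
        _ = CL * (2 * (|K.mu q.1.1| + 4 * K.b ^ 2 * F ^ 2 * CL)) * ξ ^ 2 := by ring
        _ < ε ^ 2 * ξ ^ 2 := by gcongr
        _ = _ := by rw [mul_pow, sq_abs]
    exact lt_of_pow_lt_pow_left₀ 2 (by positivity) hfin
  · rcases mem_conormal_of_carter_eq_zero hK hR hq h0 with h | h <;>
      rcases hs with ⟨rfl, rfl⟩ | ⟨rfl, rfl⟩
    · exact h.2.1
    · rw [h.2.1, abs_sub_comm, abs_of_pos (by linarith [hK.re_lt])] at b4
      exact absurd b4 (lt_irrefl _)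
    · rw [h.2.1, abs_of_pos (by linarith [hK.re_lt])] at b4
      exact absurd b4 (lt_irrefl _)
    · exact h.2.1
  · have hY := radVel_sq hK hq
    unfold Data.pot at hY
    have hk := mul_neg_of_neg_of_pos (b3 hpos) hQ
    have : K.b ^ 2 * K.alpha R q.1.1 ^ 2 * angMom q ^ 2
        ≤ K.b ^ 2 * K.alpha R q.1.1 ^ 2 * (CL * K.carter R q) := by gcongr
    nlinarith [sq_nonneg (K.radVel R q)]

/-- The unit conormals over the horizon form a compact sphere, so an open conic neighbourhood
contains a cone of uniform width around them. -/
theorem exists_cone_subset (hK : K.Subextremal) (hs : K.IsSide R τ) {ς : ℝ} (hς : ς * ς = 1)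
    {U : Set Phase} (hU : IsOpen U) (hUc : IsConic U) (hSU : signPart ς (K.conormal R) ⊆ U) :
    ∃ ε > 0, ∀ q ∈ K.cotangent, |q.1.1 - R| < ε → 0 < ς * q.2.1 → ‖q.2.2‖ < ε * |q.2.1| → q ∈ U := by
  set Z : Set Phase := (fun ω : V => ((R, ω), (ς, 0))) '' Metric.sphere 0 1 with hZ
  have hZc : IsCompact Z := (isCompact_sphere _ _).image (by fun_prop)
  have hZU : Z ⊆ U := by
    rintro _ ⟨ω, hω, rfl⟩
    exact hSU (mem_signPart_unit hς (hs.mem_dom hK) (by simpa using hω)).1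
  obtain ⟨ε, hε, hth⟩ := hZc.exists_thickening_subset_open hU hZU
  refine ⟨ε, hε, fun q hq h1 h2 h3 => ?_⟩
  have hξ : q.2.1 ≠ 0 := by intro h; rw [h] at h2; simp at h2
  have habs : 0 < |q.2.1| := abs_pos.2 hξ
  have hx : |q.2.1|⁻¹ * q.2.1 = ς := by
    rcases mul_self_eq_one_iff.1 hς with rfl | rfl
    · rw [abs_of_pos (by linarith)]; field_simp
    · rw [abs_of_neg (by linarith)]; field_simp
  have hmem : (q.1, |q.2.1|⁻¹ • q.2) ∈ U := by
    refine hth (Metric.mem_thickening_iff.2 ⟨_, ⟨q.1.2, by simpa using hq.2.1, rfl⟩, ?_⟩)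
    rw [Prod.dist_eq, Prod.dist_eq, Prod.dist_eq]
    simp only [dist_self, Prod.smul_fst, Prod.smul_snd, smul_eq_mul, hx, dist_zero_right]
    refine max_lt (max_lt (by rwa [Real.dist_eq]) hε) (max_lt hε ?_)
    rw [norm_smul, norm_inv, Real.norm_eq_abs, abs_abs, inv_mul_lt_iff₀ habs]
    linarith
  have := hUc _ hmem |q.2.1| habs
  simpa [smul_smul, habs.ne'] using this

/-- W prescribes |r - R| small, τξ_r > 0 and E < 0. Lines with Q > 0 then lie outside the horizon,
and backwards in time their radius moves monotonically towards R. So the estimate |η| < ε|ξ_r|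
persists and keeps them in U. -/
theorem exists_stable_neighborhood (hK : K.Subextremal) (hs : K.IsSide R τ)
    {U : Set Phase} (hU : IsOpen U) (hUc : IsConic U) (hSU : signPart τ (K.conormal R) ⊆ U) :
    ∃ W, IsOpen W ∧ IsConic W ∧ signPart τ (K.conormal R) ⊆ W ∧
      ∀ γ I, K.IsMaxFlowLine R γ I → ∀ s₀ ∈ I, γ s₀ ∈ W → (∀ s ∈ I, s ≤ s₀ → γ s ∈ U) ∧
        Tendsto (fun s : I => (γ s).1.1) atBot (𝓝 R) ∧
        Tendsto (fun s : I => τ * (γ s).2.1) atBot atTop := by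
  have hR := hK.pos_of_mem (hs.mem_Icc hK)
  have hτ := hs.sq
  have hb := hK.b_pos
  obtain ⟨ε, hε, hcone⟩ := exists_cone_subset hK hs hτ hU hUc hSU
  obtain ⟨ε', hε', hnear⟩ := exists_near_horizon hK hs hε
  obtain ⟨ε'', hε'', hball⟩ := Metric.isOpen_iff.1 (isOpen_Ioo : IsOpen K.dom) R (hs.mem_dom hK)
  set e := min ε (min ε' ε'') with he
  have hepos : 0 < e := lt_min hε (lt_min hε' hε'')
  have he1 : ∀ {x : ℝ}, |x - R| < e → |x - R| < ε ∧ |x - R| < ε' ∧ x ∈ K.dom := fun h =>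
    ⟨h.trans_le (min_le_left _ _), h.trans_le ((min_le_right _ _).trans (min_le_left _ _)),
      hball (by rw [Metric.mem_ball, Real.dist_eq]
                exact h.trans_le ((min_le_right _ _).trans (min_le_right _ _)))⟩
  set O : Set Phase := {q | |q.1.1 - R| < e ∧ 0 < τ * q.2.1} with hO
  have hOopen : IsOpen O := by
    have h1 : IsOpen {q : Phase | |q.1.1 - R| < e} := isOpen_lt (by fun_prop) continuous_const
    have h2 : IsOpen {q : Phase | 0 < τ * q.2.1} := isOpen_lt continuous_const (by fun_prop)
    exact h1.inter h2
  have hEc : ContinuousOn (K.energy R) O := fun q hq =>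
    (continuousAt_energy hK (he1 hq.1).2.2).continuousWithinAt
  refine ⟨O ∩ K.energy R ⁻¹' Iio 0, hEc.isOpen_inter_preimage hOopen isOpen_Iio, ?_, ?_, ?_⟩
  · rintro q ⟨⟨h1, h2⟩, h3⟩ t ht
    refine ⟨⟨h1, ?_⟩, ?_⟩
    · have : 0 < t * (τ * q.2.1) := mul_pos ht h2
      simpa [mul_left_comm] using this
    · have e : K.energy R (q.1, t • q.2) = t * K.energy R q := by
        unfold Data.energy; rw [angMom_smul]; simp; ring
      rw [mem_preimage, e]
      exact mul_neg_of_pos_of_neg ht h3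
  · intro q hq
    refine ⟨⟨by rw [hq.1.2.1]; simpa using hepos, hq.2⟩, ?_⟩
    have e : K.energy R q = -(K.b * (τ * q.2.1)) := by
      simp [Data.energy, angMom, phiComp, hq.1.2.1, hq.1.2.2, hs.f_eq hK]; ring
    rw [mem_preimage, e]
    exact neg_lt_zero.2 (mul_pos hb hq.2)
  · rintro γ I hγ s₀ hs₀ ⟨⟨h1, h2⟩, hE0⟩
    have hline := hγ.1
    obtain ⟨hη, hz, hpos⟩ := hnear _ (hline.mem s₀ hs₀) (he1 h1).2.1
    rcases (carter_nonneg hK hR (hline.mem s₀ hs₀).1).eq_or_lt with h0 | h0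
    · have hmem : γ s₀ ∈ signPart τ (K.conormal R) :=
        ⟨⟨(hline.mem s₀ hs₀).1, hz h0.symm,
          (carter_eq_zero_iff hK hR (hline.mem s₀ hs₀).1).1 h0.symm⟩, h2⟩
      have hall := hline.mem_signPart hK hR hs₀ hmem
      refine ⟨fun s hsI _ => hSU (hall s hsI),
        tendsto_const_nhds.congr fun s => ((hall s s.2).1.2.1).symm, ?_⟩
      have h3 := hγ.rev.xi_tendsto_of_conormal hK hR hs fun s hsI => by
        have hm := hall (-s) hsI
        refine ⟨⟨cotangent_flip.2 hm.1.1, hm.1.2.1, ?_⟩, ?_⟩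
        · simp [KdS.rev, flip, hm.1.2.2]
        · have := hm.2
          simpa [KdS.rev, flip] using this
      have h4 : Tendsto (fun s : (-I : Set ℝ) => τ * (γ (-s)).2.1) atTop atTop := by
        refine (tendsto_neg_atBot_atTop.comp h3).congr fun s => ?_
        simp [KdS.rev, flip]
      exact tendsto_neg_atTop_iff (g := fun s => τ * (γ s).2.1).1 h4
    · have hQ : ∀ s ∈ I, 0 < K.carter R (γ s) := fun s hsI => by
        rw [hline.carter_eq hK hsI hs₀]; exact h0
      have hE := hline.energy_neg hK hR hs₀ hE0
      have hside : ∀ s ∈ I, 0 < τ * (R - (γ s).1.1) := by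
        obtain ⟨R', τ', hs', hside⟩ := hline.exists_side hK (hs.mem_Icc hK) hQ
        have h5 := hside s₀ hs₀
        have h6 := hpos h0
        have : τ' = τ := by
          rcases hs.cases with rfl | rfl <;> rcases hs'.cases with rfl | rfl
          · rfl
          · exfalso; apply h6; linarith
          · exfalso; apply h6; linarith
          · rfl
        rwa [this] at hside
      refine ⟨?_, hγ.backward_infinity hK (hs.mem_Icc hK) hs hQ hE hside⟩
      have hclose : ∀ s ∈ I, s ≤ s₀ → |(γ s).1.1 - R| < e := by
        intro s hsI hss
        have hmono := hline.monotoneOn_radius hK (κ := -τ) (s₁ := s) fun t ht _ => by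
          have := radVel_neg_outside hK hs (hline.mem t ht) (hQ t ht) (hE t ht)
            (by linarith [hside t ht])
          linarith
        have h5 := hmono ⟨hsI, self_mem_Ici⟩ ⟨hs₀, hss⟩ hss
        simp only at h5
        have h6 := hside s hsI
        have h7 := hside s₀ hs₀
        rw [abs_lt] at h1 ⊢
        rcases hs.cases with rfl | rfl
        · constructor <;> linarith
        · constructor <;> linarith
      have hJ : IsConnected (I ∩ Iic s₀) :=
        ⟨⟨s₀, hs₀, self_mem_Iic⟩, (hline.connected.isPreconnected.ordConnected.inter
          ordConnected_Iic).isPreconnected⟩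
      -- The strict bound |η| < ε|ξ_r| excludes ξ_r = 0, so the sign of ξ_r cannot change.
      have hsign : ∀ s ∈ I ∩ Iic s₀, 0 < τ * (γ s).2.1 := by
        rcases forall_pos_or_forall_neg (g := fun s => τ * (γ s).2.1) hJ
          (fun t ht => ((continuous_snd.fst.continuousAt.comp
            (hline.continuousAt ht.1)).const_smul τ).continuousWithinAt)
          (fun t ht h => by
            have h5 := (hnear _ (hline.mem t ht.1) (he1 (hclose t ht.1 ht.2)).2.1).1
            have hτ0 : τ ≠ 0 := by rintro rfl; norm_num at hτ
            rw [(mul_eq_zero.1 h).resolve_left hτ0] at h5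
            simp at h5
            linarith [norm_nonneg (γ t).2.2]) with h5 | h5
        · exact h5
        · exact absurd h2 (not_lt.2 (h5 s₀ ⟨hs₀, self_mem_Iic⟩).le)
      intro s hsI hss
      have h5 := hclose s hsI hss
      exact hcone _ (hline.mem s hsI).1 (he1 h5).1 (hsign s ⟨hsI, hss⟩)
        (hnear _ (hline.mem s hsI) (he1 h5).2.1).1

theorem isStableRadialSource_signPart (hK : K.Subextremal) (hs : K.IsSide R τ) (A : Pt → ℂ)
    (σ : ℂ) : IsStableRadialSource K.cotangent (K.symb R A σ) (signPart τ (K.conormal R)) := by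
  have hR := hK.pos_of_mem (hs.mem_Icc hK)
  refine ⟨fun q hq => isExactlyRadial_conormal hK hs A σ q hq.1, ?_, fun U hU hUc hSU => ?_⟩
  · have := isNormalSourceSink_signPart hK hR hs A σ hs.sq
    rwa [hs.sq] at this
  · obtain ⟨W, h1, h2, h3, h4⟩ := exists_stable_neighborhood hK hs hU hUc hSU
    refine ⟨W, h1, h2, h3, fun γ I hγ s₀ hs₀ hW => ?_⟩
    have hγ' := (isMaximalBichar_iff hK hR A σ γ I).1 hγ
    obtain ⟨a1, a2, a3⟩ := h4 γ I hγ' s₀ hs₀ hW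
    exact ⟨a1, hγ'.1.tendsToFiberInfinity hK hR hs.sq (hs.mem_dom hK) a2 a3⟩

theorem continuous_flip : Continuous flip := by unfold flip; fun_prop

theorem IsConic.preimage_flip {U : Set Phase} (hU : IsConic U) : IsConic (flip ⁻¹' U) := by
  intro q hq t ht
  have := hU _ hq t ht
  simpa [flip] using this

theorem signPart_flip {ς : ℝ} {q : Phase} :
    flip q ∈ signPart ς (K.conormal R) ↔ q ∈ signPart (-ς) (K.conormal R) := by
  have h : flip q ∈ K.conormal R ↔ q ∈ K.conormal R := by
    simp only [Data.conormal, mem_ofPred_eq, cotangent_flip]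
    simp [flip]
  simp only [signPart, mem_ofPred_eq, h]
  simp [flip]

/-- Reversing time and the covector exchanges the two sign parts and turns the source neighbourhood
into a sink neighbourhood. -/
theorem isStableRadialSink_signPart (hK : K.Subextremal) (hs : K.IsSide R τ) (A : Pt → ℂ)
    (σ : ℂ) : IsStableRadialSink K.cotangent (K.symb R A σ) (signPart (-τ) (K.conormal R)) := by
  have hR := hK.pos_of_mem (hs.mem_Icc hK)
  have hτ' : -τ * -τ = 1 := by linarith [hs.sq]
  refine ⟨fun q hq => isExactlyRadial_conormal hK hs A σ q hq.1, ?_, fun U hU hUc hSU => ?_⟩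
  · have := isNormalSourceSink_signPart hK hR hs A σ hτ'
    rwa [neg_mul, hs.sq] at this
  · obtain ⟨W, h1, h2, h3, h4⟩ := exists_stable_neighborhood hK hs (hU.preimage continuous_flip)
      hUc.preimage_flip fun q hq => hSU (signPart_flip.1 (by rwa [flip_flip]))
    refine ⟨flip ⁻¹' W, h1.preimage continuous_flip, h2.preimage_flip,
      fun q hq => h3 (signPart_flip.2 hq), fun γ I hγ s₀ hs₀ hW => ?_⟩
    have hγ' := (isMaximalBichar_iff hK hR A σ γ I).1 hγ
    obtain ⟨a1, a2, a3⟩ := h4 (rev γ) (-I) hγ'.rev (-s₀) (by simpa using hs₀)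
      (by simpa [rev] using hW)
    refine ⟨fun s hsI hss => ?_, hγ'.1.tendsToFiberInfinity hK hR hτ' (hs.mem_dom hK)
      (tendsto_neg_atBot_iff (g := fun s => (γ s).1.1).1 a2)
      (tendsto_neg_atBot_iff (g := fun s => -τ * (γ s).2.1).1 ?_)⟩
    · have := a1 (-s) (by simpa using hsI) (by linarith)
      simpa [rev, flip_flip] using this
    · refine a3.congr fun s => ?_
      simp [rev, flip]

end Stable

/-! ### Assembly of the global and local results -/

theorem Data.IsMaxFlowLine.start_end (hK : K.Subextremal) {r₀ : ℝ} (hr₀ : r₀ ∈ Icc K.re K.rc)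
    {γ : ℝ → Phase} {I : Set ℝ} (hγ : K.IsMaxFlowLine r₀ γ I)
    (hne : ∃ s ∈ I, γ s ∉ K.conormal K.re ∪ K.conormal K.rc) :
    ((∃ s ∈ I, 0 < K.timeComp r₀ (γ s)) → ∃ R τ, K.IsSide R τ ∧
      StartsAtInfinity (signPart τ (K.conormal R)) γ I ∧ EndsAtRadius (R - τ * K.δ) γ I) ∧
    ((∃ s ∈ I, K.timeComp r₀ (γ s) < 0) → ∃ R τ, K.IsSide R τ ∧
      StartsAtRadius (R - τ * K.δ) γ I ∧ EndsAtInfinity (signPart (-τ) (K.conormal R)) γ I) := by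
  have hr₀pos := hK.pos_of_mem hr₀
  have hline := hγ.1
  obtain ⟨s₀, hs₀, hout⟩ := hne
  -- A single point off both conormal bundles makes the conserved Carter constant positive along the
  -- whole line.
  have hQ0 : 0 < K.carter r₀ (γ s₀) := by
    refine (carter_nonneg hK hr₀pos (hline.mem s₀ hs₀).1).lt_of_ne fun h => hout ?_
    exact mem_conormal_of_carter_eq_zero hK hr₀pos (hline.mem s₀ hs₀) h.symm
  have hQ : ∀ s ∈ I, 0 < K.carter r₀ (γ s) := fun s hsI => by
    rw [hline.carter_eq hK hsI hs₀]; exact hQ0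
  obtain ⟨R, τ, hs, hside⟩ := hline.exists_side hK hr₀ hQ
  constructor
  · rintro ⟨s, hsI, ht⟩
    have hE := hline.energy_neg hK hr₀pos hsI
      ((timeComp_energy hK hr₀pos (hline.mem s hsI)).1 ht)
    exact ⟨R, τ, hs, hγ.future_directed hK hr₀ hs hQ hE hside⟩
  · rintro ⟨s, hsI, ht⟩
    have hE0 := (timeComp_energy hK hr₀pos (hline.mem s hsI)).2 ht
    have hE : ∀ t ∈ I, 0 < K.energy r₀ (γ t) := by
      intro t htI
      by_contra hcon
      have h1 := lt_of_le_of_ne (not_lt.1 hcon) (energy_ne_zero hK hr₀pos (hline.mem t htI))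
      exact lt_asymm hE0 (hline.energy_neg hK hr₀pos htI h1 s hsI)
    exact ⟨R, τ, hs, hγ.past_directed hK hr₀ hs hQ hE hside⟩

theorem horizon_flow (hK : K.Subextremal) {R τ : ℝ} (hs : K.IsSide R τ) (A : Pt → ℂ) (σ : ℂ) :
    (∀ γ I, IsMaximalBichar K.cotangent (K.symb R A σ) γ I →
        ((StartsAtInfinity (K.conormal R) γ I ∧ EndsAtRadius (R - τ * K.δ) γ I) ∨
          (StartsAtRadius (R - τ * K.δ) γ I ∧ EndsAtInfinity (K.conormal R) γ I)) →
        ∀ s ∈ I, (γ s).1.1 ∉ Ioo K.re K.rc) ∧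
      IsExactlyRadial (K.symb R A σ) (K.conormal R) ∧
      IsStableRadialSource K.cotangent (K.symb R A σ) (signPart τ (K.conormal R)) ∧
      IsStableRadialSink K.cotangent (K.symb R A σ) (signPart (-τ) (K.conormal R)) := by
  have hR := hK.pos_of_mem (hs.mem_Icc hK)
  refine ⟨fun γ I hγ h => ?_, isExactlyRadial_conormal hK hs A σ,
    isStableRadialSource_signPart hK hs A σ, isStableRadialSink_signPart hK hs A σ⟩
  have hγ' := (isMaximalBichar_iff hK hR A σ γ I).1 hγ
  have : Nonempty I := hγ'.1.connected.nonempty.to_subtype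
  rcases h with ⟨-, h⟩ | ⟨h, -⟩
  · exact hγ'.notMem_Ioo hK hs h.2
  · exact hγ'.notMem_Ioo hK hs h.2

end KdS

end


open KdS in
theorem proposition3p2 (K : Data) (hK : K.Subextremal) (r₀ : ℝ) (hr₀ : r₀ ∈ Set.Icc K.re K.rc)
    (A : Pt → ℂ) (hA : K.IsPotential A) (σ : ℂ)
    (D : Set Phase) (hD : D = K.cotangent) (p : Phase → ℂ) (hp : p = K.symb r₀ A σ)
    (Ne Nc : Set Phase) (hNe : Ne = K.conormal K.re) (hNc : Nc = K.conormal K.rc) :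
    (Ne ⊆ charSet D p ∧ Nc ⊆ charSet D p) ∧
    (IsGeneralizedRadial D p Ne ∧ IsGeneralizedRadial D p Nc) ∧
    (∀ γ I, IsMaximalBichar D p γ I → (∃ s ∈ I, γ s ∉ Ne ∪ Nc) →
      ((∃ s ∈ I, γ s ∈ K.sigmaPos r₀ p) →
        (StartsAtInfinity (posPart Ne) γ I ∧ EndsAtRadius (K.re - K.δ) γ I) ∨
        (StartsAtInfinity (negPart Nc) γ I ∧ EndsAtRadius (K.rc + K.δ) γ I)) ∧
      ((∃ s ∈ I, γ s ∈ K.sigmaNeg r₀ p) →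
        (StartsAtRadius (K.re - K.δ) γ I ∧ EndsAtInfinity (negPart Ne) γ I) ∨
        (StartsAtRadius (K.rc + K.δ) γ I ∧ EndsAtInfinity (posPart Nc) γ I))) ∧
    (IsNormalSource D p (posPart Ne) ∧ IsNormalSink D p (negPart Ne) ∧
      IsNormalSource D p (negPart Nc) ∧ IsNormalSink D p (posPart Nc)) ∧
    (r₀ = K.re →
      (∀ γ I, IsMaximalBichar D p γ I →
        ((StartsAtInfinity Ne γ I ∧ EndsAtRadius (K.re - K.δ) γ I) ∨
          (StartsAtRadius (K.re - K.δ) γ I ∧ EndsAtInfinity Ne γ I)) →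
        ∀ s ∈ I, (γ s).1.1 ∉ Set.Ioo K.re K.rc) ∧
      IsExactlyRadial p Ne ∧
      IsStableRadialSource D p (posPart Ne) ∧ IsStableRadialSink D p (negPart Ne)) ∧
    (r₀ = K.rc →
      (∀ γ I, IsMaximalBichar D p γ I →
        ((StartsAtInfinity Nc γ I ∧ EndsAtRadius (K.rc + K.δ) γ I) ∨
          (StartsAtRadius (K.rc + K.δ) γ I ∧ EndsAtInfinity Nc γ I)) →
        ∀ s ∈ I, (γ s).1.1 ∉ Set.Ioo K.re K.rc) ∧
      IsExactlyRadial p Nc ∧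
      IsStableRadialSource D p (negPart Nc) ∧ IsStableRadialSink D p (posPart Nc)) := by
  subst hD hp hNe hNc
  have hr₀pos := hK.pos_of_mem hr₀
  have hse : K.IsSide K.re 1 := Or.inl ⟨rfl, rfl⟩
  have hsc : K.IsSide K.rc (-1) := Or.inr ⟨rfl, rfl⟩
  have ee : K.re - 1 * K.δ = K.re - K.δ := by ring
  have ec : K.rc - -1 * K.δ = K.rc + K.δ := by ring
  have hge := isGeneralizedRadial_conormal hK hr₀pos hse A σ
  have hgc := isGeneralizedRadial_conormal hK hr₀pos hsc A σ
  simp only [posPart_eq, negPart_eq]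
  refine ⟨⟨hge.1, hgc.1⟩, ⟨hge, hgc⟩, fun γ I hγ hne => ?_, ⟨?_, ?_, ?_, ?_⟩, ?_, ?_⟩
  · have hγ' := (isMaximalBichar_iff hK hr₀pos A σ γ I).1 hγ
    obtain ⟨h1, h2⟩ := hγ'.start_end hK hr₀ hne
    constructor
    · rintro ⟨s, hsI, hm⟩
      obtain ⟨R, τ, ⟨rfl, rfl⟩ | ⟨rfl, rfl⟩, h3, h4⟩ := h1 ⟨s, hsI, hm.2⟩
      · rw [ee] at h4; exact Or.inl ⟨h3, h4⟩
      · rw [ec] at h4; exact Or.inr ⟨h3, h4⟩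
    · rintro ⟨s, hsI, hm⟩
      obtain ⟨R, τ, ⟨rfl, rfl⟩ | ⟨rfl, rfl⟩, h3, h4⟩ := h2 ⟨s, hsI, hm.2⟩
      · rw [ee] at h3; exact Or.inl ⟨h3, h4⟩
      · rw [ec] at h3; rw [neg_neg] at h4; exact Or.inr ⟨h3, h4⟩
  · simpa [IsNormalSource] using isNormalSourceSink_signPart hK hr₀pos hse A σ (ς := 1) (by norm_num)
  · simpa [IsNormalSink] using isNormalSourceSink_signPart hK hr₀pos hse A σ (ς := -1) (by norm_num)
  · simpa [IsNormalSource] using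
      isNormalSourceSink_signPart hK hr₀pos hsc A σ (ς := -1) (by norm_num)
  · simpa [IsNormalSink] using isNormalSourceSink_signPart hK hr₀pos hsc A σ (ς := 1) (by norm_num)
  · rintro rfl
    have := horizon_flow hK hse A σ
    rwa [ee] at this
  · rintro rfl
    have := horizon_flow hK hsc A σ
    rwa [ec, neg_neg] at this
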